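/- Let $H$ be a (real or complex) Hilbert space with norm $|\cdot|$, and let $A:D(A)\subset H\to H$ satisfy (A1) $A$ is self-adjoint and nonnegative, has a compact resolvent, and $|Au|\ge\omega|u|$ for all $u\in D(A)$, for some $\omega>0$. For $k\in\mathbb Z$ put $|u|_k=|A^{k/2}u|$; for $k\ge 0$ let $H_k=D(A^{k/2})$ with norm $|\cdot|_k$ (so $H_0=H$). For a pair $W=(w,w')$ let $e_k(W)=\tfrac12\big(|A^{k/2}w|^2+|A^{(k-1)/2}w'|^2\big)$. In complex spaces, $\langle\cdot,\cdot\rangle$ below stands for its real part. Let $n\ge 2$, and let $C_{i\,i-1},\Pi_i\in\mathcal L(H)$ for $2\le i\le n$. Consider the cascade system $$u_1''+Au_1=0,\qquad u_i''+Au_i+C_{i\,i-1}u_{i-1}=0\quad(2\le i\le n). \tag{S}$$ Its solutions $U=(u_1,\dots,u_n,u_1',\dots,u_n')$ are the finite energy (weak) solutions in $C([0,\infty);H_1^n\times H^n)$; strong solutions are those in $C([0,\infty);H_2^n\times H_1^n)\cap C^1([0,\infty);H_1^n\times H^n)$. Write $U_i=(u_i,u_i')$. Assume: (A2)$_n$ For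 all $i\in\{2,\dots,n\}$: $C_{i\,i-1}^*\in\mathcal L(H_k)$ for $k\in\{0,\dots,n-i+1\}$; with $\beta_i=\|C_{i\,i-1}\|$ we have $|C_{i\,i-1}w|^2\le\beta_i\langle C_{i\,i-1}w,w\rangle$ for all $w\in H$; and there is $\alpha_i>0$ with $\alpha_i|\Pi_iw|^2\le\langle C_{i\,i-1}w,w\rangle$ for all $w\in H$. (A3)$_n$ For all $i\in\{2,\dots,n\}$ there is $T_{0,i}>0$ such that for all $T>T_{0,i}$ there is $\gamma_i(T)>0$ such that all finite energy solutions $w$ of $w''+Aw=0$ satisfy $\int_0^T|\Pi_iw'|^2\,dt\ge\gamma_i(T)\,e_1(W)(0)$, where $W=(w,w')$. Let $G_n$ be a Hilbert space and let $\mathbf B_n^*:H_2\times H\to G_n$ be linear with (A4)$_n$ $\mathbf B_n^*\in\mathcal L(H_2\times H;G_n)$, and for all $T>0$ there is $D_n(T)>0$ such that for all strong solutions $w\in C([0,T];H_2)\cap C^1([0,T];H_1)\cap C^2([0,T];H)$ of $w''+Aw=f$, $$\int_0^T\|\mathbf B_n^*W\|_{G_n}^2dt\le D_n(T)\Big(e_1(W)(0)+e_1(W)(T)+\int_0^Te_1(W)(t)\,dt+\int_0^T|f|^2dt\Big).$$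 (A5)$_n$ There is $T_{0,n}>0$ such that for all $T>T_{0,n}$ there is $R_n(T)>0$ such that all strong solutions of $w''+Aw=0$ satisfy $\int_0^T\|\mathbf B_n^*W\|_{G_n}^2dt\ge R_n(T)\,e_1(W)(0)$. For a solution $W$ of (S), $\mathbf B_n^*W_n\in L^2(0,T;G_n)$ is defined pointwise if $W$ is a strong solution, and in general as the limit in $L^2(0,T;G_n)$ of $\mathbf B_n^*W_n^{(m)}$ for strong solutions $W^{(m)}$ of (S) with $W^{(m)}(0)\to W(0)$ in $H_1^n\times H^n$. Then there exist $T_n^*>0$, a constant $K>0$ and numbers $d_{i,n}(T)>0$ ($1\le i\le n$, $T>T_n^*$) such that for all solutions $W$ of (S) and all $T>T_n^*$ the observation $\mathbf B_n^*W_n\in L^2(0,T;G_n)$ exists and $$e_{1+i-n}(W_i)(0)\le d_{i,n}(T)\int_0^T\|\mathbf B_n^*W_n\|_{G_n}^2\,dt\qquad\forall\, i\in\{1,\dots,n\},$$ with $d_{i,n}(T)\le K/T^3$ for $i\in\{1,\dots,n-1\}$ and $d_{n,n}(T)\le K/T$, where $K$ does not depend on $T$. -/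

import Mathlib

open MeasureTheory Filter Topology Set

namespace CascadeObs

variable {𝕜 : Type*} [RCLike 𝕜] {H : Type*} [NormedAddCommGroup H] [InnerProductSpace 𝕜 H]

/-- The eigenspace `ker (A - μ)` of an unbounded operator `A` for a real number `μ`: all `x` such
that `(x, μ x)` lies in the graph of `A`. -/
def eigenspace (A : H →ₗ.[𝕜] H) (μ : ℝ) : Submodule 𝕜 H :=
  A.graph.comap (LinearMap.id.prod ((μ : 𝕜) • LinearMap.id))

/-- The operator `A` has a compact resolvent: for some `z` the operator `A - z` has an everywhere
defined inverse, and this inverse is compact. -/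
def HasCompactResolvent (A : H →ₗ.[𝕜] H) : Prop :=
  ∃ (z : 𝕜) (R : H →L[𝕜] H), IsCompactOperator R ∧
    (∀ x : H, ∃ h : R x ∈ A.domain, A ⟨R x, h⟩ - z • R x = x) ∧
    ∀ x : A.domain, R (A x - z • (x : H)) = x

/-- Assumption (A1): `A` is self-adjoint, nonnegative (so that its powers make sense), satisfies
`|A u| ≥ ω |u|` for some `ω > 0`, and has a compact resolvent. -/
structure A1 [CompleteSpace H] (A : H →ₗ.[𝕜] H) : Prop where
  selfAdjoint : IsSelfAdjoint A
  nonneg : ∀ u : A.domain, 0 ≤ RCLike.re (inner 𝕜 (A u) (u : H))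
  bounded_below : ∃ ω : ℝ, 0 < ω ∧ ∀ u : A.domain, ω * ‖(u : H)‖ ≤ ‖A u‖
  compactResolvent : HasCompactResolvent A

variable [CompleteSpace H]

/-- The orthogonal projection of `u` on the eigenspace of `A` for `μ`. -/
noncomputable def eigenProj (A : H →ₗ.[𝕜] H) (μ : ℝ) (u : H) : H :=
  (eigenspace A μ).topologicalClosure.starProjection u

/-- `u ∈ H_k = D(A^{k/2})`, through the spectral decomposition of `A`: `∑_μ μ^k |P_μ u|² < ∞`. For
`k ≤ 0` and under (A1) this holds for every `u ∈ H`. -/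
def MemH (A : H →ₗ.[𝕜] H) (k : ℤ) (u : H) : Prop :=
  Summable fun μ : ℝ => μ ^ k * ‖eigenProj A μ u‖ ^ 2

/-- The norm `|u|_k = |A^{k/2} u| = (∑_μ μ^k |P_μ u|²)^{1/2}`. -/
noncomputable def normH (A : H →ₗ.[𝕜] H) (k : ℤ) (u : H) : ℝ :=
  √(∑' μ : ℝ, μ ^ k * ‖eigenProj A μ u‖ ^ 2)

/-- The energy of level `k`: `e_k(u, v) = (|A^{k/2} u|² + |A^{(k-1)/2} v|²) / 2`. -/
noncomputable def energy (A : H →ₗ.[𝕜] H) (k : ℤ) (u v : H) : ℝ :=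
  (1 / 2) * (normH A k u ^ 2 + normH A (k - 1) v ^ 2)

/-- `u` is continuous on `S` with values in `H_k`. -/
def ContinuousInH (A : H →ₗ.[𝕜] H) (k : ℤ) (S : Set ℝ) (u : ℝ → H) : Prop :=
  ∀ t ∈ S, MemH A k (u t) ∧ Tendsto (fun s => normH A k (u s - u t)) (𝓝[S] t) (𝓝 0)

variable [NormedSpace ℝ H]

/-- `u` is differentiable on `S` with derivative `v`, for the norm of `H_k`. -/
def HasDerivInH (A : H →ₗ.[𝕜] H) (k : ℤ) (S : Set ℝ) (u v : ℝ → H) : Prop :=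
  ∀ t ∈ S, Tendsto (fun s => normH A k ((s - t)⁻¹ • (u s - u t) - v t)) (𝓝[S \ {t}] t) (𝓝 0)

/-- Finite energy (weak) solution `(w, w') = (w, v)` of `w'' + A w = f` on the time interval `S`:
`w ∈ C(S; H_1) ∩ C¹(S; H)`, and `(d/dt) ⟨φ, w'⟩ + ⟨A φ, w⟩ = ⟨φ, f⟩` for all `φ ∈ D(A)`. -/
structure IsWeakSol (A : H →ₗ.[𝕜] H) (f : ℝ → H) (S : Set ℝ) (w v : ℝ → H) : Prop where
  continuous_fst : ContinuousInH A 1 S w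
  continuous_snd : ContinuousOn v S
  deriv_fst : ∀ t ∈ S, HasDerivWithinAt w (v t) S t
  deriv_snd : ∀ φ : A.domain, ∀ t ∈ S,
    HasDerivWithinAt (fun s => inner 𝕜 (φ : H) (v s))
      (inner 𝕜 (φ : H) (f t) - inner 𝕜 (A φ) (w t)) S t

/-- Strong solution `(w, w') = (w, v)` of `w'' + A w = f` on the time interval `S`:
`w ∈ C(S; H_2) ∩ C¹(S; H_1) ∩ C²(S; H)`, where `H_2 = D(A)` has the norm `|A ·|`. -/
structure IsStrongSol (A : H →ₗ.[𝕜] H) (f : ℝ → H) (S : Set ℝ) (w : ℝ → A.domain) (v : ℝ → H) :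
    Prop where
  continuous_source : ContinuousOn f S
  continuous_fst : ContinuousOn (fun t => A (w t)) S
  continuous_snd : ContinuousInH A 1 S v
  deriv_fst : HasDerivInH A 1 S (fun t => (w t : H)) v
  deriv_snd : ∀ t ∈ S, HasDerivWithinAt v (f t - A (w t)) S t

/-- The source term of the `i`-th equation of the bi-diagonal cascade system: `0` for `i = 1` and
`-C_{i,i-1} w_{i-1}` for `i ≥ 2`. The operator `C_{i,i-1}` is written `C i`. -/
def cascadeSource (C : ℕ → H →L[𝕜] H) (w : ℕ → ℝ → H) (i : ℕ) (t : ℝ) : H :=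
  if 2 ≤ i then -(C i (w (i - 1) t)) else 0

/-- `W = (w_1, …, w_n, v_1, …, v_n)` is a finite energy solution on `[0, ∞)` of the cascade system
`w_1'' + A w_1 = 0`, `w_i'' + A w_i + C_{i,i-1} w_{i-1} = 0` for `2 ≤ i ≤ n`; here `v_i = w_i'`.
Components whose index is not in `{1, …, n}` play no role. -/
def IsCascadeSol (A : H →ₗ.[𝕜] H) (C : ℕ → H →L[𝕜] H) (n : ℕ) (w v : ℕ → ℝ → H) : Prop :=
  ∀ i, 1 ≤ i → i ≤ n → IsWeakSol A (cascadeSource C w i) (Ici 0) (w i) (v i)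

/-- Strong solution on `[0, ∞)` of the cascade system, that is, a solution in
`C([0, ∞); H_2^n × H_1^n) ∩ C¹([0, ∞); H_1^n × H^n)`. -/
def IsStrongCascadeSol (A : H →ₗ.[𝕜] H) (C : ℕ → H →L[𝕜] H) (n : ℕ)
    (w : ℕ → ℝ → A.domain) (v : ℕ → ℝ → H) : Prop :=
  ∀ i, 1 ≤ i → i ≤ n →
    IsStrongSol A (cascadeSource C (fun j t => (w j t : H)) i) (Ici 0) (w i) (v i)

/-- Assumption (A2) for the coupling operators `C_{i,i-1} = C i`, relative to the operators
`Π_i = P i`, `2 ≤ i ≤ n`. Here `β_i = ‖C i‖`. -/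
structure A2 (A : H →ₗ.[𝕜] H) (C P : ℕ → H →L[𝕜] H) (n : ℕ) : Prop where
  adjoint_bounded : ∀ i k : ℕ, 2 ≤ i → i ≤ n → k + i ≤ n + 1 → ∃ c : ℝ, ∀ u : H, MemH A k u →
    MemH A k (ContinuousLinearMap.adjoint (C i) u) ∧
      normH A k (ContinuousLinearMap.adjoint (C i) u) ≤ c * normH A k u
  sq_le : ∀ i : ℕ, 2 ≤ i → i ≤ n → ∀ w : H,
    ‖C i w‖ ^ 2 ≤ ‖C i‖ * RCLike.re (inner 𝕜 (C i w) w)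
  coercive : ∀ i : ℕ, 2 ≤ i → i ≤ n → ∃ α : ℝ, 0 < α ∧ ∀ w : H,
    α * ‖P i w‖ ^ 2 ≤ RCLike.re (inner 𝕜 (C i w) w)

/-- Assumption (A3): for `2 ≤ i ≤ n`, the operator `Π_i = P i`, applied to the velocity, observes
the free equation in all sufficiently large times. -/
def A3 (A : H →ₗ.[𝕜] H) (P : ℕ → H →L[𝕜] H) (n : ℕ) : Prop :=
  ∀ i : ℕ, 2 ≤ i → i ≤ n → ∃ T₀ : ℝ, 0 < T₀ ∧ ∀ T : ℝ, T₀ < T → ∃ γ : ℝ, 0 < γ ∧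
    ∀ w v : ℝ → H, IsWeakSol A (fun _ => 0) (Ici 0) w v →
      γ * energy A 1 (w 0) (v 0) ≤ ∫ t in (0 : ℝ)..T, ‖P i (v t)‖ ^ 2

variable {G : Type*} [NormedAddCommGroup G] [InnerProductSpace 𝕜 G]

/-- Assumption (A4): the observation operator `B` is bounded from `H_2 × H` to `G`, and it is
admissible. The inequality is required for the strong solutions only, for which `B (w, w')` is
defined pointwise; it extends to all finite energy solutions with square integrable source by
density. -/
structure A4 (A : H →ₗ.[𝕜] H) (B : A.domain × H →ₗ[𝕜] G) : Prop where
  bounded : ∃ c : ℝ, ∀ (u : A.domain) (v : H), ‖B (u, v)‖ ≤ c * (‖A u‖ + ‖v‖)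
  admissible : ∀ T : ℝ, 0 < T → ∃ D : ℝ, 0 < D ∧
    ∀ (f : ℝ → H) (w : ℝ → A.domain) (v : ℝ → H), IsStrongSol A f (Icc 0 T) w v →
      ∫ t in (0 : ℝ)..T, ‖B (w t, v t)‖ ^ 2 ≤
        D * (energy A 1 (w 0) (v 0) + energy A 1 (w T) (v T) +
          (∫ t in (0 : ℝ)..T, energy A 1 (w t) (v t)) + ∫ t in (0 : ℝ)..T, ‖f t‖ ^ 2)

/-- Assumption (A5): `B` observes the free equation in all sufficiently large times (required for
strong solutions only, as in (A4)). -/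
def A5 (A : H →ₗ.[𝕜] H) (B : A.domain × H →ₗ[𝕜] G) : Prop :=
  ∃ T₀ : ℝ, 0 < T₀ ∧ ∀ T : ℝ, T₀ < T → ∃ R : ℝ, 0 < R ∧
    ∀ (w : ℝ → A.domain) (v : ℝ → H), IsStrongSol A (fun _ => 0) (Ici 0) w v →
      R * energy A 1 (w 0) (v 0) ≤ ∫ t in (0 : ℝ)..T, ‖B (w t, v t)‖ ^ 2

/-- `y ∈ L²(0, T; G)` is the observation `B (W_n)` on `[0, T]` of the finite energy solution
`W = (w, v)` of the cascade system. For a strong solution it is the function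
`t ↦ B (w_n(t), w_n'(t))`; in general it is the limit in `L²(0, T; G)` of such functions for strong
solutions whose initial data converge to those of `W` in `H_1^n × H^n`. -/
def IsObservation (A : H →ₗ.[𝕜] H) (C : ℕ → H →L[𝕜] H) (n : ℕ) (B : A.domain × H →ₗ[𝕜] G)
    (w v : ℕ → ℝ → H) (T : ℝ) (y : ℝ → G) : Prop :=
  MemLp y 2 (volume.restrict (Ioc 0 T)) ∧
  ∃ (a : ℕ → ℕ → ℝ → A.domain) (b : ℕ → ℕ → ℝ → H),
    (∀ m, IsStrongCascadeSol A C n (a m) (b m)) ∧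
    (∀ i, 1 ≤ i → i ≤ n →
      Tendsto (fun m => normH A 1 ((a m i 0 : H) - w i 0)) atTop (𝓝 0) ∧
      Tendsto (fun m => b m i 0) atTop (𝓝 (v i 0))) ∧
    Tendsto (fun m => eLpNorm (fun t => B (a m n t, b m n t) - y t) 2 (volume.restrict (Ioc 0 T)))
      atTop (𝓝 0)

end CascadeObs

/-!
With `Λ = A ^ (-1/2)`, `r = A w` and `w' = Λ q`, the equation `w'' + A w = f` becomes the system
`(Λ r)' = q`, `(Λ q)' = f - r`, whose energies of all levels `k ≤ 1` are norms of `Λ ^ m r` and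
`Λ ^ m q`.

Observability of the cascade is proved by induction on its length. Pairing the equation of the last
component with the component before it, and conversely, shows that the integral of the coupling term
`⟨C_{n+1,n} w_n, w_n⟩` is a boundary term plus an integral of the source of the `n`-th equation
against `w_{n+1}`. The coupling term dominates `|Π_{n+1} w_n|²`, which is the observation of the
velocity of the primitive in time of the first `n` components; this primitive solves the same
cascade, one energy level higher. By induction the coupling integral therefore controls the energies
of the first `n` components, at one level below the one they are observed at, and hence also the
source in the last equation. That equation is observed through `B` over windows of a fixed length,
and for large `T` the contribution of its source is absorbed, with a gain of `T ^ (-2)` per step.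

This gives the estimate for strong solutions. Averaging a finite energy solution over the short
intervals `[t, t + h]` gives a strong solution of the same cascade, and `h → 0` gives the general
case, because the observation is continuous for the energy norm by admissibility.
-/

namespace CascadeObs

/-! ### Spectral decomposition of `A` and the operator `A^{-1/2}` -/

section Spectral

variable {𝕜 : Type*} [RCLike 𝕜] {H : Type*} [NormedAddCommGroup H] [InnerProductSpace 𝕜 H]
  {A : H →ₗ.[𝕜] H}

lemma mem_eigenspace_iff {μ : ℝ} {x : H} :
    x ∈ eigenspace A μ ↔ ∃ h : x ∈ A.domain, A ⟨x, h⟩ = (μ : 𝕜) • x := by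
  simp only [eigenspace, Submodule.mem_comap, LinearMap.prod_apply, Function.prod_apply,
    LinearPMap.mem_graph_iff]
  constructor
  · rintro ⟨⟨_, hx⟩, rfl, h⟩
    exact ⟨hx, h⟩
  · rintro ⟨hx, h⟩
    exact ⟨⟨x, hx⟩, rfl, h⟩

/-- `R` is the inverse of `A`, it is everywhere defined, and it is compact. -/
structure IsCompactInverse (A : H →ₗ.[𝕜] H) (R : H →L[𝕜] H) : Prop where
  isCompactOperator : IsCompactOperator R
  apply_inverse : ∀ x : H, ∃ h : R x ∈ A.domain, A ⟨R x, h⟩ = x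
  inverse_apply : ∀ x : A.domain, R (A x) = x

lemma IsCompactInverse.eigenspace_eq {R : H →L[𝕜] H} (hR : IsCompactInverse A R) {μ : ℝ}
    (hμ : μ ≠ 0) :
    eigenspace A μ = Module.End.eigenspace (R : Module.End 𝕜 H) ((μ⁻¹ : ℝ) : 𝕜) := by
  have hμ' : (μ : 𝕜) ≠ 0 := by simpa using hμ
  ext x
  rw [mem_eigenspace_iff, Module.End.mem_eigenspace_iff, ContinuousLinearMap.coe_coe,
    RCLike.ofReal_inv]
  constructor
  · rintro ⟨h, hx⟩
    rw [eq_inv_smul_iff₀ hμ', ← map_smul, ← hx, hR.inverse_apply]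
  · intro hx
    obtain ⟨h, hAR⟩ := hR.apply_inverse x
    have hxR : x = (μ : 𝕜) • R x := by rw [hx, smul_inv_smul₀ hμ']
    have hxA : x ∈ A.domain := hxR ▸ A.domain.smul_mem _ h
    refine ⟨hxA, ?_⟩
    rw [show (⟨x, hxA⟩ : A.domain) = (μ : 𝕜) • ⟨R x, h⟩ from Subtype.ext hxR,
      LinearPMap.map_smul, hAR]

variable [CompleteSpace H]

lemma A1.symmetric (hA : A1 A) (x y : A.domain) :
    inner 𝕜 (A x) (y : H) = inner 𝕜 (x : H) (A y) := by
  have h := LinearPMap.adjoint_isFormalAdjoint hA.selfAdjoint.dense_domain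
  rw [LinearPMap.isSelfAdjoint_def.1 hA.selfAdjoint] at h
  exact h x y

lemma A1.eq_zero_of_apply_eq_zero (hA : A1 A) {x : A.domain} (hx : A x = 0) : (x : H) = 0 := by
  obtain ⟨ω, hω, h⟩ := hA.bounded_below
  have hle : ω * ‖(x : H)‖ ≤ 0 := by simpa [hx] using h x
  exact norm_le_zero_iff.1 (nonpos_of_mul_nonpos_right hle hω)

lemma A1.isCompactInverse_of_apply_inverse (hA : A1 A) {R : H →L[𝕜] H}
    (hc : IsCompactOperator R) (hR : ∀ x : H, ∃ h : R x ∈ A.domain, A ⟨R x, h⟩ = x) :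
    IsCompactInverse A R where
  isCompactOperator := hc
  apply_inverse := hR
  inverse_apply x := by
    obtain ⟨h, hAR⟩ := hR (A x)
    have h0 : A (⟨R (A x), h⟩ - x) = 0 := by rw [LinearPMap.map_sub, hAR, sub_self]
    exact sub_eq_zero.1 (hA.eq_zero_of_apply_eq_zero h0)

-- If `(A - z)⁻¹ x = -z⁻¹ x`, then `A x = 0`, hence `x = 0`: the Fredholm alternative applies.
lemma A1.neg_inv_mem_resolventSet (hA : A1 A) {z : 𝕜} (hz : z ≠ 0) {R : H →L[𝕜] H}
    (hc : IsCompactOperator R)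
    (hR : ∀ x : H, ∃ h : R x ∈ A.domain, A ⟨R x, h⟩ - z • R x = x) :
    -z⁻¹ ∈ resolventSet 𝕜 R := by
  have hz' : -z⁻¹ ≠ 0 := by simpa using hz
  refine (hc.hasEigenvalue_or_mem_resolventSet hz').resolve_left fun he => ?_
  obtain ⟨x, hx⟩ := he.exists_hasEigenvector
  have hRx : R x = (-z⁻¹) • x := hx.apply_eq_smul
  obtain ⟨h, hAR⟩ := hR x
  have hARx : A ⟨R x, h⟩ = 0 := by
    have hzR : z • R x = -x := by rw [hRx, smul_smul]; simp [hz]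
    simpa [hzR] using hAR
  have hRx0 : R x = 0 := hA.eq_zero_of_apply_eq_zero hARx
  exact hx.2 ((smul_eq_zero.1 (hRx ▸ hRx0)).resolve_left hz')

lemma A1.exists_isCompactInverse (hA : A1 A) : ∃ R : H →L[𝕜] H, IsCompactInverse A R := by
  obtain ⟨z, Rz, hc, hRz, -⟩ := hA.compactResolvent
  rcases eq_or_ne z 0 with rfl | hz
  · exact ⟨Rz, hA.isCompactInverse_of_apply_inverse hc (by simpa using hRz)⟩
  obtain ⟨S, hS⟩ := (spectrum.mem_resolventSet_iff.1
    (hA.neg_inv_mem_resolventSet hz hc hRz)).exists_right_inv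
  have hS' : ∀ x, (-z⁻¹) • S x - Rz (S x) = x := fun x => by
    simpa [Algebra.algebraMap_eq_smul_one] using congr($hS x)
  -- With `S = (-z⁻¹ - (A - z)⁻¹)⁻¹` one has `A⁻¹ = -z⁻¹ (A - z)⁻¹ S`.
  refine ⟨Rz ∘L ((-z⁻¹) • S),
    hA.isCompactInverse_of_apply_inverse (hc.comp_clm _) fun x => ?_⟩
  obtain ⟨h, hx⟩ := hRz (((-z⁻¹) • S) x)
  refine ⟨h, ?_⟩
  rw [sub_eq_iff_eq_add] at hx
  calc A ⟨Rz (((-z⁻¹) • S) x), h⟩ = (-z⁻¹) • S x + z • Rz ((-z⁻¹) • S x) := hx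
    _ = (-z⁻¹) • S x - Rz (S x) := by
      rw [map_smul, smul_smul, mul_neg, mul_inv_cancel₀ hz, neg_one_smul, sub_eq_add_neg]
    _ = x := hS' x

lemma A1.isSymmetric_of_isCompactInverse (hA : A1 A) {R : H →L[𝕜] H} (hR : IsCompactInverse A R) :
    (R : H →ₗ[𝕜] H).IsSymmetric := by
  intro x y
  obtain ⟨hx, hAx⟩ := hR.apply_inverse x
  obtain ⟨hy, hAy⟩ := hR.apply_inverse y
  simpa [hAx, hAy] using (hA.symmetric ⟨R x, hx⟩ ⟨R y, hy⟩).symm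

lemma A1.exists_pos_forall_eigenspace_eq_bot (hA : A1 A) :
    ∃ ω : ℝ, 0 < ω ∧ ∀ μ < ω, eigenspace A μ = ⊥ := by
  obtain ⟨ω, hω, h⟩ := hA.bounded_below
  refine ⟨ω, hω, fun μ hμ => (Submodule.eq_bot_iff _).2 fun x hx => ?_⟩
  obtain ⟨hx, hAx⟩ := mem_eigenspace_iff.1 hx
  by_contra hne
  have hpos : 0 < ‖x‖ := norm_pos_iff.2 hne
  have hμ0 : 0 ≤ μ := by
    have hre := hA.nonneg ⟨x, hx⟩
    rw [hAx, inner_smul_left, RCLike.conj_ofReal, RCLike.re_ofReal_mul,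
      inner_self_eq_norm_sq] at hre
    exact nonneg_of_mul_nonneg_left hre (by positivity)
  have hωμ := h ⟨x, hx⟩
  rw [hAx, norm_smul, RCLike.norm_ofReal, abs_of_nonneg hμ0] at hωμ
  exact hμ.not_ge (le_of_mul_le_mul_right hωμ hpos)

lemma A1.isClosed_eigenspace (hA : A1 A) (μ : ℝ) : IsClosed (eigenspace A μ : Set H) := by
  rcases eq_or_ne μ 0 with rfl | hμ
  · obtain ⟨ω, hω, hbot⟩ := hA.exists_pos_forall_eigenspace_eq_bot
    rw [hbot 0 hω]
    exact isClosed_singleton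
  · obtain ⟨R, hR⟩ := hA.exists_isCompactInverse
    have hset : (eigenspace A μ : Set H) = {x | R x = ((μ⁻¹ : ℝ) : 𝕜) • x} := by
      rw [hR.eigenspace_eq hμ]
      ext x
      simp
    rw [hset]
    exact isClosed_eq R.continuous (continuous_const_smul _)

lemma A1.topologicalClosure_eigenspace (hA : A1 A) (μ : ℝ) :
    (eigenspace A μ).topologicalClosure = eigenspace A μ :=
  (hA.isClosed_eigenspace μ).submodule_topologicalClosure_eq

lemma A1.inner_eq_zero_of_ne (hA : A1 A) {μ ν : ℝ} (hμν : μ ≠ ν) {x y : H}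
    (hx : x ∈ eigenspace A μ) (hy : y ∈ eigenspace A ν) : inner 𝕜 x y = 0 := by
  obtain ⟨hx, hAx⟩ := mem_eigenspace_iff.1 hx
  obtain ⟨hy, hAy⟩ := mem_eigenspace_iff.1 hy
  have hsym := hA.symmetric ⟨x, hx⟩ ⟨y, hy⟩
  rw [hAx, hAy, inner_smul_left, inner_smul_right, RCLike.conj_ofReal, ← sub_eq_zero,
    ← sub_mul] at hsym
  exact (mul_eq_zero.1 hsym).resolve_left (sub_ne_zero.2 (by exact_mod_cast hμν))

lemma A1.eigenspace_le_of_isCompactInverse (hA : A1 A) {R : H →L[𝕜] H}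
    (hR : IsCompactInverse A R) (z : 𝕜) :
    Module.End.eigenspace (R : Module.End 𝕜 H) z ≤ ⨆ μ : ℝ, eigenspace A μ := by
  by_cases hz : Module.End.eigenspace (R : Module.End 𝕜 H) z = ⊥
  · exact hz ▸ bot_le
  have hz0 : z ≠ 0 := by
    rintro rfl
    refine hz ((Submodule.eq_bot_iff _).2 fun x hx => ?_)
    rw [Module.End.mem_eigenspace_iff, zero_smul] at hx
    obtain ⟨h, hAR⟩ := hR.apply_inverse x
    rw [← hAR, show (⟨R x, h⟩ : A.domain) = 0 from Subtype.ext hx, LinearPMap.map_zero]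
  obtain ⟨ν, rfl⟩ := RCLike.conj_eq_iff_real.1
    ((hA.isSymmetric_of_isCompactInverse hR).conj_eigenvalue_eq_self
      (Module.End.hasEigenvalue_iff.2 hz))
  refine le_trans (le_of_eq ?_) (le_iSup _ ν⁻¹)
  rw [hR.eigenspace_eq (inv_ne_zero (by simpa using hz0)), inv_inv]

lemma A1.isHilbertSum (hA : A1 A) : IsHilbertSum 𝕜
    (fun μ : ℝ => (eigenspace A μ).topologicalClosure)
    (fun μ => (eigenspace A μ).topologicalClosure.subtypeₗᵢ) := by
  obtain ⟨R, hR⟩ := hA.exists_isCompactInverse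
  have : ∀ μ : ℝ, CompleteSpace (eigenspace A μ).topologicalClosure := fun μ =>
    (Submodule.isClosed_topologicalClosure _).completeSpace_coe
  refine IsHilbertSum.mkInternal (F := fun μ : ℝ => (eigenspace A μ).topologicalClosure) ?_ ?_
  · rintro μ ν hμν ⟨x, hx⟩ ⟨y, hy⟩
    rw [hA.topologicalClosure_eigenspace] at hx hy
    exact hA.inner_eq_zero_of_ne hμν hx hy
  · simp only [hA.topologicalClosure_eigenspace]
    rw [top_le_iff, Submodule.topologicalClosure_eq_top_iff, eq_bot_iff,
      ← ContinuousLinearMap.orthogonalComplement_iSup_eigenspaces_eq_bot hR.isCompactOperator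
        (hA.isSymmetric_of_isCompactInverse hR)]
    exact Submodule.orthogonal_le (iSup_le (hA.eigenspace_le_of_isCompactInverse hR))

lemma A1.eigenProj_mem (hA : A1 A) (μ : ℝ) (u : H) : eigenProj A μ u ∈ eigenspace A μ := by
  rw [← hA.topologicalClosure_eigenspace μ]
  exact Submodule.starProjection_apply_mem _ _

lemma A1.eigenProj_of_mem (hA : A1 A) {μ : ℝ} {u : H} (hu : u ∈ eigenspace A μ) :
    eigenProj A μ u = u := by
  rw [← hA.topologicalClosure_eigenspace μ] at hu
  exact Submodule.starProjection_eq_self_iff.2 hu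

lemma A1.eigenProj_of_mem_of_ne (hA : A1 A) {μ ν : ℝ} (h : μ ≠ ν) {u : H}
    (hu : u ∈ eigenspace A μ) : eigenProj A ν u = 0 := by
  refine (Submodule.starProjection_apply_eq_zero_iff _).2 fun y hy => ?_
  rw [hA.topologicalClosure_eigenspace] at hy
  exact hA.inner_eq_zero_of_ne h.symm hy hu

lemma inner_eigenProj_left (μ : ℝ) (u v : H) :
    inner 𝕜 (eigenProj A μ u) v = inner 𝕜 u (eigenProj A μ v) :=
  Submodule.inner_starProjection_left_eq_right _ u v

/-- The spectral projection `eigenProj A μ` as a bounded operator. -/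
noncomputable def eigenProjCLM (A : H →ₗ.[𝕜] H) (μ : ℝ) : H →L[𝕜] H :=
  (eigenspace A μ).topologicalClosure.starProjection

lemma eigenProj_add (μ : ℝ) (u v : H) :
    eigenProj A μ (u + v) = eigenProj A μ u + eigenProj A μ v := map_add (eigenProjCLM A μ) u v

lemma eigenProj_sub (μ : ℝ) (u v : H) :
    eigenProj A μ (u - v) = eigenProj A μ u - eigenProj A μ v := map_sub (eigenProjCLM A μ) u v

lemma eigenProj_smul (μ : ℝ) (a : 𝕜) (u : H) :
    eigenProj A μ (a • u) = a • eigenProj A μ u := map_smul (eigenProjCLM A μ) a u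

lemma A1.eigenProj_eq_of_hasSum (hA : A1 A) {c : ℝ → H} (hc : ∀ μ, c μ ∈ eigenspace A μ) {u : H}
    (hu : HasSum c u) (μ : ℝ) : eigenProj A μ u = c μ := by
  have hproj : (fun ν => eigenProjCLM A μ (c ν)) = fun ν => if ν = μ then c μ else 0 := by
    funext ν
    split_ifs with h
    · exact h ▸ hA.eigenProj_of_mem (hc ν)
    · exact hA.eigenProj_of_mem_of_ne h (hc ν)
  exact (hu.mapL (eigenProjCLM A μ)).unique (hproj ▸ hasSum_ite_eq μ (c μ))

lemma A1.coe_linearIsometryEquiv_apply (hA : A1 A) (u : H) (μ : ℝ) :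
    (hA.isHilbertSum.linearIsometryEquiv u μ : H) = eigenProj A μ u := by
  have hsum := hA.isHilbertSum.hasSum_linearIsometryEquiv_symm
    (hA.isHilbertSum.linearIsometryEquiv u)
  rw [LinearIsometryEquiv.symm_apply_apply] at hsum
  exact (hA.eigenProj_eq_of_hasSum
    (fun ν => (hA.topologicalClosure_eigenspace ν).le (Subtype.prop _)) hsum μ).symm

lemma A1.hasSum_eigenProj (hA : A1 A) (u : H) : HasSum (fun μ => eigenProj A μ u) u := by
  have hsum := hA.isHilbertSum.hasSum_linearIsometryEquiv_symm
    (hA.isHilbertSum.linearIsometryEquiv u)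
  rw [LinearIsometryEquiv.symm_apply_apply] at hsum
  simpa only [Submodule.coe_subtypeₗᵢ, Submodule.subtype_apply,
    hA.coe_linearIsometryEquiv_apply] using hsum

lemma A1.hasSum_norm_eigenProj_sq (hA : A1 A) (u : H) :
    HasSum (fun μ => ‖eigenProj A μ u‖ ^ 2) (‖u‖ ^ 2) := by
  have hsum := lp.hasSum_norm (p := 2) (by norm_num) (hA.isHilbertSum.linearIsometryEquiv u)
  rw [LinearIsometryEquiv.norm_map] at hsum
  simpa only [Submodule.coe_norm, hA.coe_linearIsometryEquiv_apply, ENNReal.toReal_ofNat,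
    Real.rpow_ofNat] using hsum

lemma A1.ext_eigenProj (hA : A1 A) {u v : H} (h : ∀ μ, eigenProj A μ u = eigenProj A μ v) :
    u = v := by
  have hu := hA.hasSum_eigenProj u
  simp only [h] at hu
  exact hu.unique (hA.hasSum_eigenProj v)

lemma A1.exists_eigenProj_eq (hA : A1 A) {c : ℝ → H} (hc : ∀ μ, c μ ∈ eigenspace A μ)
    (hs : Summable fun μ => ‖c μ‖ ^ 2) : ∃ u : H, ∀ μ, eigenProj A μ u = c μ := by
  have hc' : ∀ μ, c μ ∈ (eigenspace A μ).topologicalClosure := fun μ =>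
    (hA.topologicalClosure_eigenspace μ).ge (hc μ)
  have hsum : Summable c := (hA.isHilbertSum.OrthogonalFamily.summable_iff_norm_sq_summable
    (fun μ => ⟨c μ, hc' μ⟩)).2 hs
  exact ⟨_, hA.eigenProj_eq_of_hasSum hc hsum.hasSum⟩

lemma A1.exists_pos_forall_eigenProj_eq_zero (hA : A1 A) :
    ∃ ω : ℝ, 0 < ω ∧ ∀ μ < ω, ∀ u, eigenProj A μ u = 0 := by
  obtain ⟨ω, hω, hbot⟩ := hA.exists_pos_forall_eigenspace_eq_bot
  refine ⟨ω, hω, fun μ hμ u => ?_⟩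
  simpa [hbot μ hμ] using hA.eigenProj_mem μ u

lemma A1.eigenProj_of_nonpos (hA : A1 A) {μ : ℝ} (hμ : μ ≤ 0) (u : H) : eigenProj A μ u = 0 := by
  obtain ⟨ω, hω, h⟩ := hA.exists_pos_forall_eigenProj_eq_zero
  exact h μ (hμ.trans_lt hω) u

lemma A1.eigenProj_apply (hA : A1 A) (μ : ℝ) (x : A.domain) :
    eigenProj A μ (A x) = (μ : 𝕜) • eigenProj A μ (x : H) := by
  refine ext_inner_right 𝕜 fun y => ?_
  obtain ⟨hy, hAy⟩ := mem_eigenspace_iff.1 (hA.eigenProj_mem μ y)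
  rw [inner_eigenProj_left, inner_smul_left, inner_eigenProj_left, RCLike.conj_ofReal,
    hA.symmetric x ⟨_, hy⟩, hAy, inner_smul_right]

/-- Existence of the operator `φ(A)` for a function `φ` that is bounded on the spectrum. -/
lemma A1.exists_eigenProj_apply_eq_smul (hA : A1 A) (φ : ℝ → ℝ) (c : ℝ)
    (hφ : ∀ μ, eigenspace A μ ≠ ⊥ → |φ μ| ≤ c) :
    ∃ M : H →L[𝕜] H, ∀ u μ, eigenProj A μ (M u) = (φ μ : 𝕜) • eigenProj A μ u := by
  have hle : ∀ u μ, ‖(φ μ : 𝕜) • eigenProj A μ u‖ ^ 2 ≤ c ^ 2 * ‖eigenProj A μ u‖ ^ 2 := by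
    intro u μ
    by_cases hbot : eigenspace A μ = ⊥
    · have h0 : eigenProj A μ u = 0 := by simpa [hbot] using hA.eigenProj_mem μ u
      simp [h0]
    · rw [norm_smul, mul_pow, RCLike.norm_ofReal]
      have := hφ μ hbot
      gcongr
  have hex : ∀ u, ∃ x : H, ∀ μ, eigenProj A μ x = (φ μ : 𝕜) • eigenProj A μ u := fun u =>
    hA.exists_eigenProj_eq (fun μ => Submodule.smul_mem _ _ (hA.eigenProj_mem μ u))
      (((hA.hasSum_norm_eigenProj_sq u).summable.mul_left (c ^ 2)).of_nonneg_of_le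
        (fun μ => by positivity) (hle u))
  choose M hM using hex
  have hnorm : ∀ u, ‖M u‖ ≤ |c| * ‖u‖ := fun u => by
    refine (sq_le_sq₀ (norm_nonneg _) (by positivity)).1 ?_
    rw [mul_pow, sq_abs]
    refine hasSum_le (fun μ => ?_) (hA.hasSum_norm_eigenProj_sq (M u))
      ((hA.hasSum_norm_eigenProj_sq u).mul_left _)
    exact hM u μ ▸ hle u μ
  let M' : H →ₗ[𝕜] H :=
    { toFun := M
      map_add' := fun x y => hA.ext_eigenProj fun μ => by
        simp only [eigenProj_add, hM, smul_add]
      map_smul' := fun a x => hA.ext_eigenProj fun μ => by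
        simp only [eigenProj_smul, hM, RingHom.id_apply, smul_comm a] }
  exact ⟨M'.mkContinuous |c| hnorm, hM⟩

lemma A1.memH_zero (hA : A1 A) (u : H) : MemH A 0 u := by
  simpa [MemH] using (hA.hasSum_norm_eigenProj_sq u).summable

lemma A1.normH_zero (hA : A1 A) (u : H) : normH A 0 u = ‖u‖ := by
  simp only [normH, zpow_zero, one_mul, (hA.hasSum_norm_eigenProj_sq u).tsum_eq,
    Real.sqrt_sq (norm_nonneg u)]

/-- `Λ` is the operator `A^{-1/2}`, described through the spectral decomposition of `A`. -/
def IsInvSqrt (A : H →ₗ.[𝕜] H) (Λ : H →L[𝕜] H) : Prop :=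
  ∀ u μ, eigenProj A μ (Λ u) = (((√μ)⁻¹ : ℝ) : 𝕜) • eigenProj A μ u

lemma A1.exists_isInvSqrt (hA : A1 A) : ∃ Λ : H →L[𝕜] H, IsInvSqrt A Λ := by
  obtain ⟨ω, hω, hbot⟩ := hA.exists_pos_forall_eigenspace_eq_bot
  refine hA.exists_eigenProj_apply_eq_smul (fun μ => (√μ)⁻¹) (√ω)⁻¹ fun μ hμ => ?_
  have hωμ : ω ≤ μ := le_of_not_gt fun h => hμ (hbot μ h)
  rw [abs_of_nonneg (by positivity)]
  gcongr

namespace IsInvSqrt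

variable {Λ : H →L[𝕜] H}

lemma isSymmetric (hΛ : IsInvSqrt A Λ) (hA : A1 A) : (Λ : H →ₗ[𝕜] H).IsSymmetric := by
  intro x y
  have hterm : ∀ μ, inner 𝕜 (Λ x) (eigenProj A μ y) = inner 𝕜 x (eigenProj A μ (Λ y)) := by
    intro μ
    have hidem : eigenProj A μ (eigenProj A μ y) = eigenProj A μ y :=
      hA.eigenProj_of_mem (hA.eigenProj_mem μ y)
    rw [hΛ, inner_smul_right, ← hidem, ← inner_eigenProj_left, hΛ, inner_smul_left,
      RCLike.conj_ofReal, inner_eigenProj_left, hidem]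
  have hleft := (hA.hasSum_eigenProj y).mapL (innerSL 𝕜 (Λ x))
  have hright := (hA.hasSum_eigenProj (Λ y)).mapL (innerSL 𝕜 x)
  simp only [innerSL_apply_apply, hterm] at hleft hright
  exact hleft.unique hright

lemma zpow_mul_norm_eigenProj_sq (hΛ : IsInvSqrt A Λ) (hA : A1 A) (k : ℤ) (u : H) (μ : ℝ) :
    μ ^ k * ‖eigenProj A μ (Λ u)‖ ^ 2 = μ ^ (k - 1) * ‖eigenProj A μ u‖ ^ 2 := by
  rcases le_or_gt μ 0 with h | h
  · simp [hA.eigenProj_of_nonpos h]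
  · rw [hΛ, norm_smul, RCLike.norm_ofReal, mul_pow, sq_abs, inv_pow, Real.sq_sqrt h.le,
      zpow_sub_one₀ h.ne']
    ring

lemma memH_apply_iff (hΛ : IsInvSqrt A Λ) (hA : A1 A) (k : ℤ) (u : H) :
    MemH A k (Λ u) ↔ MemH A (k - 1) u := by
  simp only [MemH, hΛ.zpow_mul_norm_eigenProj_sq hA]

lemma normH_apply (hΛ : IsInvSqrt A Λ) (hA : A1 A) (k : ℤ) (u : H) :
    normH A k (Λ u) = normH A (k - 1) u := by
  simp only [normH, hΛ.zpow_mul_norm_eigenProj_sq hA]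

lemma normH_neg_natCast (hΛ : IsInvSqrt A Λ) (hA : A1 A) (k : ℕ) (u : H) :
    normH A (-(k : ℤ)) u = ‖(Λ ^ k) u‖ := by
  induction k generalizing u with
  | zero => simpa using hA.normH_zero u
  | succ k ih =>
    rw [pow_succ, mul_apply_eq_comp, ← ih, hΛ.normH_apply hA, Nat.cast_succ, neg_add']

lemma normH_pow_apply (hΛ : IsInvSqrt A Λ) (hA : A1 A) (k : ℕ) (u : H) :
    normH A k ((Λ ^ k) u) = ‖u‖ := by
  induction k with
  | zero => simpa using hA.normH_zero u
  | succ k ih =>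
    rw [pow_succ', mul_apply_eq_comp, hΛ.normH_apply hA, Nat.cast_succ, add_sub_cancel_right, ih]

lemma exists_apply_eq_of_memH_succ (hΛ : IsInvSqrt A Λ) (hA : A1 A) (k : ℕ) {u : H}
    (hu : MemH A (k + 1) u) : ∃ x, Λ x = u := by
  obtain ⟨ω, hω, h0⟩ := hA.exists_pos_forall_eigenProj_eq_zero
  have hs : Summable fun μ : ℝ => ‖((√μ : ℝ) : 𝕜) • eigenProj A μ u‖ ^ 2 := by
    refine (hu.mul_left (ω ^ k)⁻¹).of_nonneg_of_le (fun μ => by positivity) fun μ => ?_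
    rcases lt_or_ge μ ω with h | h
    · simp [h0 μ h]
    · have hμ : 0 < μ := hω.trans_le h
      rw [norm_smul, RCLike.norm_ofReal, mul_pow, sq_abs, Real.sq_sqrt hμ.le, ← mul_assoc]
      gcongr
      rw [inv_mul_eq_div, le_div_iff₀ (by positivity), zpow_add_one₀ hμ.ne', zpow_natCast,
        mul_comm]
      gcongr
  obtain ⟨x, hx⟩ := hA.exists_eigenProj_eq
    (fun μ => Submodule.smul_mem _ _ (hA.eigenProj_mem μ u)) hs
  refine ⟨x, hA.ext_eigenProj fun μ => ?_⟩
  rcases le_or_gt μ 0 with h | h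
  · simp [hA.eigenProj_of_nonpos h]
  · rw [hΛ, hx, smul_smul, ← RCLike.ofReal_mul, inv_mul_cancel₀ (Real.sqrt_pos.2 h).ne',
      RCLike.ofReal_one, one_smul]

lemma memH_natCast_iff (hΛ : IsInvSqrt A Λ) (hA : A1 A) (k : ℕ) {u : H} :
    MemH A k u ↔ ∃ x, (Λ ^ k) x = u := by
  induction k generalizing u with
  | zero => simpa using hA.memH_zero u
  | succ k ih =>
    have hpred : ∀ y, MemH A (k + 1 : ℕ) (Λ y) ↔ MemH A k y := fun y => by
      rw [hΛ.memH_apply_iff hA, Nat.cast_succ, add_sub_cancel_right]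
    constructor
    · intro hu
      obtain ⟨y, rfl⟩ := hΛ.exists_apply_eq_of_memH_succ hA k (by exact_mod_cast hu)
      obtain ⟨x, rfl⟩ := ih.1 ((hpred y).1 hu)
      exact ⟨x, by rw [pow_succ', mul_apply_eq_comp]⟩
    · rintro ⟨x, rfl⟩
      rw [pow_succ', mul_apply_eq_comp, hpred]
      exact ih.2 ⟨x, rfl⟩

lemma apply_apply_apply (hΛ : IsInvSqrt A Λ) (hA : A1 A) (x : A.domain) : Λ (Λ (A x)) = x := by
  refine hA.ext_eigenProj fun μ => ?_
  rcases le_or_gt μ 0 with h | h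
  · simp [hA.eigenProj_of_nonpos h]
  · have hcancel : (√μ)⁻¹ * ((√μ)⁻¹ * μ) = 1 := by
      rw [← mul_assoc, ← mul_inv, Real.mul_self_sqrt h.le, inv_mul_cancel₀ h.ne']
    rw [hΛ, hΛ, hA.eigenProj_apply, smul_smul, smul_smul, mul_assoc, ← RCLike.ofReal_mul,
      ← RCLike.ofReal_mul, hcancel, RCLike.ofReal_one, one_smul]

lemma exists_apply_apply_mem_domain (hΛ : IsInvSqrt A Λ) (hA : A1 A) (g : H) :
    ∃ h : Λ (Λ g) ∈ A.domain, A ⟨Λ (Λ g), h⟩ = g := by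
  obtain ⟨R, hR⟩ := hA.exists_isCompactInverse
  obtain ⟨h, hAR⟩ := hR.apply_inverse g
  have hRg : Λ (Λ g) = R g := by simpa only [hAR] using hΛ.apply_apply_apply hA ⟨R g, h⟩
  simpa only [hRg] using hR.apply_inverse g

lemma injective (hΛ : IsInvSqrt A Λ) (hA : A1 A) : Function.Injective Λ := by
  refine (injective_iff_map_eq_zero Λ).2 fun u hu => ?_
  have hnorm := hΛ.normH_pow_apply hA 1 u
  rw [pow_one, hu] at hnorm
  simpa [normH, eigenProj] using hnorm.symm

/-- The inverse `A⁻¹ = Λ²` of `A`, with values in the domain of `A`. -/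
noncomputable def lift (hΛ : IsInvSqrt A Λ) (hA : A1 A) : H →ₗ[𝕜] A.domain :=
  (Λ ∘L Λ : H →ₗ[𝕜] H).codRestrict A.domain fun g => (hΛ.exists_apply_apply_mem_domain hA g).1

lemma coe_lift (hΛ : IsInvSqrt A Λ) (hA : A1 A) (g : H) : (hΛ.lift hA g : H) = Λ (Λ g) := rfl

lemma apply_lift (hΛ : IsInvSqrt A Λ) (hA : A1 A) (g : H) : A (hΛ.lift hA g) = g :=
  (hΛ.exists_apply_apply_mem_domain hA g).2

lemma lift_apply (hΛ : IsInvSqrt A Λ) (hA : A1 A) (x : A.domain) : hΛ.lift hA (A x) = x :=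
  Subtype.ext (hΛ.apply_apply_apply hA x)

end IsInvSqrt

end Spectral

/-! ### Integral inequalities -/

section Calculus

lemma intervalIntegrable_of_continuousOn_Ici {E : Type*} [NormedAddCommGroup E] {g : ℝ → E}
    (hg : ContinuousOn g (Ici 0)) {a b : ℝ} (ha : 0 ≤ a) (hb : 0 ≤ b) :
    IntervalIntegrable g volume a b :=
  (hg.mono fun _ hx => (le_min ha hb).trans hx.1).intervalIntegrable

lemma integral_mono_of_continuousOn_Ici {g h : ℝ → ℝ} (hg : ContinuousOn g (Ici 0))
    (hh : ContinuousOn h (Ici 0)) {a b : ℝ} (ha : 0 ≤ a) (hab : a ≤ b)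
    (hle : ∀ x ∈ Icc a b, g x ≤ h x) : ∫ x in a..b, g x ≤ ∫ x in a..b, h x :=
  intervalIntegral.integral_mono_on hab
    (intervalIntegrable_of_continuousOn_Ici hg ha (ha.trans hab))
    (intervalIntegrable_of_continuousOn_Ici hh ha (ha.trans hab)) hle

lemma integral_mono_interval_of_continuousOn_Ici {g : ℝ → ℝ} (hg : ContinuousOn g (Ici 0))
    (h0 : ∀ x, 0 ≤ g x) {a b c d : ℝ} (hc : 0 ≤ c) (hca : c ≤ a) (hab : a ≤ b) (hbd : b ≤ d) :
    ∫ x in a..b, g x ≤ ∫ x in c..d, g x :=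
  intervalIntegral.integral_mono_interval hca hab hbd (ae_of_all _ h0)
    (intervalIntegrable_of_continuousOn_Ici hg hc (hc.trans (hca.trans (hab.trans hbd))))

lemma integral_le_mul_of_continuousOn_Ici {g : ℝ → ℝ} (hg : ContinuousOn g (Ici 0)) {a c : ℝ}
    (ha : 0 ≤ a) (hle : ∀ x ∈ Icc 0 a, g x ≤ c) : ∫ x in (0 : ℝ)..a, g x ≤ a * c := by
  simpa using integral_mono_of_continuousOn_Ici hg continuousOn_const le_rfl ha hle

lemma integral_eq_sub_of_hasDerivWithinAt {E : Type*} [NormedAddCommGroup E] [NormedSpace ℝ E]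
    [CompleteSpace E] {g g' : ℝ → E} {a b : ℝ} (hab : a ≤ b)
    (hd : ∀ t ∈ Icc a b, HasDerivWithinAt g (g' t) (Icc a b) t)
    (hc : ContinuousOn g' (Icc a b)) : ∫ x in a..b, g' x = g b - g a :=
  intervalIntegral.integral_eq_sub_of_hasDerivAt_of_le hab (HasDerivWithinAt.continuousOn hd)
    (fun x hx => (hd x (Ioo_subset_Icc_self hx)).hasDerivAt (Icc_mem_nhds hx.1 hx.2))
    (hc.intervalIntegrable_of_Icc hab)

lemma norm_sub_sq_le_two_mul {E : Type*} [NormedAddCommGroup E] (x y : E) :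
    ‖x - y‖ ^ 2 ≤ 2 * ‖x‖ ^ 2 + 2 * ‖y‖ ^ 2 := by
  have h := pow_le_pow_left₀ (norm_nonneg _) (norm_sub_le x y) 2
  nlinarith [sq_nonneg (‖x‖ - ‖y‖)]

lemma sq_integral_le {g : ℝ → ℝ} {a b : ℝ} (hab : a ≤ b) (hg : ContinuousOn g (Icc a b)) :
    (∫ x in a..b, g x) ^ 2 ≤ (b - a) * ∫ x in a..b, g x ^ 2 := by
  rcases hab.eq_or_lt with rfl | hlt
  · simp
  have hi := hg.intervalIntegrable_of_Icc (μ := volume) hab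
  have hi2 : IntervalIntegrable (fun x => g x ^ 2) volume a b :=
    (hg.pow 2).intervalIntegrable_of_Icc hab
  set m := ∫ x in a..b, g x with hm
  have hvar : 0 ≤ ∫ x in a..b, ((b - a) * g x - m) ^ 2 :=
    intervalIntegral.integral_nonneg hab fun x _ => sq_nonneg _
  have hexpand : ∫ x in a..b, ((b - a) * g x - m) ^ 2 =
      (b - a) * ((b - a) * (∫ x in a..b, g x ^ 2) - m ^ 2) := by
    have hsq : ∀ x, ((b - a) * g x - m) ^ 2 =
        (b - a) ^ 2 * g x ^ 2 - 2 * (b - a) * m * g x + m ^ 2 := fun x => by ring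
    simp only [hsq]
    rw [intervalIntegral.integral_add ((hi2.const_mul _).sub (hi.const_mul _)) (by simp),
      intervalIntegral.integral_sub (hi2.const_mul _) (hi.const_mul _),
      intervalIntegral.integral_const_mul, intervalIntegral.integral_const_mul,
      intervalIntegral.integral_const, ← hm, smul_eq_mul]
    ring
  rw [hexpand, mul_nonneg_iff_of_pos_left (sub_pos.2 hlt)] at hvar
  exact sub_nonneg.1 hvar

lemma exists_mul_le_integral {g : ℝ → ℝ} {a b : ℝ} (hab : a ≤ b)
    (hg : ContinuousOn g (Icc a b)) : ∃ s ∈ Icc a b, (b - a) * g s ≤ ∫ x in a..b, g x := by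
  obtain ⟨s, hs, hmin⟩ := isCompact_Icc.exists_isMinOn (nonempty_Icc.2 hab) hg
  refine ⟨s, hs, ?_⟩
  simpa using intervalIntegral.integral_mono_on (μ := volume) hab
    (intervalIntegrable_const (c := g s))
    (hg.intervalIntegrable_of_Icc hab) fun x hx => hmin hx

lemma exists_mul_le_integral_of_continuousOn_Ici {g : ℝ → ℝ} (hg : ContinuousOn g (Ici 0))
    (h0 : ∀ x, 0 ≤ g x) {a b c : ℝ} (ha : 0 ≤ a) (hab : a ≤ b) (hbc : b ≤ c) :
    ∃ s ∈ Icc a b, (b - a) * g s ≤ ∫ x in (0 : ℝ)..c, g x := by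
  obtain ⟨s, hs, hle⟩ := exists_mul_le_integral hab (hg.mono fun x hx => ha.trans hx.1)
  exact ⟨s, hs, hle.trans
    (integral_mono_interval_of_continuousOn_Ici hg h0 le_rfl ha hab hbc)⟩

lemma abs_sqrt_sub_sqrt_le_integral_of_pos {e e' φ : ℝ → ℝ} {a b : ℝ} (hab : a ≤ b)
    (he : ∀ t ∈ Icc a b, HasDerivWithinAt e (e' t) (Icc a b) t) (hpos : ∀ t, 0 < e t)
    (hc : ContinuousOn e' (Icc a b)) (hφ : ContinuousOn φ (Icc a b))
    (hle : ∀ t, |e' t| ≤ 2 * (φ t * √(e t))) : |√(e b) - √(e a)| ≤ ∫ t in a..b, φ t := by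
  have hsqrt : ∀ t, 0 < √(e t) := fun t => Real.sqrt_pos.2 (hpos t)
  have hd : ∀ t ∈ Icc a b, HasDerivWithinAt (fun t => √(e t)) (e' t / (2 * √(e t))) (Icc a b) t :=
    fun t ht => (he t ht).sqrt (hpos t).ne'
  have hc' : ContinuousOn (fun t => e' t / (2 * √(e t))) (Icc a b) :=
    hc.div (continuousOn_const.mul (HasDerivWithinAt.continuousOn hd)) fun t _ =>
      (mul_pos two_pos (hsqrt t)).ne'
  rw [← integral_eq_sub_of_hasDerivWithinAt hab hd hc']
  refine (intervalIntegral.abs_integral_le_integral_abs hab).trans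
    (intervalIntegral.integral_mono_on hab (hc'.abs.intervalIntegrable_of_Icc hab)
      (hφ.intervalIntegrable_of_Icc hab) fun t _ => ?_)
  rw [abs_div, abs_of_pos (mul_pos two_pos (hsqrt t)), div_le_iff₀ (mul_pos two_pos (hsqrt t))]
  linarith [hle t]

lemma abs_sqrt_sub_sqrt_le_integral {e e' φ : ℝ → ℝ} {a b : ℝ} (hab : a ≤ b)
    (he : ∀ t ∈ Icc a b, HasDerivWithinAt e (e' t) (Icc a b) t) (he0 : ∀ t, 0 ≤ e t)
    (hc : ContinuousOn e' (Icc a b)) (hφ : ContinuousOn φ (Icc a b)) (hφ0 : ∀ t, 0 ≤ φ t)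
    (hle : ∀ t, |e' t| ≤ 2 * (φ t * √(e t))) : |√(e b) - √(e a)| ≤ ∫ t in a..b, φ t := by
  -- `√` is not differentiable at `0`, so the inequality is proved for `e + ε` and `ε` sent to `0`.
  have hlim : Tendsto (fun ε => |√(e b + ε) - √(e a + ε)|) (𝓝[>] 0) (𝓝 |√(e b) - √(e a)|) := by
    have hcont : Continuous fun ε => |√(e b + ε) - √(e a + ε)| := by fun_prop
    simpa using (hcont.tendsto 0).mono_left nhdsWithin_le_nhds
  refine le_of_tendsto hlim (eventually_mem_nhdsWithin.mono fun ε (hε : 0 < ε) => ?_)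
  refine abs_sqrt_sub_sqrt_le_integral_of_pos hab (fun t ht => (he t ht).add_const ε)
    (fun t => add_pos_of_nonneg_of_pos (he0 t) hε) hc hφ fun t => (hle t).trans ?_
  have := hφ0 t
  gcongr
  linarith

lemma sqrt_le_sqrt_add_integral {e e' φ : ℝ → ℝ} {a b : ℝ}
    (he : ∀ t ∈ Icc a b, HasDerivWithinAt e (e' t) (Icc a b) t) (he0 : ∀ t, 0 ≤ e t)
    (hc : ContinuousOn e' (Icc a b)) (hφ : ContinuousOn φ (Icc a b)) (hφ0 : ∀ t, 0 ≤ φ t)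
    (hle : ∀ t, |e' t| ≤ 2 * (φ t * √(e t))) {s t : ℝ} (hs : s ∈ Icc a b) (ht : t ∈ Icc a b) :
    √(e t) ≤ √(e s) + ∫ x in a..b, φ x := by
  have hsub : ∀ {c d}, c ∈ Icc a b → d ∈ Icc a b → c ≤ d →
      |√(e d) - √(e c)| ≤ ∫ x in a..b, φ x := fun {c d} hc' hd' hcd => by
    have hss : Icc c d ⊆ Icc a b := Icc_subset_Icc hc'.1 hd'.2
    exact (abs_sqrt_sub_sqrt_le_integral hcd (fun x hx => (he x (hss hx)).mono hss) he0
      (hc.mono hss) (hφ.mono hss) hφ0 hle).trans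
      (intervalIntegral.integral_mono_interval hc'.1 hcd hd'.2 (ae_of_all _ hφ0)
        (hφ.intervalIntegrable_of_Icc (hc'.1.trans hc'.2)))
  rcases le_total s t with hst | hst
  · linarith [(abs_le.1 (hsub hs ht hst)).2]
  · linarith [(abs_le.1 (hsub ht hs hst)).1]

lemma integral_le_of_forall_le_integral_of_continuous {e g : ℝ → ℝ}
    (he : ContinuousOn e (Ici 0)) (hg : Continuous g) (h0 : ∀ x, 0 ≤ g x) {c τ a : ℝ}
    (hc : 0 ≤ c) (hτ : 0 ≤ τ) (ha : 0 ≤ a) (h : ∀ s, 0 ≤ s → e s ≤ c * ∫ x in s..s + τ, g x) :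
    ∫ s in (0 : ℝ)..a, e s ≤ c * τ * ∫ x in (0 : ℝ)..a + τ, g x := by
  have hg2 : Continuous fun p : ℝ × ℝ => g (p.1 + p.2) := by fun_prop
  have hint : IntegrableOn (Function.uncurry fun s u => g (s + u)) (uIoc 0 a ×ˢ uIoc 0 τ) :=
    (hg2.continuousOn.integrableOn_compact (isCompact_uIcc.prod isCompact_uIcc)).mono_set
      (prod_mono uIoc_subset_uIcc uIoc_subset_uIcc)
  have hshift : ∀ u ∈ Icc 0 τ, ∫ s in (0 : ℝ)..a, g (s + u) ≤ ∫ x in (0 : ℝ)..a + τ, g x := by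
    intro u hu
    rw [intervalIntegral.integral_comp_add_right]
    exact integral_mono_interval_of_continuousOn_Ici hg.continuousOn h0 le_rfl
      (by linarith [hu.1]) (by linarith) (by linarith [hu.2])
  calc ∫ s in (0 : ℝ)..a, e s
      ≤ ∫ s in (0 : ℝ)..a, c * ∫ u in (0 : ℝ)..τ, g (s + u) := by
        refine integral_mono_of_continuousOn_Ici he (Continuous.continuousOn ?_) le_rfl ha
          fun s hs => (h s hs.1).trans_eq ?_
        · exact continuous_const.mul
            (intervalIntegral.continuous_parametric_intervalIntegral_of_continuous' hg2 0 τ)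
        · rw [intervalIntegral.integral_comp_add_left, add_zero]
    _ = c * ∫ u in (0 : ℝ)..τ, ∫ s in (0 : ℝ)..a, g (s + u) := by
        rw [intervalIntegral.integral_const_mul, intervalIntegral_intervalIntegral_swap hint]
    _ ≤ c * (τ * ∫ x in (0 : ℝ)..a + τ, g x) := by
        refine mul_le_mul_of_nonneg_left
          (integral_le_mul_of_continuousOn_Ici (Continuous.continuousOn ?_) hτ hshift) hc
        exact intervalIntegral.continuous_parametric_intervalIntegral_of_continuous'
          (by fun_prop) 0 a
    _ = c * τ * ∫ x in (0 : ℝ)..a + τ, g x := by ring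

lemma integral_le_of_forall_le_integral {e g : ℝ → ℝ} (he : ContinuousOn e (Ici 0))
    (hg : ContinuousOn g (Ici 0)) (h0 : ∀ x, 0 ≤ g x) {c τ a : ℝ} (hc : 0 ≤ c) (hτ : 0 ≤ τ)
    (ha : 0 ≤ a) (h : ∀ s, 0 ≤ s → e s ≤ c * ∫ x in s..s + τ, g x) :
    ∫ s in (0 : ℝ)..a, e s ≤ c * τ * ∫ x in (0 : ℝ)..a + τ, g x := by
  have hext : ∀ {u v : ℝ}, 0 ≤ u → u ≤ v → ∫ x in u..v, g (max x 0) = ∫ x in u..v, g x := by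
    intro u v hu huv
    refine intervalIntegral.integral_congr fun x hx => ?_
    rw [uIcc_of_le huv] at hx
    simp only [max_eq_left (hu.trans hx.1)]
  rw [← hext le_rfl (by linarith)]
  refine integral_le_of_forall_le_integral_of_continuous he
    (hg.comp_continuous (by fun_prop) fun x => le_max_right x 0) (fun x => h0 _) hc hτ ha
    fun s hs => ?_
  exact (h s hs).trans_eq (congrArg (c * ·) (hext hs (by linarith)).symm)

end Calculus

/-! ### Strong solutions of the wave equation -/

section WaveSol

variable {𝕜 : Type*} [RCLike 𝕜] {H : Type*} [NormedAddCommGroup H] [InnerProductSpace 𝕜 H]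

/-- Twice the energy of level `1 - k` of `(w, w')`, where `r = A w`, `w' = Λ q` and
`Λ = A^{-1/2}`. -/
noncomputable def waveEnergy (Λ : H →L[𝕜] H) (k : ℕ) (r q : H) : ℝ :=
  ‖(Λ ^ k) (Λ r)‖ ^ 2 + ‖(Λ ^ k) (Λ q)‖ ^ 2

lemma waveEnergy_nonneg (Λ : H →L[𝕜] H) (k : ℕ) (r q : H) : 0 ≤ waveEnergy Λ k r q :=
  add_nonneg (sq_nonneg _) (sq_nonneg _)

lemma pow_apply_comm (Λ : H →L[𝕜] H) (k : ℕ) (x : H) : (Λ ^ k) (Λ x) = Λ ((Λ ^ k) x) := by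
  rw [← mul_apply_eq_comp, ← mul_apply_eq_comp, ← pow_succ, ← pow_succ']

variable [NormedSpace ℝ H]

/-- A strong solution of `w'' + A w = f`, written in terms of `r = A w` and `q` with `w' = Λ q`,
where `Λ = A^{-1/2}`. Then `w = Λ (Λ r)`, and only bounded operators occur. -/
structure IsWaveSol (Λ : H →L[𝕜] H) (f : ℝ → H) (S : Set ℝ) (r q : ℝ → H) : Prop where
  continuous_source : ContinuousOn f S
  continuous_fst : ContinuousOn r S
  continuous_snd : ContinuousOn q S
  deriv_fst : ∀ t ∈ S, HasDerivWithinAt (fun s => Λ (r s)) (q t) S t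
  deriv_snd : ∀ t ∈ S, HasDerivWithinAt (fun s => Λ (q s)) (f t - r t) S t

section

variable {S : Set ℝ} {g₁ g₂ : ℝ → H} {g₁' g₂' : H} {t : ℝ}

lemma hasDerivWithinAt_re_inner (h₁ : HasDerivWithinAt g₁ g₁' S t)
    (h₂ : HasDerivWithinAt g₂ g₂' S t) :
    HasDerivWithinAt (fun s => RCLike.re (inner 𝕜 (g₁ s) (g₂ s)))
      (RCLike.re (inner 𝕜 (g₁ t) g₂') + RCLike.re (inner 𝕜 g₁' (g₂ t))) S t := by
  simpa using!
    (RCLike.reCLM (K := 𝕜)).hasFDerivAt.comp_hasDerivWithinAt t (h₁.inner 𝕜 h₂)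

lemma hasDerivWithinAt_clm_apply [IsScalarTower ℝ 𝕜 H] {E : Type*} [NormedAddCommGroup E]
    [NormedSpace 𝕜 E] [NormedSpace ℝ E] [IsScalarTower ℝ 𝕜 E] (L : H →L[𝕜] E)
    (h : HasDerivWithinAt g₁ g₁' S t) : HasDerivWithinAt (fun s => L (g₁ s)) (L g₁') S t :=
  (L.restrictScalars ℝ).hasFDerivAt.comp_hasDerivWithinAt t h

variable (𝕜) in
lemma hasDerivWithinAt_norm_sq (h : HasDerivWithinAt g₁ g₁' S t) :
    HasDerivWithinAt (fun s => ‖g₁ s‖ ^ 2) (2 * RCLike.re (inner 𝕜 (g₁ t) g₁')) S t := by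
  have hinner := hasDerivWithinAt_re_inner (𝕜 := 𝕜) h h
  rw [inner_re_symm (𝕜 := 𝕜) g₁' (g₁ t)] at hinner
  simpa only [inner_self_eq_norm_sq, two_mul] using hinner

end

namespace IsWaveSol

variable {Λ : H →L[𝕜] H} {f g r q r' q' : ℝ → H} {S S' : Set ℝ}

lemma mono (h : IsWaveSol Λ f S r q) (hS : S' ⊆ S) : IsWaveSol Λ f S' r q where
  continuous_source := h.continuous_source.mono hS
  continuous_fst := h.continuous_fst.mono hS
  continuous_snd := h.continuous_snd.mono hS
  deriv_fst t ht := (h.deriv_fst t (hS ht)).mono hS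
  deriv_snd t ht := (h.deriv_snd t (hS ht)).mono hS

lemma congr_source (h : IsWaveSol Λ f S r q) (hfg : ∀ t ∈ S, g t = f t) :
    IsWaveSol Λ g S r q where
  continuous_source := h.continuous_source.congr hfg
  continuous_fst := h.continuous_fst
  continuous_snd := h.continuous_snd
  deriv_fst := h.deriv_fst
  deriv_snd t ht := by rw [hfg t ht]; exact h.deriv_snd t ht

lemma sub (h : IsWaveSol Λ f S r q) (h' : IsWaveSol Λ g S r' q') :
    IsWaveSol Λ (fun t => f t - g t) S (fun t => r t - r' t) (fun t => q t - q' t) where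
  continuous_source := h.continuous_source.sub h'.continuous_source
  continuous_fst := h.continuous_fst.sub h'.continuous_fst
  continuous_snd := h.continuous_snd.sub h'.continuous_snd
  deriv_fst t ht := by
    simpa only [map_sub] using! (h.deriv_fst t ht).sub (h'.deriv_fst t ht)
  deriv_snd t ht := by
    simp only [map_sub]
    exact ((h.deriv_snd t ht).fun_sub (h'.deriv_snd t ht)).congr_deriv (by abel)

lemma shift (h : IsWaveSol Λ f (Ici 0) r q) {a : ℝ} (ha : 0 ≤ a) :
    IsWaveSol Λ (fun t => f (a + t)) (Ici 0) (fun t => r (a + t)) (fun t => q (a + t)) := by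
  have hm : MapsTo (fun t : ℝ => a + t) (Ici 0) (Ici 0) := fun t ht => add_nonneg ha ht
  have hc : ContinuousOn (fun t : ℝ => a + t) (Ici 0) := by fun_prop
  have hd : ∀ t, HasDerivWithinAt (fun t : ℝ => a + t) 1 (Ici 0) t := fun t =>
    ((hasDerivAt_id t).const_add a).hasDerivWithinAt
  refine ⟨h.continuous_source.comp hc hm, h.continuous_fst.comp hc hm,
    h.continuous_snd.comp hc hm, fun t ht => ?_, fun t ht => ?_⟩
  · simpa using! (h.deriv_fst (a + t) (hm ht)).scomp t (hd t) hm
  · simpa using! (h.deriv_snd (a + t) (hm ht)).scomp t (hd t) hm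

lemma continuousOn_energy (h : IsWaveSol Λ f S r q) (k : ℕ) :
    ContinuousOn (fun t => waveEnergy Λ k (r t) (q t)) S := by
  have hk : Continuous fun x => ‖(Λ ^ k) (Λ x)‖ ^ 2 := by fun_prop
  exact (hk.comp_continuousOn h.continuous_fst).add (hk.comp_continuousOn h.continuous_snd)

lemma deriv_energy (h : IsWaveSol Λ f S r q) (hΛ : (Λ : H →ₗ[𝕜] H).IsSymmetric) {t : ℝ}
    (ht : t ∈ S) :
    HasDerivWithinAt (fun s => waveEnergy Λ 0 (r s) (q s))
      (2 * RCLike.re (inner 𝕜 (Λ (q t)) (f t))) S t := by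
  refine ((hasDerivWithinAt_norm_sq 𝕜 (h.deriv_fst t ht)).fun_add
    (hasDerivWithinAt_norm_sq 𝕜 (h.deriv_snd t ht))).congr_deriv ?_
  have hcross : RCLike.re (inner 𝕜 (Λ (r t)) (q t)) = RCLike.re (inner 𝕜 (Λ (q t)) (r t)) := by
    rw [inner_re_symm]
    exact congrArg RCLike.re (hΛ (q t) (r t)).symm
  rw [inner_sub_right, map_sub, hcross]
  ring

lemma sqrt_energy_zero_le {a b : ℝ} (h : IsWaveSol Λ f (Icc a b) r q)
    (hΛ : (Λ : H →ₗ[𝕜] H).IsSymmetric) {s t : ℝ} (hs : s ∈ Icc a b) (ht : t ∈ Icc a b) :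
    √(waveEnergy Λ 0 (r t) (q t)) ≤ √(waveEnergy Λ 0 (r s) (q s)) + ∫ x in a..b, ‖f x‖ := by
  refine sqrt_le_sqrt_add_integral (fun x hx => h.deriv_energy hΛ hx)
    (fun x => waveEnergy_nonneg Λ 0 (r x) (q x)) ?_ h.continuous_source.norm
    (fun x => norm_nonneg (f x)) (fun x => ?_) hs ht
  · exact continuousOn_const.mul (RCLike.continuous_re.comp_continuousOn
      ((Λ.continuous.comp_continuousOn h.continuous_snd).inner (𝕜 := 𝕜) h.continuous_source))
  · rw [abs_mul, abs_two, mul_comm ‖f x‖]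
    gcongr
    calc |RCLike.re (inner 𝕜 (Λ (q x)) (f x))|
        ≤ ‖Λ (q x)‖ * ‖f x‖ := (RCLike.abs_re_le_norm _).trans (norm_inner_le_norm _ _)
      _ ≤ √(waveEnergy Λ 0 (r x) (q x)) * ‖f x‖ := by
        gcongr
        exact Real.le_sqrt_of_sq_le (le_add_of_nonneg_left (sq_nonneg _))

variable [IsScalarTower ℝ 𝕜 H]

lemma map_pow (h : IsWaveSol Λ f S r q) (k : ℕ) :
    IsWaveSol Λ (fun t => (Λ ^ k) (f t)) S (fun t => (Λ ^ k) (r t)) (fun t => (Λ ^ k) (q t)) where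
  continuous_source := (Λ ^ k).continuous.comp_continuousOn h.continuous_source
  continuous_fst := (Λ ^ k).continuous.comp_continuousOn h.continuous_fst
  continuous_snd := (Λ ^ k).continuous.comp_continuousOn h.continuous_snd
  deriv_fst t ht := by
    simpa only [pow_apply_comm] using hasDerivWithinAt_clm_apply (Λ ^ k) (h.deriv_fst t ht)
  deriv_snd t ht := by
    simpa only [pow_apply_comm, map_sub] using
      hasDerivWithinAt_clm_apply (Λ ^ k) (h.deriv_snd t ht)

lemma sqrt_energy_le {a b : ℝ} (h : IsWaveSol Λ f (Icc a b) r q)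
    (hΛ : (Λ : H →ₗ[𝕜] H).IsSymmetric) (k : ℕ) {s t : ℝ} (hs : s ∈ Icc a b) (ht : t ∈ Icc a b) :
    √(waveEnergy Λ k (r t) (q t)) ≤
      √(waveEnergy Λ k (r s) (q s)) + ∫ x in a..b, ‖(Λ ^ k) (f x)‖ := by
  simpa only [waveEnergy, pow_apply_comm, pow_zero, one_apply_eq_self] using
    (h.map_pow k).sqrt_energy_zero_le hΛ hs ht

end IsWaveSol

end WaveSol

/-! ### Free waves by the functional calculus -/

section Free

variable {𝕜 : Type*} [RCLike 𝕜] {H : Type*} [NormedAddCommGroup H] [InnerProductSpace 𝕜 H]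
  [CompleteSpace H] {A : H →ₗ.[𝕜] H}

lemma A1.continuous_of_eigenProj (hA : A1 A) {φ : ℝ → ℝ} (hφ : Continuous φ)
    (hb : ∀ s, |φ s| ≤ 1) {x : H} {g : ℝ → H}
    (hg : ∀ t μ, eigenProj A μ (g t) = (φ (√μ * t) : 𝕜) • eigenProj A μ x) : Continuous g := by
  refine continuous_iff_continuousAt.2 fun t => ?_
  rw [ContinuousAt, tendsto_iff_norm_sub_tendsto_zero]
  have hnorm : ∀ s, ‖g s - g t‖ ^ 2 =
      ∑' μ, |φ (√μ * s) - φ (√μ * t)| ^ 2 * ‖eigenProj A μ x‖ ^ 2 := fun s => by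
    rw [← (hA.hasSum_norm_eigenProj_sq (g s - g t)).tsum_eq]
    refine tsum_congr fun μ => ?_
    rw [eigenProj_sub, hg, hg, ← sub_smul, norm_smul, mul_pow, ← RCLike.ofReal_sub,
      RCLike.norm_ofReal]
  have hdom := tendsto_tsum_of_dominated_convergence (𝓕 := 𝓝 t)
    (f := fun s μ => |φ (√μ * s) - φ (√μ * t)| ^ 2 * ‖eigenProj A μ x‖ ^ 2)
    (g := fun _ => (0 : ℝ)) (bound := fun μ => 2 ^ 2 * ‖eigenProj A μ x‖ ^ 2)
    ((hA.hasSum_norm_eigenProj_sq x).summable.mul_left _) (fun μ => ?_)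
    (Eventually.of_forall fun s μ => ?_)
  · simp only [← hnorm, tsum_zero] at hdom
    simpa [Real.sqrt_sq] using hdom.sqrt
  · have hcont : Continuous fun s =>
        |φ (√μ * s) - φ (√μ * t)| ^ 2 * ‖eigenProj A μ x‖ ^ 2 := by fun_prop
    simpa using hcont.tendsto t
  · have htwo : |φ (√μ * s) - φ (√μ * t)| ≤ 2 :=
      (abs_sub _ _).trans (by linarith [hb (√μ * s), hb (√μ * t)])
    rw [Real.norm_of_nonneg (by positivity)]
    gcongr

lemma A1.exists_continuous_eigenProj_eq (hA : A1 A) {φ : ℝ → ℝ} (hφ : Continuous φ)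
    (hb : ∀ s, |φ s| ≤ 1) (x : H) : ∃ g : ℝ → H, Continuous g ∧
      ∀ t μ, eigenProj A μ (g t) = (φ (√μ * t) : 𝕜) • eigenProj A μ x := by
  have hex : ∀ t : ℝ, ∃ y : H, ∀ μ, eigenProj A μ y = (φ (√μ * t) : 𝕜) • eigenProj A μ x := by
    intro t
    obtain ⟨M, hM⟩ := hA.exists_eigenProj_apply_eq_smul (fun μ => φ (√μ * t)) 1
      fun μ _ => hb (√μ * t)
    exact ⟨M x, hM x⟩
  choose g hg using hex
  exact ⟨g, hA.continuous_of_eigenProj hφ hb hg, hg⟩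

variable [NormedSpace ℝ H] [IsScalarTower ℝ 𝕜 H]

lemma A1.hasDerivAt_of_eigenProj (hA : A1 A) {g g' : ℝ → H} (hc : Continuous g')
    (h : ∀ μ t, HasDerivAt (fun s => eigenProj A μ (g s)) (eigenProj A μ (g' t)) t) (t : ℝ) :
    HasDerivAt g (g' t) t := by
  set G : ℝ → H := fun t => g 0 + ∫ s in (0 : ℝ)..t, g' s with hG
  have hGd : ∀ t, HasDerivAt G (g' t) t := fun t =>
    (intervalIntegral.integral_hasDerivAt_right (hc.intervalIntegrable _ _)
      (hc.stronglyMeasurableAtFilter _ _) hc.continuousAt).const_add _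
  suffices heq : g = G by
    rw [heq]
    exact hGd t
  funext t
  refine hA.ext_eigenProj fun μ => ?_
  have hd : ∀ t, HasDerivAt (fun s => eigenProj A μ (g s) - eigenProj A μ (G s)) 0 t := by
    intro t
    have hproj := hasDerivWithinAt_clm_apply (eigenProjCLM A μ)
      (hGd t).hasDerivWithinAt (S := univ)
    rw [hasDerivWithinAt_univ] at hproj
    exact ((h μ t).fun_sub hproj).congr_deriv (sub_self _)
  have hconst := is_const_of_deriv_eq_zero (fun t => (hd t).differentiableAt)
    (fun t => (hd t).deriv) t 0
  have h0 : G 0 = g 0 := by simp [hG]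
  simp only [h0, sub_self] at hconst
  exact sub_eq_zero.1 hconst

lemma IsInvSqrt.hasDerivAt_apply {Λ : H →L[𝕜] H} (hΛ : IsInvSqrt A Λ) (hA : A1 A)
    {φ φ' : ℝ → ℝ} (hφ : ∀ s, HasDerivAt φ (φ' s) s) {x : H} {g g' : ℝ → H} (hc : Continuous g')
    (hg : ∀ t μ, eigenProj A μ (g t) = (φ (√μ * t) : 𝕜) • eigenProj A μ x)
    (hg' : ∀ t μ, eigenProj A μ (g' t) = (φ' (√μ * t) : 𝕜) • eigenProj A μ x) (t : ℝ) :
    HasDerivAt (fun s => Λ (g s)) (g' t) t := by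
  refine hA.hasDerivAt_of_eigenProj hc (fun μ t => ?_) t
  rcases le_or_gt μ 0 with hμ | hμ
  · simpa only [hA.eigenProj_of_nonpos hμ] using hasDerivAt_const t (0 : H)
  have hscalar : HasDerivAt (fun s => (√μ)⁻¹ * φ (√μ * s)) (φ' (√μ * t)) t := by
    refine (((hφ (√μ * t)).comp t ((hasDerivAt_id t).const_mul √μ)).const_mul
      (√μ)⁻¹).congr_deriv ?_
    have := (Real.sqrt_pos.2 hμ).ne'
    field_simp
  have hcoe : ∀ (a : ℝ) (y : H), a • y = (a : 𝕜) • y := fun a y => (algebraMap_smul 𝕜 a y).symm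
  simpa only [hΛ _ μ, hg, hg', hcoe, RCLike.ofReal_mul, smul_smul] using
    hscalar.smul_const (eigenProj A μ x)

/-- The curves `c = cos(t A^{1/2}) x` and `s = sin(t A^{1/2}) x`. -/
lemma IsInvSqrt.exists_cos_sin {Λ : H →L[𝕜] H} (hΛ : IsInvSqrt A Λ) (hA : A1 A) (x : H) :
    ∃ c s : ℝ → H, Continuous c ∧ Continuous s ∧ c 0 = x ∧ s 0 = 0 ∧
      (∀ t, HasDerivAt (fun τ => Λ (c τ)) (-s t) t) ∧
      ∀ t, HasDerivAt (fun τ => Λ (s τ)) (c t) t := by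
  obtain ⟨c, hcc, hc⟩ :=
    hA.exists_continuous_eigenProj_eq Real.continuous_cos Real.abs_cos_le_one x
  obtain ⟨s, hsc, hs⟩ :=
    hA.exists_continuous_eigenProj_eq Real.continuous_sin Real.abs_sin_le_one x
  have hneg : ∀ t μ, eigenProj A μ (-s t) =
      ((-Real.sin (√μ * t) : ℝ) : 𝕜) • eigenProj A μ x := fun t μ => by
    rw [RCLike.ofReal_neg, neg_smul, ← hs]
    exact map_neg (eigenProjCLM A μ) (s t)
  have hzero : ∀ μ, eigenProj A μ (0 : H) = 0 := fun μ => map_zero (eigenProjCLM A μ)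
  refine ⟨c, s, hcc, hsc, hA.ext_eigenProj fun μ => by simp [hc], hA.ext_eigenProj fun μ => ?_,
    hΛ.hasDerivAt_apply hA Real.hasDerivAt_cos hsc.neg hc hneg,
    hΛ.hasDerivAt_apply hA Real.hasDerivAt_sin hcc hs hc⟩
  simp [hs, hzero]

/-- Every pair is the initial value of a strong solution of the free equation. -/
def HasFreeSol (Λ : H →L[𝕜] H) : Prop :=
  ∀ r₀ q₀ : H, ∃ r q : ℝ → H, r 0 = r₀ ∧ q 0 = q₀ ∧ IsWaveSol Λ (fun _ => 0) (Ici 0) r q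

lemma IsInvSqrt.hasFreeSol {Λ : H →L[𝕜] H} (hΛ : IsInvSqrt A Λ) (hA : A1 A) : HasFreeSol Λ := by
  intro r₀ q₀
  obtain ⟨c, s, hc, hs, hc0, hs0, hdc, hds⟩ := hΛ.exists_cos_sin hA r₀
  obtain ⟨c', s', hc', hs', hc0', hs0', hdc', hds'⟩ := hΛ.exists_cos_sin hA q₀
  refine ⟨fun t => c t + s' t, fun t => c' t - s t, by simp [hc0, hs0'], by simp [hc0', hs0],
    continuousOn_const, (hc.add hs').continuousOn, (hc'.sub hs).continuousOn,
    fun t _ => ?_, fun t _ => ?_⟩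
  · simp only [map_add]
    exact (((hdc t).fun_add (hds' t)).congr_deriv (by abel)).hasDerivWithinAt
  · simp only [map_sub]
    exact (((hdc' t).fun_sub (hds t)).congr_deriv (by abel)).hasDerivWithinAt

end Free

/-! ### Admissible observers -/

section Observer

variable {𝕜 : Type*} [RCLike 𝕜] {H : Type*} [NormedAddCommGroup H] [InnerProductSpace 𝕜 H]
  [NormedSpace ℝ H] {G : Type*} [NormedAddCommGroup G] [NormedSpace 𝕜 G]

/-- The observation of strong solutions by `b`, acting on `(r, q)`, is admissible in time `T` with
constant `D`. -/
def IsAdmissible (Λ : H →L[𝕜] H) (b : H × H →L[𝕜] G) (T D : ℝ) : Prop :=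
  ∀ f r q : ℝ → H, IsWaveSol Λ f (Icc 0 T) r q → ∫ t in (0 : ℝ)..T, ‖b (r t, q t)‖ ^ 2 ≤
    D * (waveEnergy Λ 0 (r 0) (q 0) + waveEnergy Λ 0 (r T) (q T) +
      (∫ t in (0 : ℝ)..T, waveEnergy Λ 0 (r t) (q t)) + ∫ t in (0 : ℝ)..T, ‖f t‖ ^ 2)

/-- The operator `b`, acting on `(r, q)`, observes the free equation in time `T` with
constant `R`. -/
def ObservesFree (Λ : H →L[𝕜] H) (b : H × H →L[𝕜] G) (T R : ℝ) : Prop :=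
  ∀ r q : ℝ → H, IsWaveSol Λ (fun _ => 0) (Ici 0) r q →
    R * waveEnergy Λ 0 (r 0) (q 0) ≤ ∫ t in (0 : ℝ)..T, ‖b (r t, q t)‖ ^ 2

/-- In some time, the operator `b` is admissible and observes the free equation. -/
def IsObserver (Λ : H →L[𝕜] H) (b : H × H →L[𝕜] G) : Prop :=
  ∃ T D R : ℝ, 0 < T ∧ 0 < D ∧ 0 < R ∧ IsAdmissible Λ b T D ∧ ObservesFree Λ b T R

variable {Λ : H →L[𝕜] H} {b : H × H →L[𝕜] G} {f r q : ℝ → H} {T D R : ℝ}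

lemma IsWaveSol.continuousOn_obs {S : Set ℝ} (h : IsWaveSol Λ f S r q) (b : H × H →L[𝕜] G) :
    ContinuousOn (fun t => b (r t, q t)) S :=
  b.continuous.comp_continuousOn (h.continuous_fst.prodMk h.continuous_snd)

lemma IsWaveSol.continuousOn_norm_obs_sq {S : Set ℝ} (h : IsWaveSol Λ f S r q)
    (b : H × H →L[𝕜] G) : ContinuousOn (fun t => ‖b (r t, q t)‖ ^ 2) S :=
  (h.continuousOn_obs b).norm.pow 2

lemma IsWaveSol.energy_le_mul_integral (h : IsWaveSol Λ f (Icc 0 T) r q)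
    (hΛ : (Λ : H →ₗ[𝕜] H).IsSymmetric) (h0 : waveEnergy Λ 0 (r 0) (q 0) = 0) {t : ℝ}
    (ht : t ∈ Icc 0 T) : waveEnergy Λ 0 (r t) (q t) ≤ T * ∫ x in (0 : ℝ)..T, ‖f x‖ ^ 2 := by
  have hT : 0 ≤ T := ht.1.trans ht.2
  have hsqrt := h.sqrt_energy_zero_le hΛ (left_mem_Icc.2 hT) ht
  rw [h0, Real.sqrt_zero, zero_add] at hsqrt
  rw [← Real.sq_sqrt (waveEnergy_nonneg Λ 0 (r t) (q t))]
  simpa using (pow_le_pow_left₀ (Real.sqrt_nonneg _) hsqrt 2).trans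
    (sq_integral_le hT h.continuous_source.norm)

lemma IsAdmissible.integral_le_of_energy_eq_zero (hb : IsAdmissible Λ b T D)
    (hΛ : (Λ : H →ₗ[𝕜] H).IsSymmetric) (hT : 0 ≤ T) (hD : 0 ≤ D)
    (h : IsWaveSol Λ f (Ici 0) r q) (h0 : waveEnergy Λ 0 (r 0) (q 0) = 0) :
    ∫ t in (0 : ℝ)..T, ‖b (r t, q t)‖ ^ 2 ≤
      D * (1 + T + T ^ 2) * ∫ t in (0 : ℝ)..T, ‖f t‖ ^ 2 := by
  have hIcc := h.mono (Icc_subset_Ici_self : Icc 0 T ⊆ Ici 0)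
  have hle := fun t ht => hIcc.energy_le_mul_integral hΛ h0 (t := t) ht
  have hend := hle T (right_mem_Icc.2 hT)
  have hint := integral_le_mul_of_continuousOn_Ici (h.continuousOn_energy 0) hT hle
  refine (hb f r q hIcc).trans ?_
  rw [h0, mul_assoc]
  gcongr
  linarith

variable (b) in
lemma IsWaveSol.integral_obs_free_le (h : IsWaveSol Λ f (Ici 0) r q) {r' q' : ℝ → H}
    (h' : IsWaveSol Λ (fun _ => 0) (Ici 0) r' q') (hT : 0 ≤ T) :
    ∫ t in (0 : ℝ)..T, ‖b (r' t, q' t)‖ ^ 2 ≤ 2 * (∫ t in (0 : ℝ)..T, ‖b (r t, q t)‖ ^ 2) +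
      2 * ∫ t in (0 : ℝ)..T, ‖b (r t - r' t, q t - q' t)‖ ^ 2 := by
  have hc := h.continuousOn_norm_obs_sq b
  have hcd := (h.sub h').continuousOn_norm_obs_sq b
  have hi := intervalIntegrable_of_continuousOn_Ici hc le_rfl hT
  have hid := intervalIntegrable_of_continuousOn_Ici hcd le_rfl hT
  rw [← intervalIntegral.integral_const_mul, ← intervalIntegral.integral_const_mul,
    ← intervalIntegral.integral_add (hi.const_mul 2) (hid.const_mul 2)]
  refine integral_mono_of_continuousOn_Ici (h'.continuousOn_norm_obs_sq b)
    ((hc.const_mul 2).add (hcd.const_mul 2)) le_rfl hT fun t _ => ?_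
  have hdecomp : b (r' t, q' t) = b (r t, q t) - b (r t - r' t, q t - q' t) := by
    rw [← map_sub, Prod.mk_sub_mk, sub_sub_cancel, sub_sub_cancel]
  rw [hdecomp]
  exact norm_sub_sq_le_two_mul _ _

/-- The free solution with the same initial data differs from the given one by a solution with zero
initial data, to which admissibility applies. -/
lemma IsWaveSol.energy_zero_le_of_observesFree (h : IsWaveSol Λ f (Ici 0) r q)
    (hΛ : (Λ : H →ₗ[𝕜] H).IsSymmetric) (hfree : HasFreeSol Λ) (hT : 0 ≤ T) (hD : 0 ≤ D)
    (hR : 0 < R) (hadm : IsAdmissible Λ b T D) (hobs : ObservesFree Λ b T R) :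
    waveEnergy Λ 0 (r 0) (q 0) ≤ (2 + 2 * D * (1 + T + T ^ 2)) / R *
      ∫ t in (0 : ℝ)..T, (‖b (r t, q t)‖ ^ 2 + ‖f t‖ ^ 2) := by
  obtain ⟨r', q', hr0, hq0, h'⟩ := hfree (r 0) (q 0)
  have hlow := hobs r' q' h'
  have hup := h.integral_obs_free_le b h' hT
  have hzero : waveEnergy Λ 0 (r 0 - r' 0) (q 0 - q' 0) = 0 := by simp [hr0, hq0, waveEnergy]
  have hdiff := hadm.integral_le_of_energy_eq_zero hΛ hT hD (h.sub h') hzero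
  simp only [sub_zero] at hdiff
  rw [hr0, hq0] at hlow
  have hsource : ContinuousOn (fun t => ‖f t‖ ^ 2) (Ici 0) := h.continuous_source.norm.pow 2
  rw [intervalIntegral.integral_add
    (intervalIntegrable_of_continuousOn_Ici (h.continuousOn_norm_obs_sq b) le_rfl hT)
    (intervalIntegrable_of_continuousOn_Ici hsource le_rfl hT),
    div_mul_eq_mul_div, le_div_iff₀ hR]
  have hO : 0 ≤ ∫ t in (0 : ℝ)..T, ‖b (r t, q t)‖ ^ 2 :=
    intervalIntegral.integral_nonneg hT fun t _ => sq_nonneg _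
  have hF : 0 ≤ ∫ t in (0 : ℝ)..T, ‖f t‖ ^ 2 :=
    intervalIntegral.integral_nonneg hT fun t _ => sq_nonneg _
  have hDO : 0 ≤ D * (1 + T + T ^ 2) * ∫ t in (0 : ℝ)..T, ‖b (r t, q t)‖ ^ 2 := by positivity
  linarith

lemma IsObserver.exists_window (hb : IsObserver Λ b) (hΛ : (Λ : H →ₗ[𝕜] H).IsSymmetric)
    (hfree : HasFreeSol Λ) : ∃ τ c : ℝ, 0 < τ ∧ 0 < c ∧ ∀ f r q : ℝ → H,
      IsWaveSol Λ f (Ici 0) r q → ∀ s, 0 ≤ s →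
        waveEnergy Λ 0 (r s) (q s) ≤ c * ∫ t in s..s + τ, (‖b (r t, q t)‖ ^ 2 + ‖f t‖ ^ 2) := by
  obtain ⟨T, D, R, hT, hD, hR, hadm, hobs⟩ := hb
  refine ⟨T, (2 + 2 * D * (1 + T + T ^ 2)) / R, hT, by positivity, fun f r q h s hs => ?_⟩
  simpa only [add_zero, intervalIntegral.integral_comp_add_left
    (fun t => ‖b (r t, q t)‖ ^ 2 + ‖f t‖ ^ 2)] using
    (h.shift hs).energy_zero_le_of_observesFree hΛ hfree hT.le hD.le hR hadm hobs

end Observer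

/-! ### Cascades -/

section Cascade

variable {𝕜 : Type*} [RCLike 𝕜] {H : Type*} [NormedAddCommGroup H] [InnerProductSpace 𝕜 H]

/-- The source term of the `i`-th equation of the cascade, in terms of `r_i = A w_i`. -/
def waveSource (Λ : H →L[𝕜] H) (C : ℕ → H →L[𝕜] H) (r : ℕ → ℝ → H) (i : ℕ) (t : ℝ) : H :=
  if 2 ≤ i then -(C i (Λ (Λ (r (i - 1) t)))) else 0

/-- The coupling operators `C i` act boundedly in the negative norms `‖Λ ^ k ·‖`, and they dominate
the operators `P i`. -/
structure IsCoupling (Λ : H →L[𝕜] H) (C P : ℕ → H →L[𝕜] H) (n : ℕ) : Prop where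
  bounded : ∀ i k : ℕ, 2 ≤ i → i ≤ n → k + i ≤ n + 1 → ∃ c : ℝ, 0 ≤ c ∧ ∀ u : H,
    ‖(Λ ^ k) (C i u)‖ ≤ c * ‖(Λ ^ k) u‖
  coercive : ∀ i : ℕ, 2 ≤ i → i ≤ n → ∃ α : ℝ, 0 < α ∧ ∀ w : H,
    α * ‖P i w‖ ^ 2 ≤ RCLike.re (inner 𝕜 (C i w) w)

/-- A primitive in time of the component `r_i` of a solution of the cascade, obtained by integrating
the equation `(Λ q_i)' = f_i - r_i`. -/
noncomputable def primitive (Λ : H →L[𝕜] H) (C : ℕ → H →L[𝕜] H) (q : ℕ → ℝ → H) : ℕ → ℝ → H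
  | 0, _ => 0
  | i + 1, t => (if 2 ≤ i + 1 then -(C (i + 1) (Λ (Λ (primitive Λ C q i t)))) else 0) -
      Λ (q (i + 1) t)

variable {Λ : H →L[𝕜] H} {C P : ℕ → H →L[𝕜] H} {n : ℕ} {r q : ℕ → ℝ → H}

lemma waveSource_one : waveSource Λ C r 1 = fun _ => 0 := rfl

lemma waveSource_succ {j : ℕ} (hj : 1 ≤ j) (t : ℝ) :
    waveSource Λ C r (j + 1) t = -(C (j + 1) (Λ (Λ (r j t)))) :=
  if_pos (Nat.succ_le_succ hj)

lemma primitive_eq {i : ℕ} (hi : 1 ≤ i) (t : ℝ) :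
    primitive Λ C q i t = waveSource Λ C (primitive Λ C q) i t - Λ (q i t) := by
  obtain ⟨i, rfl⟩ := Nat.exists_eq_add_of_le' hi
  rfl

lemma IsCoupling.mono {m : ℕ} (h : IsCoupling Λ C P n) (hmn : m ≤ n) : IsCoupling Λ C P m where
  bounded i k h2 hi hk := h.bounded i k h2 (by omega) (by omega)
  coercive i h2 hi := h.coercive i h2 (by omega)

lemma IsCoupling.re_inner_nonneg (h : IsCoupling Λ C P n) {i : ℕ} (h2 : 2 ≤ i) (hi : i ≤ n)
    (w : H) : 0 ≤ RCLike.re (inner 𝕜 (C i w) w) := by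
  obtain ⟨α, hα, hco⟩ := h.coercive i h2 hi
  exact le_trans (by positivity) (hco w)

lemma sq_norm_fst_le_waveEnergy (k : ℕ) (x y : H) :
    ‖(Λ ^ k) (Λ x)‖ ^ 2 ≤ waveEnergy Λ k x y :=
  le_add_of_nonneg_right (sq_nonneg _)

lemma sq_norm_snd_le_waveEnergy (k : ℕ) (x y : H) :
    ‖(Λ ^ k) (Λ y)‖ ^ 2 ≤ waveEnergy Λ k x y :=
  le_add_of_nonneg_left (sq_nonneg _)

lemma waveEnergy_succ (k : ℕ) (x y : H) :
    waveEnergy Λ (k + 1) x y = waveEnergy Λ k (Λ x) (Λ y) := by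
  simp only [waveEnergy, pow_succ, mul_apply_eq_comp]

lemma waveEnergy_succ_le_sq_norm_mul (k : ℕ) (x y : H) :
    waveEnergy Λ (k + 1) x y ≤ ‖Λ‖ ^ 2 * waveEnergy Λ k x y := by
  have hle : ∀ z, ‖(Λ ^ k) (Λ (Λ z))‖ ^ 2 ≤ ‖Λ‖ ^ 2 * ‖(Λ ^ k) (Λ z)‖ ^ 2 := fun z => by
    rw [pow_apply_comm, ← mul_pow]
    exact pow_le_pow_left₀ (norm_nonneg _) (Λ.le_opNorm _) 2
  rw [waveEnergy_succ, waveEnergy, waveEnergy, mul_add]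
  exact add_le_add (hle x) (hle y)

lemma waveEnergy_succ_le_of_apply_eq_sub {x y z s : H} (h : Λ y = s - z) (k : ℕ) :
    waveEnergy Λ (k + 1) x y ≤ 2 * waveEnergy Λ k z (Λ x) + 2 * ‖(Λ ^ (k + 1)) s‖ ^ 2 := by
  have hsub := norm_sub_sq_le_two_mul ((Λ ^ (k + 1)) s) ((Λ ^ (k + 1)) z)
  rw [← map_sub, ← h] at hsub
  simp only [waveEnergy, pow_succ, mul_apply_eq_comp] at hsub ⊢
  linarith [sq_nonneg ‖(Λ ^ k) (Λ (Λ x))‖]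

lemma IsCoupling.exists_sq_norm_source_le (h : IsCoupling Λ C P n) {j k : ℕ} (hj : 1 ≤ j)
    (hjn : j + 1 ≤ n) (hk : k + j ≤ n) : ∃ c : ℝ, 0 ≤ c ∧ ∀ (r : ℕ → ℝ → H) (t : ℝ) (y : H),
      ‖(Λ ^ k) (waveSource Λ C r (j + 1) t)‖ ^ 2 ≤ c * waveEnergy Λ (k + 1) (r j t) y := by
  obtain ⟨c, -, hle⟩ := h.bounded (j + 1) k (by omega) hjn (by omega)
  refine ⟨c ^ 2, sq_nonneg c, fun r t y => ?_⟩
  rw [waveSource_succ hj, map_neg, norm_neg]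
  refine (pow_le_pow_left₀ (norm_nonneg _) (hle _) 2).trans ?_
  rw [mul_pow, waveEnergy_succ]
  gcongr
  exact sq_norm_fst_le_waveEnergy k _ _

variable [NormedSpace ℝ H]

/-- A strong solution of the cascade of length `n`. -/
def IsWaveCascade (Λ : H →L[𝕜] H) (C : ℕ → H →L[𝕜] H) (n : ℕ) (r q : ℕ → ℝ → H) : Prop :=
  ∀ i, 1 ≤ i → i ≤ n → IsWaveSol Λ (waveSource Λ C r i) (Ici 0) (r i) (q i)

/-- The observability of the cascade of length `n` through the observation of its last component
by `b`, with the decay in `T` of the constants. -/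
def IsObservable {G : Type*} [NormedAddCommGroup G] [NormedSpace 𝕜 G]
    (Λ : H →L[𝕜] H) (C : ℕ → H →L[𝕜] H) (n : ℕ) (b : H × H →L[𝕜] G) : Prop :=
  ∃ Tstar : ℝ, 1 ≤ Tstar ∧ ∀ i, 1 ≤ i → i ≤ n → ∃ K : ℝ, 0 ≤ K ∧ ∀ r q : ℕ → ℝ → H,
    IsWaveCascade Λ C n r q → ∀ T, Tstar < T →
      T ^ (2 * (n - i) + 1) * waveEnergy Λ (n - i) (r i 0) (q i 0) ≤
        K * ∫ t in (0 : ℝ)..T, ‖b (r n t, q n t)‖ ^ 2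

lemma IsWaveCascade.mono {m : ℕ} (h : IsWaveCascade Λ C n r q) (hmn : m ≤ n) :
    IsWaveCascade Λ C m r q := fun i h1 hi => h i h1 (hi.trans hmn)

lemma IsWaveCascade.shift (h : IsWaveCascade Λ C n r q) {a : ℝ} (ha : 0 ≤ a) :
    IsWaveCascade Λ C n (fun i t => r i (a + t)) (fun i t => q i (a + t)) :=
  fun i h1 hi => (h i h1 hi).shift ha

variable [IsScalarTower ℝ 𝕜 H]

lemma hasDerivWithinAt_waveSource {z z' : ℕ → ℝ → H} {i : ℕ} {t : ℝ} {S : Set ℝ}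
    (h : 2 ≤ i → HasDerivWithinAt (z (i - 1)) (z' (i - 1) t) S t) :
    HasDerivWithinAt (waveSource Λ C z i) (waveSource Λ C z' i t) S t := by
  by_cases h2 : 2 ≤ i
  · have hsource : ∀ y : ℕ → ℝ → H,
        waveSource Λ C y i = fun s => (-(C i ∘L Λ ∘L Λ)) (y (i - 1) s) := fun y => by
      funext s
      simp [waveSource, h2]
    rw [hsource, hsource]
    exact hasDerivWithinAt_clm_apply _ (h h2)
  · have hsource : ∀ y : ℕ → ℝ → H, waveSource Λ C y i = fun _ => 0 := fun y => by
      funext s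
      simp [waveSource, h2]
    rw [hsource, hsource]
    exact hasDerivWithinAt_const _ _ _

lemma IsWaveCascade.hasDerivWithinAt_primitive (h : IsWaveCascade Λ C n r q) {i : ℕ} (h1 : 1 ≤ i)
    (hi : i ≤ n) {t : ℝ} (ht : 0 ≤ t) :
    HasDerivWithinAt (primitive Λ C q i) (r i t) (Ici 0) t := by
  induction i using Nat.strong_induction_on with
  | _ i ih =>
    have hsource : HasDerivWithinAt (waveSource Λ C (primitive Λ C q) i) (waveSource Λ C r i t)
        (Ici 0) t :=
      hasDerivWithinAt_waveSource fun h2 => ih (i - 1) (by omega) (by omega) (by omega)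
    rw [show primitive Λ C q i = fun s => waveSource Λ C (primitive Λ C q) i s - Λ (q i s) from
      funext fun s => primitive_eq h1 s]
    exact (hsource.fun_sub ((h i h1 hi).deriv_snd t ht)).congr_deriv (by abel)

lemma IsWaveCascade.primitive (h : IsWaveCascade Λ C n r q) :
    IsWaveCascade Λ C n (primitive Λ C q) (fun i t => Λ (r i t)) := by
  intro i h1 hi
  have hprim : ∀ t ∈ Ici (0 : ℝ), HasDerivWithinAt (CascadeObs.primitive Λ C q i) (r i t)
    (Ici 0) t := fun t ht => h.hasDerivWithinAt_primitive h1 hi ht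
  have hsource : ∀ t ∈ Ici (0 : ℝ), HasDerivWithinAt
      (waveSource Λ C (CascadeObs.primitive Λ C q) i) (waveSource Λ C r i t) (Ici 0) t :=
    fun t ht => hasDerivWithinAt_waveSource fun _ =>
      h.hasDerivWithinAt_primitive (by omega) (by omega) ht
  refine ⟨HasDerivWithinAt.continuousOn hsource, HasDerivWithinAt.continuousOn hprim,
    Λ.continuous.comp_continuousOn (h i h1 hi).continuous_fst,
    fun t ht => hasDerivWithinAt_clm_apply Λ (hprim t ht), fun t ht => ?_⟩
  refine (hasDerivWithinAt_clm_apply Λ ((h i h1 hi).deriv_fst t ht)).congr_deriv ?_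
  rw [primitive_eq h1]
  abel

end Cascade

/-! ### Domination by the coupling -/

lemma le_two_mul_of_sqrt_le {a b c : ℝ} (ha : 0 ≤ a) (hb : 0 ≤ b) (h : √a ≤ √b + c) :
    a ≤ 2 * b + 2 * c ^ 2 := by
  have hsq := pow_le_pow_left₀ (Real.sqrt_nonneg a) h 2
  rw [Real.sq_sqrt ha] at hsq
  nlinarith [Real.sq_sqrt hb, sq_nonneg (√b - c)]

section Domination

variable {𝕜 : Type*} [RCLike 𝕜] {H : Type*} [NormedAddCommGroup H] [InnerProductSpace 𝕜 H]

/-- The integral of the last coupling term `⟨C_{n+1,n} w_n, w_n⟩` over `[L, 2 L]`. -/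
noncomputable def couplingIntegral (Λ : H →L[𝕜] H) (C : ℕ → H →L[𝕜] H) (n : ℕ)
    (r : ℕ → ℝ → H) (L : ℝ) : ℝ :=
  ∫ t in L..2 * L, RCLike.re (inner 𝕜 (C (n + 1) (Λ (Λ (r n t)))) (Λ (Λ (r n t))))

/-- The observation of the velocity `w' = Λ q` through `Q`. -/
noncomputable def velocityObs (Λ Q : H →L[𝕜] H) : H × H →L[𝕜] H :=
  (Q ∘L Λ) ∘L ContinuousLinearMap.snd 𝕜 H H

variable {Λ : H →L[𝕜] H} {C P : ℕ → H →L[𝕜] H} {n : ℕ} {r q : ℕ → ℝ → H} {T : ℝ}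

lemma IsCoupling.couplingIntegral_nonneg (hC : IsCoupling Λ C P (n + 1)) (hn : 1 ≤ n) {L : ℝ}
    (hL : 0 ≤ L) : 0 ≤ couplingIntegral Λ C n r L :=
  intervalIntegral.integral_nonneg (by linarith) fun t _ =>
    hC.re_inner_nonneg (by omega) le_rfl _

lemma IsCoupling.exists_pow_mul_source_le (hC : IsCoupling Λ C P n) {j : ℕ} (hj : 1 ≤ j)
    (hjn : j + 1 ≤ n) : ∃ c : ℝ, 0 ≤ c ∧ ∀ (z : ℕ → ℝ → H) (t : ℝ) (y : H) (L : ℝ), 1 ≤ L →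
      L ^ (2 * (n - (j + 1)) + 1) * ‖(Λ ^ (n - j)) (waveSource Λ C z (j + 1) t)‖ ^ 2 ≤
        c * (L ^ (2 * (n - j) + 1) * waveEnergy Λ (n - j) (z j t) y) := by
  obtain ⟨c, hc, hle⟩ := hC.exists_sq_norm_source_le (k := n - j) hj hjn (by omega)
  refine ⟨c * ‖Λ‖ ^ 2, by positivity, fun z t y L hL => ?_⟩
  calc L ^ (2 * (n - (j + 1)) + 1) * ‖(Λ ^ (n - j)) (waveSource Λ C z (j + 1) t)‖ ^ 2
      ≤ L ^ (2 * (n - j) + 1) * (c * (‖Λ‖ ^ 2 * waveEnergy Λ (n - j) (z j t) y)) := by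
        gcongr
        · omega
        · exact (hle z t y).trans (by gcongr; exact waveEnergy_succ_le_sq_norm_mul _ _ _)
    _ = c * ‖Λ‖ ^ 2 * (L ^ (2 * (n - j) + 1) * waveEnergy Λ (n - j) (z j t) y) := by ring

variable [NormedSpace ℝ H]

/-- On `[0, 4 L]`, the energy of the `i`-th component of a solution is dominated, with the weight
`L ^ (2 (n - i) + 1)`, by the coupling integral. -/
def IsEnergyDominated (Λ : H →L[𝕜] H) (C : ℕ → H →L[𝕜] H) (n : ℕ) (T : ℝ) (i : ℕ) : Prop :=
  ∃ c : ℝ, 0 ≤ c ∧ ∀ r q : ℕ → ℝ → H, IsWaveCascade Λ C n r q → ∀ L, T < L → ∀ t ∈ Icc 0 (4 * L),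
    L ^ (2 * (n - i) + 1) * waveEnergy Λ (n + 1 - i) (r i t) (q i t) ≤
      c * couplingIntegral Λ C n r L

/-- On `[0, 4 L]`, the source of the `i`-th equation is dominated, with the weight
`L ^ (2 (n - i) + 3)`, by the coupling integral. -/
def IsSourceDominated (Λ : H →L[𝕜] H) (C : ℕ → H →L[𝕜] H) (n : ℕ) (T : ℝ) (i : ℕ) : Prop :=
  ∃ c : ℝ, 0 ≤ c ∧ ∀ r q : ℕ → ℝ → H, IsWaveCascade Λ C n r q → ∀ L, T < L → ∀ t ∈ Icc 0 (4 * L),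
    L ^ (2 * (n - i) + 3) * ‖(Λ ^ (n + 1 - i)) (waveSource Λ C r i t)‖ ^ 2 ≤
      c * couplingIntegral Λ C n r L

lemma IsWaveCascade.continuousOn_state (h : IsWaveCascade Λ C n r q) (hn : 1 ≤ n) :
    ContinuousOn (fun t => Λ (Λ (r n t))) (Ici 0) :=
  (Λ.continuous.comp Λ.continuous).comp_continuousOn (h n hn le_rfl).continuous_fst

lemma IsWaveCascade.continuousOn_coupling (h : IsWaveCascade Λ C n r q) (hn : 1 ≤ n) :
    ContinuousOn (fun t => RCLike.re (inner 𝕜 (C (n + 1) (Λ (Λ (r n t)))) (Λ (Λ (r n t)))))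
      (Ici 0) :=
  RCLike.continuous_re.comp_continuousOn
    (((C (n + 1)).continuous.comp_continuousOn (h.continuousOn_state hn)).inner (𝕜 := 𝕜)
      (h.continuousOn_state hn))

lemma IsWaveCascade.mul_integral_le_couplingIntegral (h : IsWaveCascade Λ C n r q) (hn : 1 ≤ n)
    {Q : H →L[𝕜] H} {α : ℝ}
    (hQ : ∀ w, α * ‖Q w‖ ^ 2 ≤ RCLike.re (inner 𝕜 (C (n + 1) w) w)) {L : ℝ} (hL : 0 ≤ L) :
    α * ∫ t in (0 : ℝ)..L, ‖Q (Λ (Λ (r n (L + t))))‖ ^ 2 ≤ couplingIntegral Λ C n r L := by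
  rw [intervalIntegral.integral_comp_add_left (fun t => ‖Q (Λ (Λ (r n t)))‖ ^ 2), add_zero,
    ← two_mul, ← intervalIntegral.integral_const_mul]
  exact integral_mono_of_continuousOn_Ici
    (((Q.continuous.comp_continuousOn (h.continuousOn_state hn)).norm.pow 2).const_mul α)
    (h.continuousOn_coupling hn) hL (by linarith) fun t _ => hQ _

lemma IsWaveSol.integral_norm_pow_source_sq_le {f r q : ℝ → H} (h : IsWaveSol Λ f (Ici 0) r q)
    {k m : ℕ} {L M : ℝ} (hL : 0 < L)
    (hf : ∀ t ∈ Icc 0 (4 * L), L ^ (m + 2) * ‖(Λ ^ k) (f t)‖ ^ 2 ≤ M) :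
    L ^ m * (∫ t in (0 : ℝ)..4 * L, ‖(Λ ^ k) (f t)‖) ^ 2 ≤ 16 * M := by
  have hc : ContinuousOn (fun t => ‖(Λ ^ k) (f t)‖) (Ici 0) :=
    ((Λ ^ k).continuous.comp_continuousOn h.continuous_source).norm
  have hle := integral_le_mul_of_continuousOn_Ici (hc.pow 2) (by positivity : 0 ≤ 4 * L)
    (c := M / L ^ (m + 2)) fun t ht => by
      rw [le_div_iff₀ (by positivity), mul_comm]
      exact hf t ht
  have hsq := sq_integral_le (by positivity : 0 ≤ 4 * L) (hc.mono Icc_subset_Ici_self)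
  rw [sub_zero] at hsq
  calc L ^ m * (∫ t in (0 : ℝ)..4 * L, ‖(Λ ^ k) (f t)‖) ^ 2
      ≤ L ^ m * (4 * L * (4 * L * (M / L ^ (m + 2)))) := by
        gcongr
        exact hsq.trans (by gcongr; exact hle)
    _ = 16 * M := by
        field_simp
        ring

lemma isSourceDominated_one : IsSourceDominated Λ C n T 1 :=
  ⟨0, le_rfl, fun r q _ L _ t _ => by simp [waveSource_one]⟩

lemma IsEnergyDominated.isSourceDominated_succ (hC : IsCoupling Λ C P (n + 1)) (hT : 0 ≤ T) {j : ℕ}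
    (hj : 1 ≤ j) (hjn : j + 1 ≤ n) (hE : IsEnergyDominated Λ C n T j) :
    IsSourceDominated Λ C n T (j + 1) := by
  obtain ⟨c, hc, hle⟩ := hE
  obtain ⟨cs, hcs, hsle⟩ := hC.exists_sq_norm_source_le (k := n - j) hj (by omega) (by omega)
  refine ⟨cs * c, by positivity, fun r q h L hL t ht => ?_⟩
  have hL0 : 0 ≤ L := by linarith
  have hexp : 2 * (n - (j + 1)) + 3 = 2 * (n - j) + 1 := by omega
  have hlevel : n + 1 - j = n - j + 1 := by omega
  rw [hexp, show n + 1 - (j + 1) = n - j by omega]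
  calc L ^ (2 * (n - j) + 1) * ‖(Λ ^ (n - j)) (waveSource Λ C r (j + 1) t)‖ ^ 2
      ≤ L ^ (2 * (n - j) + 1) * (cs * waveEnergy Λ (n + 1 - j) (r j t) (q j t)) := by
        rw [hlevel]
        gcongr
        exact hsle r t (q j t)
    _ = cs * (L ^ (2 * (n - j) + 1) * waveEnergy Λ (n + 1 - j) (r j t) (q j t)) := by ring
    _ ≤ cs * c * couplingIntegral Λ C n r L := by
        rw [mul_assoc]
        exact mul_le_mul_of_nonneg_left (hle r q h L hL t ht) hcs

variable [IsScalarTower ℝ 𝕜 H]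

lemma IsObservable.exists_primitive_energy_le (hC : IsCoupling Λ C P (n + 1)) (hn : 1 ≤ n)
    (hobs : IsObservable Λ C n (velocityObs Λ (P (n + 1)))) :
    ∃ T : ℝ, 1 ≤ T ∧ ∀ i, 1 ≤ i → i ≤ n → ∃ c : ℝ, 0 ≤ c ∧ ∀ r q : ℕ → ℝ → H,
      IsWaveCascade Λ C n r q → ∀ L, T < L →
        L ^ (2 * (n - i) + 1) * waveEnergy Λ (n - i) (primitive Λ C q i L) (Λ (r i L)) ≤
          c * couplingIntegral Λ C n r L := by
  obtain ⟨T, hT, hobs⟩ := hobs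
  obtain ⟨α, hα, hco⟩ := hC.coercive (n + 1) (by omega) le_rfl
  refine ⟨T, hT, fun i h1 hi => ?_⟩
  obtain ⟨K, hK, hKle⟩ := hobs i h1 hi
  refine ⟨K / α, by positivity, fun r q h L hL => ?_⟩
  have hL0 : 0 ≤ L := by linarith
  have hprim := hKle _ _ (h.primitive.shift hL0) L hL
  simp only [add_zero] at hprim
  calc L ^ (2 * (n - i) + 1) * waveEnergy Λ (n - i) (primitive Λ C q i L) (Λ (r i L))
      ≤ K * ∫ t in (0 : ℝ)..L, ‖P (n + 1) (Λ (Λ (r n (L + t))))‖ ^ 2 := hprim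
    _ = K / α * (α * ∫ t in (0 : ℝ)..L, ‖P (n + 1) (Λ (Λ (r n (L + t))))‖ ^ 2) := by
      field_simp
    _ ≤ K / α * couplingIntegral Λ C n r L := by
      gcongr
      exact h.mul_integral_le_couplingIntegral hn hco hL0

/-- Since `r_i` is the velocity of the primitive in time of the solution, the energy of the latter
controls the energy of the former one level higher, up to the source term. -/
lemma IsObservable.exists_energy_le (hC : IsCoupling Λ C P (n + 1)) (hn : 1 ≤ n)
    (hobs : IsObservable Λ C n (velocityObs Λ (P (n + 1)))) :
    ∃ T : ℝ, 1 ≤ T ∧ ∀ i, 1 ≤ i → i ≤ n → ∃ c : ℝ, 0 ≤ c ∧ ∀ r q : ℕ → ℝ → H,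
      IsWaveCascade Λ C n r q → ∀ L, T < L →
        L ^ (2 * (n - i) + 1) * waveEnergy Λ (n + 1 - i) (r i L) (q i L) ≤
          c * couplingIntegral Λ C n r L := by
  obtain ⟨T, hT, hprim⟩ := hobs.exists_primitive_energy_le hC hn
  have hsource : ∀ i, 1 ≤ i → i ≤ n → ∃ c : ℝ, 0 ≤ c ∧ ∀ r q : ℕ → ℝ → H,
      IsWaveCascade Λ C n r q → ∀ L, T < L → L ^ (2 * (n - i) + 1) *
        ‖(Λ ^ (n + 1 - i)) (waveSource Λ C (primitive Λ C q) i L)‖ ^ 2 ≤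
          c * couplingIntegral Λ C n r L := by
    intro i h1 hi
    obtain rfl | ⟨j, hj, rfl⟩ : i = 1 ∨ ∃ j, 1 ≤ j ∧ i = j + 1 :=
      h1.eq_or_lt.imp Eq.symm fun h => ⟨i - 1, by omega, by omega⟩
    · exact ⟨0, le_rfl, fun r q _ L _ => by simp [waveSource_one]⟩
    obtain ⟨cs, hcs, hle⟩ := (hC.mono n.le_succ).exists_pow_mul_source_le hj hi
    obtain ⟨c, hc, hcle⟩ := hprim j hj (by omega)
    refine ⟨cs * c, by positivity, fun r q h L hL => ?_⟩
    rw [Nat.add_sub_add_right, mul_assoc]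
    exact (hle _ L (Λ (r j L)) L (by linarith)).trans
      (mul_le_mul_of_nonneg_left (hcle r q h L hL) hcs)
  refine ⟨T, hT, fun i h1 hi => ?_⟩
  obtain ⟨c, hc, hcle⟩ := hprim i h1 hi
  obtain ⟨cs, hcs, hsle⟩ := hsource i h1 hi
  refine ⟨2 * c + 2 * cs, by positivity, fun r q h L hL => ?_⟩
  have hL0 : 0 ≤ L := by linarith
  have hq : Λ (q i L) = waveSource Λ C (primitive Λ C q) i L - primitive Λ C q i L := by
    rw [primitive_eq h1]
    abel
  have hsum := mul_le_mul_of_nonneg_left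
    (waveEnergy_succ_le_of_apply_eq_sub (x := r i L) hq (n - i)) (pow_nonneg hL0 (2 * (n - i) + 1))
  rw [← Nat.sub_add_comm hi] at hsum
  linarith [hcle r q h L hL, hsle r q h L hL]

lemma IsWaveSol.pow_mul_energy_le (hΛ : (Λ : H →ₗ[𝕜] H).IsSymmetric) {f r q : ℝ → H}
    (h : IsWaveSol Λ f (Ici 0) r q) {k m : ℕ} {L M M' : ℝ} (hL : 0 < L)
    (hE : L ^ m * waveEnergy Λ k (r L) (q L) ≤ M)
    (hf : ∀ t ∈ Icc 0 (4 * L), L ^ (m + 2) * ‖(Λ ^ k) (f t)‖ ^ 2 ≤ M') {t : ℝ}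
    (ht : t ∈ Icc 0 (4 * L)) : L ^ m * waveEnergy Λ k (r t) (q t) ≤ 2 * M + 32 * M' := by
  have hsqrt := (h.mono (Icc_subset_Ici_self : Icc 0 (4 * L) ⊆ Ici 0)).sqrt_energy_le hΛ k
    (s := L) ⟨hL.le, by linarith⟩ ht
  have hle := le_two_mul_of_sqrt_le (waveEnergy_nonneg _ _ _ _) (waveEnergy_nonneg _ _ _ _) hsqrt
  have hsum := mul_le_mul_of_nonneg_left hle (show 0 ≤ L ^ m by positivity)
  linarith [h.integral_norm_pow_source_sq_le hL hf]

lemma IsObservable.exists_dominated (hΛ : (Λ : H →ₗ[𝕜] H).IsSymmetric)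
    (hC : IsCoupling Λ C P (n + 1)) (hn : 1 ≤ n)
    (hobs : IsObservable Λ C n (velocityObs Λ (P (n + 1)))) :
    ∃ T : ℝ, 1 ≤ T ∧ ∀ i, 1 ≤ i → i ≤ n →
      IsEnergyDominated Λ C n T i ∧ IsSourceDominated Λ C n T i := by
  obtain ⟨T, hT, hle⟩ := hobs.exists_energy_le hC hn
  have henergy : ∀ i, 1 ≤ i → i ≤ n → IsSourceDominated Λ C n T i →
      IsEnergyDominated Λ C n T i := by
    rintro i h1 hi ⟨cs, hcs, hsle⟩
    obtain ⟨c, hc, hcle⟩ := hle i h1 hi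
    refine ⟨2 * c + 32 * cs, by positivity, fun r q h L hL t ht => ?_⟩
    refine ((h i h1 hi).pow_mul_energy_le hΛ (by linarith) (hcle r q h L hL)
      (hsle r q h L hL) ht).trans_eq (by ring)
  refine ⟨T, hT, fun i h1 => ?_⟩
  induction i, h1 using Nat.le_induction with
  | base => exact fun hi => ⟨henergy 1 le_rfl hi isSourceDominated_one, isSourceDominated_one⟩
  | succ j hj ih =>
    intro hjn
    have hsource := (ih (by omega)).1.isSourceDominated_succ hC (by linarith) hj hjn
    exact ⟨henergy (j + 1) (by omega) hjn hsource, hsource⟩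

end Domination

/-! ### The cross functional -/

section CrossTerm

variable {𝕜 : Type*} [RCLike 𝕜] {H : Type*} [NormedAddCommGroup H] [InnerProductSpace 𝕜 H]
  {Λ : H →L[𝕜] H} {C P : ℕ → H →L[𝕜] H} {n : ℕ} {r q : ℕ → ℝ → H}

/-- The cross functional `⟨w_n', w_{n+1}⟩ - ⟨w_n, w_{n+1}'⟩`. -/
noncomputable def crossTerm (Λ : H →L[𝕜] H) (n : ℕ) (r q : ℕ → ℝ → H) (t : ℝ) : ℝ :=
  RCLike.re (inner 𝕜 (Λ (q n t)) (Λ (Λ (r (n + 1) t)))) -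
    RCLike.re (inner 𝕜 (Λ (Λ (r n t))) (Λ (q (n + 1) t)))

lemma abs_re_inner_apply_le (hΛ : (Λ : H →ₗ[𝕜] H).IsSymmetric) (x y : H) :
    |RCLike.re (inner 𝕜 x (Λ y))| ≤ ‖Λ x‖ * ‖y‖ := by
  rw [← hΛ.apply_clm]
  exact (RCLike.abs_re_le_norm _).trans (norm_inner_le_norm _ _)

lemma abs_crossTerm_le (hΛ : (Λ : H →ₗ[𝕜] H).IsSymmetric) (t : ℝ) :
    |crossTerm Λ n r q t| ≤ 2 * (√(waveEnergy Λ 1 (r n t) (q n t)) *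
      √(waveEnergy Λ 0 (r (n + 1) t) (q (n + 1) t))) := by
  have hfst : ∀ k x y, ‖(Λ ^ k) (Λ x)‖ ≤ √(waveEnergy Λ k x y) := fun k x y =>
    Real.le_sqrt_of_sq_le (sq_norm_fst_le_waveEnergy k x y)
  have hsnd : ∀ k x y, ‖(Λ ^ k) (Λ y)‖ ≤ √(waveEnergy Λ k x y) := fun k x y =>
    Real.le_sqrt_of_sq_le (sq_norm_snd_le_waveEnergy k x y)
  rw [two_mul]
  refine (abs_sub _ _).trans (add_le_add ?_ ?_)
  · refine (abs_re_inner_apply_le hΛ _ _).trans ?_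
    gcongr
    · simpa using hsnd 1 (r n t) (q n t)
    · simpa using hfst 0 (r (n + 1) t) (q (n + 1) t)
  · refine ((RCLike.abs_re_le_norm _).trans (norm_inner_le_norm _ _)).trans ?_
    gcongr
    · simpa using hfst 1 (r n t) (q n t)
    · simpa using hsnd 0 (r (n + 1) t) (q (n + 1) t)

variable [NormedSpace ℝ H]

lemma IsWaveCascade.continuousOn_re_inner_source (h : IsWaveCascade Λ C (n + 1) r q) (hn : 1 ≤ n) :
    ContinuousOn (fun t => RCLike.re (inner 𝕜 (waveSource Λ C r n t) (Λ (Λ (r (n + 1) t)))))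
      (Ici 0) :=
  RCLike.continuous_re.comp_continuousOn
    ((h n hn n.le_succ).continuous_source.inner (𝕜 := 𝕜) (h.continuousOn_state (by omega)))

lemma IsWaveCascade.continuousOn_sqrt_energy (h : IsWaveCascade Λ C n r q) (hn : 1 ≤ n) :
    ContinuousOn (fun t => √(waveEnergy Λ 0 (r n t) (q n t))) (Ici 0) :=
  ((h n hn le_rfl).continuousOn_energy 0).sqrt

lemma IsWaveCascade.abs_integral_re_inner_source_le (h : IsWaveCascade Λ C (n + 1) r q)
    (hΛ : (Λ : H →ₗ[𝕜] H).IsSymmetric) (hn : 1 ≤ n) {s t u M : ℝ} (hs : 0 ≤ s) (hst : s ≤ t)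
    (htu : t ≤ u) (hM : 0 ≤ M) (hf : ∀ x ∈ Icc 0 u, ‖Λ (waveSource Λ C r n x)‖ ≤ M) :
    |∫ x in s..t, RCLike.re (inner 𝕜 (waveSource Λ C r n x) (Λ (Λ (r (n + 1) x))))| ≤
      M * ∫ x in (0 : ℝ)..u, √(waveEnergy Λ 0 (r (n + 1) x) (q (n + 1) x)) := by
  have he := h.continuousOn_sqrt_energy (by omega)
  calc |∫ x in s..t, RCLike.re (inner 𝕜 (waveSource Λ C r n x) (Λ (Λ (r (n + 1) x))))|
      ≤ ∫ x in s..t, |RCLike.re (inner 𝕜 (waveSource Λ C r n x) (Λ (Λ (r (n + 1) x))))| :=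
        intervalIntegral.abs_integral_le_integral_abs hst
    _ ≤ ∫ x in s..t, M * √(waveEnergy Λ 0 (r (n + 1) x) (q (n + 1) x)) := by
        refine integral_mono_of_continuousOn_Ici (h.continuousOn_re_inner_source hn).abs
          (he.const_mul M) hs hst fun x hx => ?_
        refine (abs_re_inner_apply_le hΛ _ _).trans ?_
        exact mul_le_mul (hf x ⟨hs.trans hx.1, hx.2.trans htu⟩)
          (Real.le_sqrt_of_sq_le (sq_norm_fst_le_waveEnergy 0 _ _)) (norm_nonneg _) hM
    _ ≤ M * ∫ x in (0 : ℝ)..u, √(waveEnergy Λ 0 (r (n + 1) x) (q (n + 1) x)) := by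
        rw [intervalIntegral.integral_const_mul]
        gcongr
        exact integral_mono_interval_of_continuousOn_Ici he (fun _ => Real.sqrt_nonneg _) le_rfl hs
          hst htu

variable [IsScalarTower ℝ 𝕜 H]

/-- The terms in `A` cancel, leaving only the coupling and the source of the `n`-th equation. -/
lemma IsWaveCascade.hasDerivWithinAt_crossTerm (h : IsWaveCascade Λ C (n + 1) r q)
    (hΛ : (Λ : H →ₗ[𝕜] H).IsSymmetric) (hn : 1 ≤ n) {t : ℝ} (ht : 0 ≤ t) :
    HasDerivWithinAt (crossTerm Λ n r q)
      (RCLike.re (inner 𝕜 (C (n + 1) (Λ (Λ (r n t)))) (Λ (Λ (r n t)))) +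
        RCLike.re (inner 𝕜 (waveSource Λ C r n t) (Λ (Λ (r (n + 1) t))))) (Ici 0) t := by
  have hs := h n hn n.le_succ
  have hs' := h (n + 1) (by omega) le_rfl
  have hd := (hasDerivWithinAt_re_inner (𝕜 := 𝕜) (hs.deriv_snd t ht)
    (hasDerivWithinAt_clm_apply Λ (hs'.deriv_fst t ht))).fun_sub
    (hasDerivWithinAt_re_inner (𝕜 := 𝕜) (hasDerivWithinAt_clm_apply Λ (hs.deriv_fst t ht))
      (hs'.deriv_snd t ht))
  refine hd.congr_deriv ?_
  rw [waveSource_succ hn, inner_sub_left, inner_sub_right, inner_neg_right,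
    hΛ.apply_clm (Λ (r n t)) (r (n + 1) t), hΛ.apply_clm (r n t)]
  simp only [map_sub, map_neg]
  rw [inner_re_symm (𝕜 := 𝕜) (Λ (Λ (r n t))) (C (n + 1) (Λ (Λ (r n t))))]
  ring

lemma IsWaveCascade.integral_coupling (h : IsWaveCascade Λ C (n + 1) r q)
    (hΛ : (Λ : H →ₗ[𝕜] H).IsSymmetric) (hn : 1 ≤ n) {s t : ℝ} (hs : 0 ≤ s) (hst : s ≤ t) :
    (∫ x in s..t, RCLike.re (inner 𝕜 (C (n + 1) (Λ (Λ (r n x)))) (Λ (Λ (r n x))))) +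
      ∫ x in s..t, RCLike.re (inner 𝕜 (waveSource Λ C r n x) (Λ (Λ (r (n + 1) x)))) =
      crossTerm Λ n r q t - crossTerm Λ n r q s := by
  have hcoupling := (h.mono n.le_succ).continuousOn_coupling hn
  have hsource := h.continuousOn_re_inner_source hn
  have hsub : Icc s t ⊆ Ici (0 : ℝ) := fun x hx => hs.trans hx.1
  rw [← intervalIntegral.integral_add
    (intervalIntegrable_of_continuousOn_Ici hcoupling hs (hs.trans hst))
    (intervalIntegrable_of_continuousOn_Ici hsource hs (hs.trans hst))]
  exact integral_eq_sub_of_hasDerivWithinAt hst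
    (fun x hx => (h.hasDerivWithinAt_crossTerm hΛ hn (hsub hx)).mono hsub)
    ((hcoupling.add hsource).mono hsub)

/-- The identity of `integral_coupling` is used between two times, on either side of `[L, 2 L]`,
where the energy of the last component does not exceed its mean. -/
lemma IsWaveCascade.couplingIntegral_le (h : IsWaveCascade Λ C (n + 1) r q)
    (hΛ : (Λ : H →ₗ[𝕜] H).IsSymmetric) (hC : IsCoupling Λ C P (n + 1)) (hn : 1 ≤ n)
    {L η : ℝ} (hL : 0 < L) (hη : 0 ≤ η)
    (hE : ∀ t ∈ Icc 0 (3 * L), √(waveEnergy Λ 1 (r n t) (q n t)) ≤ η)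
    (hf : ∀ t ∈ Icc 0 (3 * L), ‖Λ (waveSource Λ C r n t)‖ ≤ η / L) :
    couplingIntegral Λ C n r L ≤ 5 * (η / L) *
      ∫ t in (0 : ℝ)..3 * L, √(waveEnergy Λ 0 (r (n + 1) t) (q (n + 1) t)) := by
  set e : ℝ → ℝ := fun t => √(waveEnergy Λ 0 (r (n + 1) t) (q (n + 1) t))
  set S := ∫ t in (0 : ℝ)..3 * L, e t
  have he : ContinuousOn e (Ici 0) := h.continuousOn_sqrt_energy (by omega)
  have he0 : ∀ t, 0 ≤ e t := fun t => Real.sqrt_nonneg _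
  obtain ⟨s, hs, hsS⟩ := exists_mul_le_integral_of_continuousOn_Ici he he0 le_rfl hL.le
    (show L ≤ 3 * L by linarith)
  obtain ⟨t, ht, htS⟩ := exists_mul_le_integral_of_continuousOn_Ici he he0
    (show 0 ≤ 2 * L by linarith) (show 2 * L ≤ 3 * L by linarith) le_rfl
  have hst : s ≤ t := by linarith [hs.2, ht.1]
  have hcross : ∀ x ∈ Icc 0 (3 * L), L * e x ≤ S → |crossTerm Λ n r q x| ≤ 2 * (η / L * S) := by
    intro x hx hxS
    calc |crossTerm Λ n r q x| ≤ 2 * (√(waveEnergy Λ 1 (r n x) (q n x)) * e x) :=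
          abs_crossTerm_le hΛ x
      _ ≤ 2 * (η * (S / L)) := by
          gcongr
          · exact hE x hx
          · rwa [le_div_iff₀' hL]
      _ = 2 * (η / L * S) := by ring
  have hcoupling : couplingIntegral Λ C n r L ≤
      ∫ x in s..t, RCLike.re (inner 𝕜 (C (n + 1) (Λ (Λ (r n x)))) (Λ (Λ (r n x)))) :=
    integral_mono_interval_of_continuousOn_Ici ((h.mono n.le_succ).continuousOn_coupling hn)
      (fun x => hC.re_inner_nonneg (by omega) le_rfl _) hs.1 hs.2 (by linarith) ht.1
  have hsource := h.abs_integral_re_inner_source_le hΛ hn hs.1 hst ht.2 (by positivity) hf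
  have hs_cross := hcross s ⟨hs.1, by linarith [hs.2]⟩ (by linarith)
  have ht_cross := hcross t ⟨by linarith [ht.1], ht.2⟩ (by linarith)
  linarith [h.integral_coupling hΛ hn hs.1 hst, (abs_le.1 hsource).1, (abs_le.1 hs_cross).1,
    (abs_le.1 ht_cross).2]

lemma IsWaveCascade.sq_mul_couplingIntegral_le (h : IsWaveCascade Λ C (n + 1) r q)
    (hΛ : (Λ : H →ₗ[𝕜] H).IsSymmetric) (hC : IsCoupling Λ C P (n + 1)) (hn : 1 ≤ n)
    {L c : ℝ} (hL : 0 < L) (hc : 0 ≤ c)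
    (hE : ∀ t ∈ Icc 0 (3 * L), L * waveEnergy Λ 1 (r n t) (q n t) ≤ c * couplingIntegral Λ C n r L)
    (hf : ∀ t ∈ Icc 0 (3 * L), L ^ 3 * ‖Λ (waveSource Λ C r n t)‖ ^ 2 ≤
      c * couplingIntegral Λ C n r L) :
    L ^ 2 * couplingIntegral Λ C n r L ≤
      75 * c * ∫ t in (0 : ℝ)..3 * L, waveEnergy Λ 0 (r (n + 1) t) (q (n + 1) t) := by
  set X := couplingIntegral Λ C n r L
  set J := ∫ t in (0 : ℝ)..3 * L, waveEnergy Λ 0 (r (n + 1) t) (q (n + 1) t)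
  set S := ∫ t in (0 : ℝ)..3 * L, √(waveEnergy Λ 0 (r (n + 1) t) (q (n + 1) t))
  have hX : 0 ≤ X := hC.couplingIntegral_nonneg hn hL.le
  have hS : S ^ 2 ≤ 3 * L * J := by
    simpa only [Real.sq_sqrt (waveEnergy_nonneg _ _ _ _), sub_zero] using
      sq_integral_le (by linarith : 0 ≤ 3 * L)
        ((h.continuousOn_sqrt_energy (by omega)).mono Icc_subset_Ici_self)
  have hXS : X ≤ 5 * (√(c * X / L) / L) * S := by
    refine h.couplingIntegral_le hΛ hC hn hL (Real.sqrt_nonneg _) (fun t ht => ?_) fun t ht => ?_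
    · exact Real.sqrt_le_sqrt ((le_div_iff₀' hL).2 (hE t ht))
    · refine (le_div_iff₀ hL).2 (Real.le_sqrt_of_sq_le ((le_div_iff₀ hL).2 ?_))
      exact (hf t ht).trans_eq' (by ring)
  obtain hX0 | hXpos := hX.eq_or_lt
  · rw [← hX0, mul_zero]
    exact mul_nonneg (by positivity) (intervalIntegral.integral_nonneg (by linarith) fun t _ =>
      waveEnergy_nonneg _ _ _ _)
  refine le_of_mul_le_mul_left ?_ hXpos
  calc X * (L ^ 2 * X) = L ^ 2 * X ^ 2 := by ring
    _ ≤ L ^ 2 * (5 * (√(c * X / L) / L) * S) ^ 2 := by gcongr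
    _ = 25 * c * X / L * S ^ 2 := by
        rw [mul_pow, mul_pow, div_pow, Real.sq_sqrt (by positivity)]
        field_simp
        ring
    _ ≤ 25 * c * X / L * (3 * L * J) := by gcongr
    _ = X * (75 * c * J) := by
        field_simp
        ring

end CrossTerm

/-! ### Observability of cascades -/

section Observability

variable {𝕜 : Type*} [RCLike 𝕜] {H : Type*} [NormedAddCommGroup H] [InnerProductSpace 𝕜 H]
  {Λ : H →L[𝕜] H} {C P : ℕ → H →L[𝕜] H} {n : ℕ} {r q : ℕ → ℝ → H} [NormedSpace ℝ H]

lemma IsWaveCascade.integral_norm_source_sq_le (h : IsWaveCascade Λ C (n + 1) r q) (hn : 1 ≤ n)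
    {L M : ℝ} (hL : 0 < L)
    (hE : ∀ t ∈ Icc 0 (4 * L), L * waveEnergy Λ 1 (r n t) (q n t) ≤ M) :
    ∫ t in (0 : ℝ)..4 * L, ‖waveSource Λ C r (n + 1) t‖ ^ 2 ≤ 4 * ‖C (n + 1)‖ ^ 2 * M := by
  have hle := integral_le_mul_of_continuousOn_Ici
    ((h (n + 1) (by omega) le_rfl).continuous_source.norm.pow 2) (by positivity : 0 ≤ 4 * L)
    (c := ‖C (n + 1)‖ ^ 2 * (M / L)) fun t ht => ?_
  · refine hle.trans_eq ?_
    field_simp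
  · have hstate : ‖Λ (Λ (r n t))‖ ^ 2 ≤ M / L := by
      rw [le_div_iff₀' hL]
      refine (mul_le_mul_of_nonneg_left ?_ hL.le).trans (hE t ht)
      simpa using sq_norm_fst_le_waveEnergy (Λ := Λ) 1 (r n t) (q n t)
    rw [Pi.pow_apply, waveSource_succ hn, norm_neg]
    refine (pow_le_pow_left₀ (norm_nonneg _) ((C (n + 1)).le_opNorm _) 2).trans ?_
    rw [mul_pow]
    gcongr

variable {G : Type*} [NormedAddCommGroup G] [NormedSpace 𝕜 G] {b : H × H →L[𝕜] G}

lemma IsWaveSol.integral_energy_le {f r q : ℝ → H} (h : IsWaveSol Λ f (Ici 0) r q) {τ c L : ℝ}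
    (hτ : 0 ≤ τ) (hc : 0 ≤ c) (hL : τ ≤ L)
    (hwindow : ∀ s, 0 ≤ s →
      waveEnergy Λ 0 (r s) (q s) ≤ c * ∫ t in s..s + τ, (‖b (r t, q t)‖ ^ 2 + ‖f t‖ ^ 2)) :
    ∫ t in (0 : ℝ)..3 * L, waveEnergy Λ 0 (r t) (q t) ≤
      c * τ * ((∫ t in (0 : ℝ)..4 * L, ‖b (r t, q t)‖ ^ 2) +
        ∫ t in (0 : ℝ)..4 * L, ‖f t‖ ^ 2) := by
  have hobs := h.continuousOn_norm_obs_sq b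
  have hsource : ContinuousOn (fun t => ‖f t‖ ^ 2) (Ici 0) := h.continuous_source.norm.pow 2
  have h0 : ∀ t, 0 ≤ ‖b (r t, q t)‖ ^ 2 + ‖f t‖ ^ 2 := fun t => by positivity
  rw [← intervalIntegral.integral_add
    (intervalIntegrable_of_continuousOn_Ici hobs le_rfl (by linarith))
    (intervalIntegrable_of_continuousOn_Ici hsource le_rfl (by linarith))]
  refine (integral_le_of_forall_le_integral (h.continuousOn_energy 0) (hobs.add hsource)
    h0 hc hτ (by linarith) hwindow).trans ?_
  gcongr
  exact integral_mono_interval_of_continuousOn_Ici (hobs.add hsource) h0 le_rfl le_rfl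
    (by linarith) (by linarith)

lemma IsWaveSol.mul_energy_zero_le {f r q : ℝ → H} (h : IsWaveSol Λ f (Ici 0) r q)
    (hΛ : (Λ : H →ₗ[𝕜] H).IsSymmetric) {L : ℝ} (hL : 0 < L) :
    L * waveEnergy Λ 0 (r 0) (q 0) ≤ 2 * (∫ t in (0 : ℝ)..3 * L, waveEnergy Λ 0 (r t) (q t)) +
      8 * L ^ 2 * ∫ t in (0 : ℝ)..4 * L, ‖f t‖ ^ 2 := by
  have hIcc := h.mono (Icc_subset_Ici_self : Icc 0 (4 * L) ⊆ Ici 0)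
  have hE : ∀ t, 0 ≤ waveEnergy Λ 0 (r t) (q t) := fun t => waveEnergy_nonneg _ _ _ _
  obtain ⟨s, hs, hmean⟩ := exists_mul_le_integral_of_continuousOn_Ici (h.continuousOn_energy 0) hE
    le_rfl hL.le (show L ≤ 3 * L by linarith)
  have hzero := le_two_mul_of_sqrt_le (hE 0) (hE s) <|
    hIcc.sqrt_energy_zero_le hΛ ⟨hs.1, by linarith [hs.2]⟩ ⟨le_rfl, by linarith⟩
  have hsource := sq_integral_le (by linarith : 0 ≤ 4 * L) hIcc.continuous_source.norm
  rw [sub_zero] at hmean hsource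
  have hmul := mul_le_mul_of_nonneg_left
    (hzero.trans (add_le_add_right (mul_le_mul_of_nonneg_left hsource zero_le_two) _)) hL.le
  linarith

lemma IsObservable.one (hΛ : (Λ : H →ₗ[𝕜] H).IsSymmetric) (hfree : HasFreeSol Λ)
    (hb : IsObserver Λ b) : IsObservable Λ C 1 b := by
  obtain ⟨τ, c, hτ, hc, hwindow⟩ := hb.exists_window hΛ hfree
  refine ⟨4 * (1 + τ), by linarith, fun i h1 hi => ?_⟩
  obtain rfl : i = 1 := le_antisymm hi h1
  refine ⟨8 * (c * τ), by positivity, fun r q h T hT => ?_⟩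
  obtain ⟨L, rfl⟩ : ∃ L, T = 4 * L := ⟨T / 4, by ring⟩
  have hs := h 1 le_rfl le_rfl
  rw [waveSource_one] at hs
  have hJ := hs.integral_energy_le hτ.le hc.le (by linarith : τ ≤ L) (hwindow _ _ _ hs)
  have hE := hs.mul_energy_zero_le hΛ (by linarith : 0 < L)
  simp only [norm_zero, ne_eq, OfNat.ofNat_ne_zero, not_false_eq_true, zero_pow,
    intervalIntegral.integral_zero, add_zero, mul_zero] at hJ hE
  simp only [Nat.sub_self, mul_zero, zero_add, pow_one]
  linarith

variable [IsScalarTower ℝ 𝕜 H]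

/-- The coupling integral `X` controls the source `F` of the last equation, and is controlled by the
energy `J` with the factor `L ^ (-2)`; for `L` large its contribution to `J` is absorbed. -/
lemma le_mul_of_absorption {X J O F E L k c c' : ℝ} (hX : 0 ≤ X) (hk : 0 ≤ k) (hc : 0 ≤ c)
    (hc' : 0 ≤ c') (hL : 1 ≤ L) (hLc : 150 * c * k * c' ≤ L) (hF : F ≤ c' * X)
    (hJ : J ≤ k * (O + F)) (hXJ : L ^ 2 * X ≤ 75 * c * J) (hE : L * E ≤ 2 * J + 8 * L ^ 2 * F) :
    L ^ 2 * X ≤ 150 * c * k * O ∧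
      L * E ≤ (2 * k + (2 * k * c' + 8 * c') * (150 * c * k)) * O := by
  have hJX : J ≤ k * (O + c' * X) := hJ.trans (by gcongr)
  have habsorb : 150 * c * k * c' * X ≤ L ^ 2 * X :=
    mul_le_mul_of_nonneg_right (hLc.trans (le_self_pow₀ hL two_ne_zero)) hX
  have hXO : L ^ 2 * X ≤ 150 * c * k * O := by
    linarith [mul_le_mul_of_nonneg_left hJX (show 0 ≤ 75 * c by positivity)]
  have hX_le : X ≤ L ^ 2 * X := le_mul_of_one_le_left hX (one_le_pow₀ hL)
  refine ⟨hXO, ?_⟩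
  calc L * E ≤ 2 * (k * (O + c' * X)) + 8 * L ^ 2 * (c' * X) := hE.trans (by gcongr)
    _ = 2 * k * O + 2 * k * c' * X + 8 * c' * (L ^ 2 * X) := by ring
    _ ≤ 2 * k * O + 2 * k * c' * (150 * c * k * O) + 8 * c' * (150 * c * k * O) := by
        gcongr
        exact hX_le.trans hXO
    _ = (2 * k + (2 * k * c' + 8 * c') * (150 * c * k)) * O := by ring

lemma IsObserver.exists_couplingIntegral_le (hb : IsObserver Λ b)
    (hΛ : (Λ : H →ₗ[𝕜] H).IsSymmetric) (hfree : HasFreeSol Λ) (hC : IsCoupling Λ C P (n + 1))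
    (hn : 1 ≤ n) {T₁ : ℝ} (hT₁ : 1 ≤ T₁) (hE : IsEnergyDominated Λ C n T₁ n)
    (hS : IsSourceDominated Λ C n T₁ n) :
    ∃ T c : ℝ, T₁ ≤ T ∧ 0 ≤ c ∧ ∀ r q : ℕ → ℝ → H, IsWaveCascade Λ C (n + 1) r q → ∀ L, T < L →
      L ^ 2 * couplingIntegral Λ C n r L ≤
        c * ∫ t in (0 : ℝ)..4 * L, ‖b (r (n + 1) t, q (n + 1) t)‖ ^ 2 ∧
      L * waveEnergy Λ 0 (r (n + 1) 0) (q (n + 1) 0) ≤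
        c * ∫ t in (0 : ℝ)..4 * L, ‖b (r (n + 1) t, q (n + 1) t)‖ ^ 2 := by
  obtain ⟨τ, cw, hτ, hcw, hwindow⟩ := hb.exists_window hΛ hfree
  obtain ⟨cE, hcE, hE⟩ := hE
  obtain ⟨cS, hcS, hS⟩ := hS
  simp only [Nat.sub_self, mul_zero, zero_add, pow_one, Nat.add_sub_cancel_left] at hE hS
  set c := cE + cS
  set c' := 4 * ‖C (n + 1)‖ ^ 2 * c
  have hc : 0 ≤ c := by positivity
  have hcc' : 0 ≤ 150 * c * (cw * τ) * c' := by positivity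
  refine ⟨T₁ + τ + 150 * c * (cw * τ) * c', 150 * c * (cw * τ) +
    (2 * (cw * τ) + (2 * (cw * τ) * c' + 8 * c') * (150 * c * (cw * τ))), by linarith,
    by positivity, fun r q h L hL => ?_⟩
  have hX : 0 ≤ couplingIntegral Λ C n r L := hC.couplingIntegral_nonneg hn (by linarith)
  have hEX : ∀ t ∈ Icc 0 (4 * L), L * waveEnergy Λ 1 (r n t) (q n t) ≤
      c * couplingIntegral Λ C n r L := fun t ht =>
    (hE r q (h.mono n.le_succ) L (by linarith) t ht).trans (by gcongr; linarith)
  have hSX : ∀ t ∈ Icc 0 (4 * L), L ^ 3 * ‖Λ (waveSource Λ C r n t)‖ ^ 2 ≤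
      c * couplingIntegral Λ C n r L := fun t ht =>
    (hS r q (h.mono n.le_succ) L (by linarith) t ht).trans (by gcongr; linarith)
  have hsub : Icc 0 (3 * L) ⊆ Icc 0 (4 * L) := Icc_subset_Icc_right (by linarith)
  have hsol := h (n + 1) (by omega) le_rfl
  have hle := le_mul_of_absorption (k := cw * τ) (c := c) (c' := c') hX (by positivity) hc
    (by positivity) (by linarith : 1 ≤ L) (by linarith)
    ((h.integral_norm_source_sq_le hn (by linarith) hEX).trans_eq (mul_assoc _ _ _).symm)
    (hsol.integral_energy_le hτ.le hcw.le (by linarith) (hwindow _ _ _ hsol))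
    (h.sq_mul_couplingIntegral_le hΛ hC hn (by linarith) hc (fun t ht => hEX t (hsub ht))
      fun t ht => hSX t (hsub ht))
    (hsol.mul_energy_zero_le hΛ (by linarith))
  have hO : 0 ≤ ∫ t in (0 : ℝ)..4 * L, ‖b (r (n + 1) t, q (n + 1) t)‖ ^ 2 :=
    intervalIntegral.integral_nonneg (by linarith) fun _ _ => sq_nonneg _
  exact ⟨hle.1.trans (mul_le_mul_of_nonneg_right (le_add_of_nonneg_right (by positivity)) hO),
    hle.2.trans (mul_le_mul_of_nonneg_right (le_add_of_nonneg_left (by positivity)) hO)⟩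

lemma IsObservable.succ (hΛ : (Λ : H →ₗ[𝕜] H).IsSymmetric) (hfree : HasFreeSol Λ)
    (hC : IsCoupling Λ C P (n + 1)) (hn : 1 ≤ n)
    (hobs : IsObservable Λ C n (velocityObs Λ (P (n + 1)))) (hb : IsObserver Λ b) :
    IsObservable Λ C (n + 1) b := by
  obtain ⟨T₁, hT₁, hdom⟩ := hobs.exists_dominated hΛ hC hn
  obtain ⟨T, c, hT₁T, hc, hle⟩ := hb.exists_couplingIntegral_le hΛ hfree hC hn hT₁
    (hdom n hn le_rfl).1 (hdom n hn le_rfl).2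
  have hscaled : ∀ i, 1 ≤ i → i ≤ n + 1 → ∃ K : ℝ, 0 ≤ K ∧ ∀ r q : ℕ → ℝ → H,
      IsWaveCascade Λ C (n + 1) r q → ∀ L, T < L →
        L ^ (2 * (n + 1 - i) + 1) * waveEnergy Λ (n + 1 - i) (r i 0) (q i 0) ≤
          K * ∫ t in (0 : ℝ)..4 * L, ‖b (r (n + 1) t, q (n + 1) t)‖ ^ 2 := by
    intro i h1 hi
    obtain rfl | hin := hi.eq_or_lt
    · exact ⟨c, hc, fun r q h L hL => by simpa using (hle r q h L hL).2⟩
    obtain ⟨cE, hcE, hE⟩ := (hdom i h1 (by omega)).1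
    refine ⟨cE * c, by positivity, fun r q h L hL => ?_⟩
    rw [show 2 * (n + 1 - i) + 1 = 2 + (2 * (n - i) + 1) by omega, pow_add, mul_assoc]
    calc _ ≤ L ^ 2 * (cE * couplingIntegral Λ C n r L) :=
          mul_le_mul_of_nonneg_left (hE r q (h.mono n.le_succ) L (by linarith) 0
            ⟨le_rfl, by linarith⟩) (sq_nonneg L)
      _ = cE * (L ^ 2 * couplingIntegral Λ C n r L) := by ring
      _ ≤ cE * c * _ := by
          rw [mul_assoc]
          exact mul_le_mul_of_nonneg_left (hle r q h L hL).1 hcE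
  refine ⟨4 * T, by linarith, fun i h1 hi => ?_⟩
  obtain ⟨K, hK, hKle⟩ := hscaled i h1 hi
  refine ⟨4 ^ (2 * (n + 1 - i) + 1) * K, by positivity, fun r q h T' hT' => ?_⟩
  obtain ⟨L, rfl⟩ : ∃ L, T' = 4 * L := ⟨T' / 4, by ring⟩
  rw [mul_pow, mul_assoc, mul_assoc]
  exact mul_le_mul_of_nonneg_left (hKle r q h L (by linarith)) (by positivity)

/-- The operators `P i`, acting on the velocity, observe the free equation. -/
def ObservesVelocity (Λ : H →L[𝕜] H) (P : ℕ → H →L[𝕜] H) (n : ℕ) : Prop :=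
  ∀ i, 2 ≤ i → i ≤ n → IsObserver Λ (velocityObs Λ (P i))

lemma IsObserver.isObservable (hb : IsObserver Λ b) (hΛ : (Λ : H →ₗ[𝕜] H).IsSymmetric)
    (hfree : HasFreeSol Λ) (hC : IsCoupling Λ C P n) (hP : ObservesVelocity Λ P n) (hn : 1 ≤ n) :
    IsObservable Λ C n b := by
  have hvelocity : ∀ m, 1 ≤ m → m ≤ n → ∀ b' : H × H →L[𝕜] H, IsObserver Λ b' →
      IsObservable Λ C m b' := by
    intro m hm
    induction m, hm using Nat.le_induction with
    | base => exact fun _ _ hb' => .one hΛ hfree hb'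
    | succ m hm ih =>
      exact fun hmn _ hb' => .succ hΛ hfree (hC.mono hmn) hm
        (ih (by omega) _ (hP (m + 1) (by omega) hmn)) hb'
  obtain rfl | ⟨m, hm, rfl⟩ : n = 1 ∨ ∃ m, 1 ≤ m ∧ n = m + 1 :=
    hn.eq_or_lt.imp Eq.symm fun h => ⟨n - 1, by omega, by omega⟩
  · exact .one hΛ hfree hb
  · exact .succ hΛ hfree hC hm
      (hvelocity m hm m.le_succ _ (hP (m + 1) (by omega) le_rfl)) hb

end Observability

/-! ### Solutions in terms of bounded operators -/

section VelocityObs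

variable {𝕜 : Type*} [RCLike 𝕜] {H : Type*} [NormedAddCommGroup H] [InnerProductSpace 𝕜 H]
  [NormedSpace ℝ H] {Λ : H →L[𝕜] H}

lemma isAdmissible_velocityObs (P : H →L[𝕜] H) {T D : ℝ} (hT : 0 ≤ T) (hD : ‖P‖ ^ 2 ≤ D) :
    IsAdmissible Λ (velocityObs Λ P) T D := by
  intro f r q h
  have hint : ∀ {g : ℝ → ℝ}, ContinuousOn g (Icc 0 T) → IntervalIntegrable g volume 0 T :=
    fun hg => ContinuousOn.intervalIntegrable (by rwa [uIcc_of_le hT])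
  have hobs : ∀ t, ‖velocityObs Λ P (r t, q t)‖ ^ 2 ≤ D * waveEnergy Λ 0 (r t) (q t) := by
    intro t
    refine (pow_le_pow_left₀ (norm_nonneg _) (P.le_opNorm (Λ (q t))) 2).trans ?_
    rw [mul_pow]
    refine mul_le_mul hD ?_ (sq_nonneg _) ((sq_nonneg _).trans hD)
    simpa using sq_norm_snd_le_waveEnergy (Λ := Λ) 0 (r t) (q t)
  have hle := intervalIntegral.integral_mono hT (hint (h.continuousOn_norm_obs_sq _))
    (hint ((h.continuousOn_energy 0).const_mul D)) hobs
  rw [intervalIntegral.integral_const_mul] at hle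
  refine hle.trans (mul_le_mul_of_nonneg_left ?_ ((sq_nonneg _).trans hD))
  have hf : 0 ≤ ∫ t in (0 : ℝ)..T, ‖f t‖ ^ 2 :=
    intervalIntegral.integral_nonneg hT fun _ _ => sq_nonneg _
  linarith [waveEnergy_nonneg Λ 0 (r 0) (q 0), waveEnergy_nonneg Λ 0 (r T) (q T)]

end VelocityObs

section Translation

variable {𝕜 : Type*} [RCLike 𝕜] {H : Type*} [NormedAddCommGroup H] [InnerProductSpace 𝕜 H]
  [CompleteSpace H] {A : H →ₗ.[𝕜] H} {Λ : H →L[𝕜] H} {S : Set ℝ} {f r q v : ℝ → H}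
  {C P : ℕ → H →L[𝕜] H} {n : ℕ}

namespace IsInvSqrt

lemma energy_apply (hΛ : IsInvSqrt A Λ) (hA : A1 A) (k : ℕ) (p v : H) :
    energy A (1 - (k : ℤ)) (Λ p) v = 1 / 2 * (‖(Λ ^ k) p‖ ^ 2 + ‖(Λ ^ k) v‖ ^ 2) := by
  rw [energy, hΛ.normH_apply hA, sub_right_comm, sub_self, zero_sub, hΛ.normH_neg_natCast hA,
    hΛ.normH_neg_natCast hA]

lemma energy_one_apply_apply (hΛ : IsInvSqrt A Λ) (hA : A1 A) (r q : H) :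
    energy A 1 (Λ (Λ r)) (Λ q) = 1 / 2 * waveEnergy Λ 0 r q := by
  simpa [waveEnergy] using hΛ.energy_apply hA 0 (Λ r) (Λ q)

lemma normH_one_apply (hΛ : IsInvSqrt A Λ) (hA : A1 A) (p : H) : normH A 1 (Λ p) = ‖p‖ := by
  rw [hΛ.normH_apply hA, sub_self, hA.normH_zero]

lemma exists_apply_eq_of_continuousInH (hΛ : IsInvSqrt A Λ) (hA : A1 A) {u : ℝ → H}
    (hu : ContinuousInH A 1 S u) : ∃ p : ℝ → H, ∀ t ∈ S, Λ (p t) = u t := by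
  choose! p hp using fun t ht =>
    hΛ.exists_apply_eq_of_memH_succ hA 0 (u := u t) (by simpa using (hu t ht).1)
  exact ⟨p, hp⟩

lemma continuousInH_iff (hΛ : IsInvSqrt A Λ) (hA : A1 A) {p u : ℝ → H}
    (hp : ∀ t ∈ S, Λ (p t) = u t) : ContinuousInH A 1 S u ↔ ContinuousOn p S := by
  refine forall₂_congr fun t ht => ?_
  have hmem : MemH A 1 (u t) := by
    rw [← hp t ht, hΛ.memH_apply_iff hA, sub_self]
    exact hA.memH_zero _
  rw [and_iff_right hmem, ContinuousWithinAt, tendsto_iff_norm_sub_tendsto_zero (f := p)]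
  refine tendsto_congr' ?_
  filter_upwards [self_mem_nhdsWithin] with s hs
  rw [← hp s hs, ← hp t ht, ← map_sub, hΛ.normH_one_apply hA]

lemma norm_pow_apply_le_of_adjoint (hΛ : IsInvSqrt A Λ) (hA : A1 A) {T : H →L[𝕜] H} {k : ℕ}
    {c : ℝ} (h : ∀ u : H, MemH A k u → MemH A k (ContinuousLinearMap.adjoint T u) ∧
      normH A k (ContinuousLinearMap.adjoint T u) ≤ c * normH A k u) (u : H) :
    ‖(Λ ^ k) (T u)‖ ≤ |c| * ‖(Λ ^ k) u‖ := by
  have hsymm : ∀ x y, inner 𝕜 ((Λ ^ k) x) y = inner 𝕜 x ((Λ ^ k) y) := fun x y => by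
    simpa only [← ContinuousLinearMap.toLinearMap_pow, ContinuousLinearMap.coe_coe] using
      ((hΛ.isSymmetric hA).pow k) x y
  set x := (Λ ^ k) (T u) with hx
  obtain ⟨hmem, hle⟩ := h ((Λ ^ k) x) ((hΛ.memH_natCast_iff hA k).2 ⟨x, rfl⟩)
  obtain ⟨z, hz⟩ := (hΛ.memH_natCast_iff hA k).1 hmem
  rw [← hz, hΛ.normH_pow_apply hA, hΛ.normH_pow_apply hA] at hle
  have hzx : ‖z‖ ≤ |c| * ‖x‖ := hle.trans (by gcongr; exact le_abs_self c)
  have hinner : inner 𝕜 x x = inner 𝕜 ((Λ ^ k) u) z := by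
    conv_lhs => rw [hx, hsymm, ← ContinuousLinearMap.adjoint_inner_right, ← hx, ← hz, ← hsymm]
  have hmul : ‖x‖ * ‖x‖ ≤ (|c| * ‖(Λ ^ k) u‖) * ‖x‖ := by
    calc ‖x‖ * ‖x‖ = ‖inner 𝕜 x x‖ := by
          rw [← inner_self_eq_norm_mul_norm (𝕜 := 𝕜), inner_self_re_eq_norm]
      _ ≤ ‖(Λ ^ k) u‖ * ‖z‖ := by rw [hinner]; exact norm_inner_le_norm _ _
      _ ≤ ‖(Λ ^ k) u‖ * (|c| * ‖x‖) := by gcongr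
      _ = _ := by ring
  obtain h0 | h0 := (norm_nonneg x).eq_or_lt
  · rw [← h0]; positivity
  · exact le_of_mul_le_mul_right hmul h0

lemma isCoupling (hΛ : IsInvSqrt A Λ) (hA : A1 A)
    (hbounded : ∀ i k : ℕ, 2 ≤ i → i ≤ n → k + i ≤ n + 1 → ∃ c : ℝ, ∀ u : H, MemH A k u →
      MemH A k (ContinuousLinearMap.adjoint (C i) u) ∧
        normH A k (ContinuousLinearMap.adjoint (C i) u) ≤ c * normH A k u)
    (hcoercive : ∀ i : ℕ, 2 ≤ i → i ≤ n → ∃ α : ℝ, 0 < α ∧ ∀ w : H,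
      α * ‖P i w‖ ^ 2 ≤ RCLike.re (inner 𝕜 (C i w) w)) :
    IsCoupling Λ C P n where
  bounded i k h2 hi hk :=
    let ⟨c, hc⟩ := hbounded i k h2 hi hk
    ⟨|c|, abs_nonneg c, hΛ.norm_pow_apply_le_of_adjoint hA hc⟩
  coercive := hcoercive

lemma cascadeSource_eq (hΛ : IsInvSqrt A Λ) (hA : A1 A) (C : ℕ → H →L[𝕜] H)
    (w : ℕ → ℝ → A.domain) :
    cascadeSource C (fun j t => (w j t : H)) = waveSource Λ C (fun j t => A (w j t)) := by
  funext i t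
  simp only [cascadeSource, waveSource, hΛ.apply_apply_apply hA]

end IsInvSqrt

variable [NormedSpace ℝ H] {G : Type*} [NormedAddCommGroup G] [InnerProductSpace 𝕜 G]
  {B : A.domain × H →ₗ[𝕜] G} {b : H × H →L[𝕜] G}

lemma A4.exists_obs (h : A4 A B) (hΛ : IsInvSqrt A Λ) (hA : A1 A) :
    ∃ b : H × H →L[𝕜] G, ∀ r q, b (r, q) = B (hΛ.lift hA r, Λ q) := by
  obtain ⟨c, hc⟩ := h.bounded
  let b₀ : H × H →ₗ[𝕜] G := B ∘ₗ ((hΛ.lift hA).prodMap (Λ : H →ₗ[𝕜] H))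
  refine ⟨b₀.mkContinuous (|c| * (1 + ‖Λ‖)) fun x => (hc _ _).trans ?_, fun r q => rfl⟩
  change c * (‖A (hΛ.lift hA x.1)‖ + ‖Λ x.2‖) ≤ _
  rw [hΛ.apply_lift hA]
  calc c * (‖x.1‖ + ‖Λ x.2‖) ≤ |c| * (‖x‖ + ‖Λ‖ * ‖x‖) := by
        gcongr
        · exact le_abs_self c
        · exact norm_fst_le x
        · exact Λ.le_opNorm_of_le (norm_snd_le x)
    _ = |c| * (1 + ‖Λ‖) * ‖x‖ := by ring

variable [IsScalarTower ℝ 𝕜 H]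

lemma IsInvSqrt.hasDerivInH_iff (hΛ : IsInvSqrt A Λ) (hA : A1 A) {p p' : ℝ → H}
    (hp' : ∀ t ∈ S, Λ (p' t) = v t) :
    HasDerivInH A 1 S (fun t => Λ (p t)) v ↔ ∀ t ∈ S, HasDerivWithinAt p (p' t) S t := by
  refine forall₂_congr fun t ht => ?_
  rw [hasDerivWithinAt_iff_tendsto_slope, tendsto_iff_norm_sub_tendsto_zero (f := slope p t)]
  refine tendsto_congr fun s => ?_
  have hsmul : Λ ((s - t)⁻¹ • (p s - p t)) = (s - t)⁻¹ • Λ (p s - p t) :=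
    (Λ.restrictScalars ℝ).map_smul _ _
  rw [← hp' t ht, ← map_sub, ← hsmul, ← map_sub, hΛ.normH_one_apply hA, slope_def_module]

lemma IsStrongSol.exists_isWaveSol {w : ℝ → A.domain} (h : IsStrongSol A f S w v)
    (hΛ : IsInvSqrt A Λ) (hA : A1 A) :
    ∃ q : ℝ → H, (∀ t ∈ S, Λ (q t) = v t) ∧ IsWaveSol Λ f S (fun t => A (w t)) q := by
  obtain ⟨q, hq⟩ := hΛ.exists_apply_eq_of_continuousInH hA h.continuous_snd
  have hderiv := h.deriv_fst
  simp only [← hΛ.apply_apply_apply hA] at hderiv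
  exact ⟨q, hq, h.continuous_source, h.continuous_fst,
    (hΛ.continuousInH_iff hA hq).1 h.continuous_snd, (hΛ.hasDerivInH_iff hA hq).1 hderiv,
    fun t ht => (h.deriv_snd t ht).congr hq (hq t ht)⟩

lemma IsWaveSol.isStrongSol (h : IsWaveSol Λ f S r q) (hΛ : IsInvSqrt A Λ) (hA : A1 A) :
    IsStrongSol A f S (fun t => hΛ.lift hA (r t)) (fun t => Λ (q t)) where
  continuous_source := h.continuous_source
  continuous_fst := by simpa only [hΛ.apply_lift hA] using h.continuous_fst
  continuous_snd := (hΛ.continuousInH_iff hA fun _ _ => rfl).2 h.continuous_snd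
  deriv_fst := (hΛ.hasDerivInH_iff hA fun _ _ => rfl).2 h.deriv_fst
  deriv_snd t ht := by simpa only [hΛ.apply_lift hA] using h.deriv_snd t ht

lemma IsWaveSol.isWeakSol (h : IsWaveSol Λ f S r q) (hΛ : IsInvSqrt A Λ) (hA : A1 A) :
    IsWeakSol A f S (fun t => Λ (Λ (r t))) (fun t => Λ (q t)) where
  continuous_fst := (hΛ.continuousInH_iff hA fun _ _ => rfl).2
    fun t ht => (h.deriv_fst t ht).continuousWithinAt
  continuous_snd := Λ.continuous.comp_continuousOn h.continuous_snd
  deriv_fst t ht := hasDerivWithinAt_clm_apply Λ (h.deriv_fst t ht)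
  deriv_snd φ t ht := by
    have hinner := hasDerivWithinAt_clm_apply (innerSL 𝕜 (φ : H)) (h.deriv_snd t ht)
    simp only [innerSL_apply_apply] at hinner
    rw [inner_sub_right] at hinner
    rwa [← (hΛ.isSymmetric hA).apply_clm, ← (hΛ.isSymmetric hA).apply_clm,
      hΛ.apply_apply_apply hA]

lemma IsStrongCascadeSol.exists_isWaveCascade {w : ℕ → ℝ → A.domain} {v : ℕ → ℝ → H}
    (h : IsStrongCascadeSol A C n w v) (hΛ : IsInvSqrt A Λ) (hA : A1 A) :
    ∃ q : ℕ → ℝ → H, (∀ i, 1 ≤ i → i ≤ n → ∀ t, 0 ≤ t → Λ (q i t) = v i t) ∧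
      IsWaveCascade Λ C n (fun i t => A (w i t)) q := by
  simp only [IsStrongCascadeSol, hΛ.cascadeSource_eq hA] at h
  choose! q hq hsol using fun i h1 hi => (h i h1 hi).exists_isWaveSol hΛ hA
  exact ⟨q, hq, hsol⟩

lemma IsWaveCascade.isStrongCascadeSol {r q : ℕ → ℝ → H} (h : IsWaveCascade Λ C n r q)
    (hΛ : IsInvSqrt A Λ) (hA : A1 A) :
    IsStrongCascadeSol A C n (fun i t => hΛ.lift hA (r i t)) (fun i t => Λ (q i t)) := by
  intro i h1 hi
  rw [hΛ.cascadeSource_eq hA]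
  simpa only [hΛ.apply_lift hA] using (h i h1 hi).isStrongSol hΛ hA

lemma A3.observesVelocity (h : A3 A P n) (hΛ : IsInvSqrt A Λ) (hA : A1 A) :
    ObservesVelocity Λ P n := by
  intro i h2 hi
  obtain ⟨T₀, hT₀, hT⟩ := h i h2 hi
  obtain ⟨γ, hγ, hobs⟩ := hT (T₀ + 1) (by linarith)
  refine ⟨T₀ + 1, ‖P i‖ ^ 2 + 1, γ / 2, by linarith, by positivity, by positivity,
    isAdmissible_velocityObs _ (by linarith) (by linarith), fun r q hs => ?_⟩
  have hle := hobs _ _ (hs.isWeakSol hΛ hA)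
  rw [hΛ.energy_one_apply_apply hA] at hle
  exact (by ring : γ / 2 * _ = _).trans_le hle

lemma A4.exists_isAdmissible (h : A4 A B) (hΛ : IsInvSqrt A Λ) (hA : A1 A)
    (hb : ∀ r q, b (r, q) = B (hΛ.lift hA r, Λ q)) {T : ℝ} (hT : 0 < T) :
    ∃ D : ℝ, 0 < D ∧ IsAdmissible Λ b T D := by
  obtain ⟨D, hD, hadm⟩ := h.admissible T hT
  refine ⟨D, hD, fun f r q hs => ?_⟩
  have hle := hadm _ _ _ (hs.isStrongSol hΛ hA)
  simp only [hΛ.coe_lift hA, hΛ.energy_one_apply_apply hA, intervalIntegral.integral_const_mul,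
    ← hb] at hle
  refine hle.trans (mul_le_mul_of_nonneg_left ?_ hD.le)
  have hE : 0 ≤ ∫ t in (0 : ℝ)..T, waveEnergy Λ 0 (r t) (q t) :=
    intervalIntegral.integral_nonneg hT.le fun _ _ => waveEnergy_nonneg _ _ _ _
  linarith [waveEnergy_nonneg Λ 0 (r 0) (q 0), waveEnergy_nonneg Λ 0 (r T) (q T)]

lemma A5.isObserver (h : A5 A B) (hadm : A4 A B) (hΛ : IsInvSqrt A Λ) (hA : A1 A)
    (hb : ∀ r q, b (r, q) = B (hΛ.lift hA r, Λ q)) : IsObserver Λ b := by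
  obtain ⟨T₀, hT₀, hT⟩ := h
  obtain ⟨R, hR, hobs⟩ := hT (T₀ + 1) (by linarith)
  obtain ⟨D, hD, hD_adm⟩ := hadm.exists_isAdmissible hΛ hA hb (by linarith : 0 < T₀ + 1)
  refine ⟨T₀ + 1, D, R / 2, by linarith, hD, by positivity, hD_adm, fun r q hs => ?_⟩
  have hle := hobs _ _ (hs.isStrongSol hΛ hA)
  simp only [hΛ.coe_lift hA, hΛ.energy_one_apply_apply hA, ← hb] at hle
  exact (by ring : R / 2 * _ = _).trans_le hle

/-- The observability of the strong solutions of the cascade in times `T > Tstar`, with the decay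
in `T` of the constants. -/
def ObservesStrong (A : H →ₗ.[𝕜] H) (C : ℕ → H →L[𝕜] H) (n : ℕ) (B : A.domain × H →ₗ[𝕜] G)
    (Tstar K : ℝ) : Prop :=
  ∀ (w : ℕ → ℝ → A.domain) (v : ℕ → ℝ → H), IsStrongCascadeSol A C n w v → ∀ T, Tstar < T →
    ∀ i, 1 ≤ i → i ≤ n → energy A (1 + (i : ℤ) - (n : ℤ)) (w i 0) (v i 0) ≤
      K / T ^ (2 * (n - i) + 1) * ∫ t in (0 : ℝ)..T, ‖B (w n t, v n t)‖ ^ 2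

lemma IsObservable.exists_observesStrong (h : IsObservable Λ C n b) (hΛ : IsInvSqrt A Λ)
    (hA : A1 A) (hb : ∀ r q, b (r, q) = B (hΛ.lift hA r, Λ q)) :
    ∃ Tstar K : ℝ, 1 ≤ Tstar ∧ 0 < K ∧ ObservesStrong A C n B Tstar K := by
  obtain ⟨Tstar, hTstar, hobs⟩ := h
  choose! K hK hle using hobs
  have hsum : 0 ≤ ∑ i ∈ Finset.Icc 1 n, K i := Finset.sum_nonneg fun i hi =>
    hK i (Finset.mem_Icc.1 hi).1 (Finset.mem_Icc.1 hi).2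
  refine ⟨Tstar, ∑ i ∈ Finset.Icc 1 n, K i + 1, hTstar, by linarith,
    fun w v hwv T hT i h1 hi => ?_⟩
  have hT0 : 0 < T := by linarith
  obtain ⟨q, hq, hcascade⟩ := hwv.exists_isWaveCascade hΛ hA
  have henergy : energy A (1 + (i : ℤ) - (n : ℤ)) (w i 0) (v i 0) =
      1 / 2 * waveEnergy Λ (n - i) (A (w i 0)) (q i 0) := by
    rw [← hΛ.apply_apply_apply hA, ← hq i h1 hi 0 le_rfl, waveEnergy, ← hΛ.energy_apply hA,
      Nat.cast_sub hi, sub_sub_eq_add_sub]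
  have hobs : ∫ t in (0 : ℝ)..T, ‖b (A (w n t), q n t)‖ ^ 2 =
      ∫ t in (0 : ℝ)..T, ‖B (w n t, v n t)‖ ^ 2 := by
    refine intervalIntegral.integral_congr fun t ht => ?_
    rw [uIcc_of_le hT0.le] at ht
    simp only [hb, hΛ.lift_apply hA, hq n (h1.trans hi) le_rfl t ht.1]
  have hKi : K i ≤ ∑ i ∈ Finset.Icc 1 n, K i := Finset.single_le_sum
    (fun i hi => hK i (Finset.mem_Icc.1 hi).1 (Finset.mem_Icc.1 hi).2) (Finset.mem_Icc.2 ⟨h1, hi⟩)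
  rw [henergy, div_mul_eq_mul_div (_ + 1), le_div_iff₀' (by positivity), ← hobs]
  calc _ = 1 / 2 * (T ^ (2 * (n - i) + 1) * waveEnergy Λ (n - i) (A (w i 0)) (q i 0)) := by ring
    _ ≤ T ^ (2 * (n - i) + 1) * waveEnergy Λ (n - i) (A (w i 0)) (q i 0) :=
        mul_le_of_le_one_left (mul_nonneg (by positivity) (waveEnergy_nonneg _ _ _ _))
          (by norm_num)
    _ ≤ K i * _ := hle i h1 hi _ _ hcascade T hT
    _ ≤ _ := mul_le_mul_of_nonneg_right (by linarith)
        (intervalIntegral.integral_nonneg hT0.le fun _ _ => sq_nonneg _)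

end Translation

/-! ### Time averages -/

section TimeAverages

variable {H : Type*} [NormedAddCommGroup H] {g g' : ℝ → H}

lemma continuous_comp_max (hg : ContinuousOn g (Ici 0)) : Continuous fun x => g (max x 0) :=
  hg.comp_continuous (by fun_prop) fun x => by simp

lemma intervalIntegrable_comp_max (hg : ContinuousOn g (Ici 0)) (a b : ℝ) :
    IntervalIntegrable (fun x => g (max x 0)) volume a b :=
  (continuous_comp_max hg).intervalIntegrable a b

variable [NormedSpace ℝ H]

/-- The mean value of `g` over `[t, t + h]`, where `g` is extended to negative times by `g 0`. -/
noncomputable def timeAvg (h : ℝ) (g : ℝ → H) (t : ℝ) : H := h⁻¹ • ∫ x in t..t + h, g (max x 0)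

/-- The forward difference quotient of `g`, which is the derivative in time of `timeAvg h g`. -/
noncomputable def timeDiff (h : ℝ) (g : ℝ → H) (t : ℝ) : H := h⁻¹ • (g (t + h) - g t)

lemma timeAvg_congr (hgg' : ∀ t, 0 ≤ t → g t = g' t) (h t : ℝ) :
    timeAvg h g t = timeAvg h g' t := by
  simp only [timeAvg, hgg' _ (le_max_right _ _)]

lemma timeAvg_sub (hg : ContinuousOn g (Ici 0)) (hg' : ContinuousOn g' (Ici 0)) (h t : ℝ) :
    timeAvg h (fun s => g s - g' s) t = timeAvg h g t - timeAvg h g' t := by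
  simp only [timeAvg]
  rw [intervalIntegral.integral_sub (intervalIntegrable_comp_max hg _ _)
    (intervalIntegrable_comp_max hg' _ _), smul_sub]

lemma tendstoUniformlyOn_timeAvg [CompleteSpace H] (hg : ContinuousOn g (Ici 0)) (T : ℝ) :
    TendstoUniformlyOn (fun h => timeAvg h g) g (𝓝[>] 0) (Icc 0 T) := by
  rw [Metric.tendstoUniformlyOn_iff]
  intro ε hε
  have huc := isCompact_Icc.uniformContinuousOn_of_continuous
    (hg.mono (Icc_subset_Ici_self : Icc (0 : ℝ) (T + 1) ⊆ Ici 0))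
  obtain ⟨δ, hδ, huc⟩ := Metric.uniformContinuousOn_iff_le.1 huc (ε / 2) (half_pos hε)
  filter_upwards [Ioo_mem_nhdsGT (lt_min hδ one_pos)] with h hh t ht
  obtain ⟨hh0, hhδ, hh1⟩ : 0 < h ∧ h < δ ∧ h < 1 := ⟨hh.1, lt_min_iff.1 hh.2⟩
  have hconst : g t = h⁻¹ • ∫ _ in t..t + h, g t := by
    rw [intervalIntegral.integral_const, add_sub_cancel_left, inv_smul_smul₀ hh0.ne']
  have hclose : ∀ x ∈ uIoc t (t + h), ‖g (max x 0) - g t‖ ≤ ε / 2 := by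
    intro x hx
    rw [uIoc_of_le (by linarith)] at hx
    have hx0 : 0 ≤ x := ht.1.trans hx.1.le
    rw [max_eq_left hx0, ← dist_eq_norm]
    refine huc x ⟨hx0, by linarith [hx.2, ht.2]⟩ t ⟨ht.1, by linarith [ht.2]⟩ ?_
    rw [Real.dist_eq, abs_of_nonneg (by linarith [hx.1])]
    linarith [hx.2]
  have hle := intervalIntegral.norm_integral_le_of_norm_le_const hclose
  rw [add_sub_cancel_left, abs_of_pos hh0] at hle
  rw [dist_comm, dist_eq_norm, hconst, timeAvg, ← smul_sub,
    ← intervalIntegral.integral_sub (intervalIntegrable_comp_max hg _ _) (by simp), norm_smul,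
    norm_inv, Real.norm_of_nonneg hh0.le, inv_mul_lt_iff₀ hh0]
  nlinarith

section Derivative

variable {h t : ℝ}

lemma hasDerivWithinAt_timeAvg [CompleteSpace H] (hg : ContinuousOn g (Ici 0)) (hh : 0 ≤ h)
    (ht : 0 ≤ t) : HasDerivWithinAt (timeAvg h g) (timeDiff h g t) (Ici 0) t := by
  have hc := continuous_comp_max hg
  have hprim : ∀ s, 0 ≤ s → HasDerivAt (fun t => ∫ x in (0 : ℝ)..t, g (max x 0)) (g s) s := by
    intro s hs
    simpa only [max_eq_left hs] using intervalIntegral.integral_hasDerivAt_right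
      (hc.intervalIntegrable 0 s) (hc.stronglyMeasurableAtFilter _ _) hc.continuousAt
  have heq : timeAvg h g = fun t =>
      h⁻¹ • ((∫ x in (0 : ℝ)..t + h, g (max x 0)) - ∫ x in (0 : ℝ)..t, g (max x 0)) := by
    funext s
    rw [timeAvg, intervalIntegral.integral_interval_sub_left (intervalIntegrable_comp_max hg _ _)
      (intervalIntegrable_comp_max hg _ _)]
  rw [heq]
  exact ((((hprim (t + h) (add_nonneg ht hh)).comp_add_const t h).fun_sub
    (hprim t ht)).const_smul h⁻¹).hasDerivWithinAt

lemma continuousOn_timeAvg [CompleteSpace H] (hg : ContinuousOn g (Ici 0)) (hh : 0 ≤ h) :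
    ContinuousOn (timeAvg h g) (Ici 0) :=
  HasDerivWithinAt.continuousOn fun _ ht => hasDerivWithinAt_timeAvg hg hh ht

lemma mapsTo_add_const_Ici (hh : 0 ≤ h) : MapsTo (fun t : ℝ => t + h) (Ici 0) (Ici 0) :=
  fun _ ht => add_nonneg ht hh

lemma continuousOn_timeDiff (hg : ContinuousOn g (Ici 0)) (hh : 0 ≤ h) :
    ContinuousOn (timeDiff h g) (Ici 0) :=
  ((hg.comp (by fun_prop) (mapsTo_add_const_Ici hh)).sub hg).const_smul h⁻¹

lemma timeAvg_eq_timeDiff [CompleteSpace H] (hg' : ContinuousOn g' (Ici 0))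
    (hd : ∀ t ∈ Ici (0 : ℝ), HasDerivWithinAt g (g' t) (Ici 0) t) (hh : 0 ≤ h) (ht : 0 ≤ t) :
    timeAvg h g' t = timeDiff h g t := by
  have hsub : Icc t (t + h) ⊆ Ici (0 : ℝ) := fun x hx => ht.trans hx.1
  have hle : t ≤ t + h := by linarith
  rw [timeAvg, timeDiff, ← integral_eq_sub_of_hasDerivWithinAt hle
    (fun x hx => (hd x (hsub hx)).mono hsub) (hg'.mono hsub)]
  congr 1
  refine intervalIntegral.integral_congr fun x hx => ?_
  rw [uIcc_of_le hle] at hx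
  simp only [max_eq_left (mem_Ici.1 (hsub hx))]

end Derivative

section Map

variable {𝕜 : Type*} [RCLike 𝕜] [NormedSpace 𝕜 H] [IsScalarTower ℝ 𝕜 H] {E : Type*}
  [NormedAddCommGroup E] [NormedSpace 𝕜 E] [NormedSpace ℝ E] [IsScalarTower ℝ 𝕜 E]

lemma map_timeDiff (L : H →L[𝕜] E) (h : ℝ) (g : ℝ → H) (t : ℝ) :
    L (timeDiff h g t) = timeDiff h (fun s => L (g s)) t := by
  have hsmul : L (h⁻¹ • (g (t + h) - g t)) = h⁻¹ • L (g (t + h) - g t) :=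
    (L.restrictScalars ℝ).map_smul _ _
  rw [timeDiff, timeDiff, hsmul, map_sub]

lemma map_timeAvg [CompleteSpace H] [CompleteSpace E] (L : H →L[𝕜] E)
    (hg : ContinuousOn g (Ici 0)) (h t : ℝ) :
    L (timeAvg h g t) = timeAvg h (fun s => L (g s)) t := by
  have hsmul : L (timeAvg h g t) = h⁻¹ • L (∫ x in t..t + h, g (max x 0)) :=
    (L.restrictScalars ℝ).map_smul _ _
  rw [hsmul, timeAvg]
  congr 1
  exact ((L.restrictScalars ℝ).intervalIntegral_comp_comm
    (intervalIntegrable_comp_max hg t (t + h))).symm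

end Map

lemma timeAvg_eq_timeDiff_of_inner {𝕜 : Type*} [RCLike 𝕜] [InnerProductSpace 𝕜 H]
    [CompleteSpace H] [IsScalarTower ℝ 𝕜 H] (hg' : ContinuousOn g' (Ici 0))
    (hd : ∀ ψ : H, ∀ t ∈ Ici (0 : ℝ),
      HasDerivWithinAt (fun s => inner 𝕜 ψ (g s)) (inner 𝕜 ψ (g' t)) (Ici 0) t)
    {h t : ℝ} (hh : 0 ≤ h) (ht : 0 ≤ t) : timeAvg h g' t = timeDiff h g t := by
  refine ext_inner_left 𝕜 fun ψ => ?_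
  have havg := map_timeAvg (innerSL 𝕜 ψ) hg' h t
  have hdiff := map_timeDiff (innerSL 𝕜 ψ) h g t
  simp only [innerSL_apply_apply] at havg hdiff
  rw [havg, hdiff]
  exact timeAvg_eq_timeDiff (continuousOn_const.inner (𝕜 := 𝕜) hg') (hd ψ) hh ht

end TimeAverages

section Regularization

variable {𝕜 : Type*} [RCLike 𝕜] {H : Type*} [NormedAddCommGroup H] [InnerProductSpace 𝕜 H]
  [CompleteSpace H] {A : H →ₗ.[𝕜] H} {Λ : H →L[𝕜] H} [NormedSpace ℝ H]

section Weak

variable {f w v p : ℝ → H}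

lemma IsWeakSol.continuousOn_fst {S : Set ℝ} (hw : IsWeakSol A f S w v) : ContinuousOn w S :=
  HasDerivWithinAt.continuousOn hw.deriv_fst

lemma IsWeakSol.hasDerivWithinAt_inner {S : Set ℝ} {t : ℝ} (hw : IsWeakSol A f S w v)
    (hΛ : IsInvSqrt A Λ) (hA : A1 A) (ψ : H) (ht : t ∈ S) :
    HasDerivWithinAt (fun s => inner 𝕜 ψ (Λ (Λ (v s)))) (inner 𝕜 ψ (Λ (Λ (f t)) - w t)) S t := by
  obtain ⟨hmem, hAψ⟩ := hΛ.exists_apply_apply_mem_domain hA ψ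
  simpa only [hAψ, (hΛ.isSymmetric hA).apply_clm, inner_sub_right] using
    hw.deriv_snd ⟨_, hmem⟩ t ht

variable [IsScalarTower ℝ 𝕜 H] {h t : ℝ}

lemma IsWeakSol.apply_timeDiff (hw : IsWeakSol A f (Ici 0) w v)
    (hpw : ∀ t ∈ Ici (0 : ℝ), Λ (p t) = w t) (hh : 0 ≤ h) (ht : 0 ≤ t) :
    Λ (timeDiff h p t) = timeAvg h v t := by
  rw [timeAvg_eq_timeDiff hw.continuous_snd hw.deriv_fst hh ht, map_timeDiff, timeDiff, timeDiff,
    hpw t ht, hpw (t + h) (add_nonneg ht hh)]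

lemma IsWeakSol.apply_timeAvg_sub (hw : IsWeakSol A f (Ici 0) w v) (hΛ : IsInvSqrt A Λ)
    (hA : A1 A) (hf : ContinuousOn f (Ici 0)) (hp : ContinuousOn p (Ici 0))
    (hpw : ∀ t ∈ Ici (0 : ℝ), Λ (p t) = w t) (hh : 0 ≤ h) (ht : 0 ≤ t) :
    Λ (timeAvg h f t - timeDiff h v t) = timeAvg h p t := by
  have hΛΛf : ContinuousOn (fun s => Λ (Λ (f s))) (Ici 0) :=
    (Λ ∘L Λ).continuous.comp_continuousOn hf
  have hweak : timeAvg h (fun s => Λ (Λ (f s))) t - timeAvg h w t =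
      timeDiff h (fun s => Λ (Λ (v s))) t := by
    rw [← timeAvg_sub hΛΛf hw.continuousOn_fst]
    exact timeAvg_eq_timeDiff_of_inner (hΛΛf.sub hw.continuousOn_fst)
      (fun ψ s hs => hw.hasDerivWithinAt_inner hΛ hA ψ hs) hh ht
  have havg : Λ (Λ (timeAvg h f t)) = timeAvg h (fun s => Λ (Λ (f s))) t :=
    map_timeAvg (Λ ∘L Λ) hf h t
  have hdiff : Λ (Λ (timeDiff h v t)) = timeDiff h (fun s => Λ (Λ (v s))) t :=
    map_timeDiff (Λ ∘L Λ) h v t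
  refine hΛ.injective hA ?_
  rw [map_sub, map_sub, havg, hdiff, ← hweak, sub_sub_cancel, map_timeAvg Λ hp,
    timeAvg_congr hpw]

-- The first component is `A` applied to the average of `w`, read off the averaged equation.
lemma IsWeakSol.isWaveSol_timeAvg (hw : IsWeakSol A f (Ici 0) w v) (hΛ : IsInvSqrt A Λ)
    (hA : A1 A) (hf : ContinuousOn f (Ici 0)) (hp : ContinuousOn p (Ici 0))
    (hpw : ∀ t ∈ Ici (0 : ℝ), Λ (p t) = w t) (hh : 0 ≤ h) :
    IsWaveSol Λ (timeAvg h f) (Ici 0) (fun t => timeAvg h f t - timeDiff h v t)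
      (timeDiff h p) where
  continuous_source := continuousOn_timeAvg hf hh
  continuous_fst := (continuousOn_timeAvg hf hh).sub (continuousOn_timeDiff hw.continuous_snd hh)
  continuous_snd := continuousOn_timeDiff hp hh
  deriv_fst _ ht := (hasDerivWithinAt_timeAvg hp hh ht).congr
    (fun _ hs => hw.apply_timeAvg_sub hΛ hA hf hp hpw hh hs)
    (hw.apply_timeAvg_sub hΛ hA hf hp hpw hh ht)
  deriv_snd t ht := by
    have hderiv := (hasDerivWithinAt_timeAvg hw.continuous_snd hh ht).congr
      (fun _ hs => hw.apply_timeDiff hpw hh hs) (hw.apply_timeDiff hpw hh ht)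
    rwa [sub_sub_cancel]

end Weak

section Cascade

variable {C : ℕ → H →L[𝕜] H} {n : ℕ} {w v p : ℕ → ℝ → H}

lemma IsCascadeSol.continuousOn_source (hw : IsCascadeSol A C n w v) {i : ℕ} (hi : i ≤ n) :
    ContinuousOn (cascadeSource C w i) (Ici 0) := by
  unfold cascadeSource
  split_ifs with h2
  · exact ((C i).continuous.comp_continuousOn
      (hw (i - 1) (by omega) (by omega)).continuousOn_fst).neg
  · exact continuousOn_const

variable [IsScalarTower ℝ 𝕜 H]

lemma IsCascadeSol.isWaveCascade_timeAvg (hw : IsCascadeSol A C n w v) (hΛ : IsInvSqrt A Λ)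
    (hA : A1 A) (hp : ∀ i, 1 ≤ i → i ≤ n → ContinuousOn (p i) (Ici 0))
    (hpw : ∀ i, 1 ≤ i → i ≤ n → ∀ t ∈ Ici (0 : ℝ), Λ (p i t) = w i t) {h : ℝ} (hh : 0 ≤ h) :
    IsWaveCascade Λ C n (fun i t => timeAvg h (cascadeSource C w i) t - timeDiff h (v i) t)
      (fun i => timeDiff h (p i)) := by
  intro i h1 hi
  refine ((hw i h1 hi).isWaveSol_timeAvg hΛ hA (hw.continuousOn_source hi) (hp i h1 hi)
    (hpw i h1 hi) hh).congr_source fun t ht => ?_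
  by_cases h2 : 2 ≤ i
  · obtain ⟨hj1, hj⟩ : 1 ≤ i - 1 ∧ i - 1 ≤ n := by omega
    have hsource : timeAvg h (cascadeSource C w i) t = (-C i) (timeAvg h (w (i - 1)) t) := by
      rw [map_timeAvg _ (hw (i - 1) hj1 hj).continuousOn_fst]
      exact timeAvg_congr (fun s _ => by simp [cascadeSource, h2]) h t
    rw [hsource, waveSource, if_pos h2, (hw (i - 1) hj1 hj).apply_timeAvg_sub hΛ hA
      (hw.continuousOn_source hj) (hp _ hj1 hj) (hpw _ hj1 hj) hh ht, map_timeAvg Λ (hp _ hj1 hj),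
      timeAvg_congr (hpw _ hj1 hj), neg_apply]
  · simp [waveSource, cascadeSource, h2, timeAvg]

end Cascade

end Regularization

/-! ### Square integrable functions -/

section SquareIntegrable

variable {G : Type*} [NormedAddCommGroup G] {a b : ℝ}

lemma memLp_of_continuousOn_Icc {g : ℝ → G} (hg : ContinuousOn g (Icc a b)) (p : ENNReal) :
    MemLp g p (volume.restrict (Ioc a b)) := by
  obtain ⟨c, hc⟩ := isCompact_Icc.exists_bound_of_continuousOn hg
  refine MemLp.of_bound ((hg.mono Ioc_subset_Icc_self).aestronglyMeasurable measurableSet_Ioc) c ?_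
  filter_upwards [ae_restrict_mem measurableSet_Ioc] with t ht
  exact hc t (Ioc_subset_Icc_self ht)

lemma norm_toLp_two_sq (hab : a ≤ b) {g : ℝ → G} (hg : MemLp g 2 (volume.restrict (Ioc a b))) :
    ‖hg.toLp g‖ ^ 2 = ∫ t in a..b, ‖g t‖ ^ 2 := by
  have hint : 0 ≤ ∫ t in Ioc a b, ‖g t‖ ^ 2 := integral_nonneg fun t => sq_nonneg _
  rw [intervalIntegral.integral_of_le hab, Lp.norm_toLp,
    hg.eLpNorm_eq_integral_rpow_norm (by norm_num) (by norm_num),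
    ENNReal.toReal_ofReal (by positivity)]
  simp only [ENNReal.toReal_ofNat, Real.rpow_ofNat]
  exact_mod_cast Real.rpow_inv_natCast_pow hint two_ne_zero

variable {F : ℕ → ℝ → G}

lemma tendsto_integral_norm_sq (hab : a ≤ b) {y : ℝ → G}
    (hF : ∀ m, MemLp (F m) 2 (volume.restrict (Ioc a b)))
    (hy : MemLp y 2 (volume.restrict (Ioc a b)))
    (h : Tendsto (fun m => eLpNorm (F m - y) 2 (volume.restrict (Ioc a b))) atTop (𝓝 0)) :
    Tendsto (fun m => ∫ t in a..b, ‖F m t‖ ^ 2) atTop (𝓝 (∫ t in a..b, ‖y t‖ ^ 2)) := by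
  have hlim := ((Lp.tendsto_Lp_iff_tendsto_eLpNorm'' F hF y hy).2 h).norm.pow 2
  simpa only [norm_toLp_two_sq hab] using hlim

lemma exists_memLp_two_tendsto [CompleteSpace G] (hab : a ≤ b)
    (hF : ∀ m, MemLp (F m) 2 (volume.restrict (Ioc a b)))
    (hcauchy : ∀ ε > 0, ∃ N, ∀ m ≥ N, ∀ k ≥ N, ∫ t in a..b, ‖F m t - F k t‖ ^ 2 ≤ ε ^ 2) :
    ∃ y : ℝ → G, MemLp y 2 (volume.restrict (Ioc a b)) ∧
      Tendsto (fun m => eLpNorm (F m - y) 2 (volume.restrict (Ioc a b))) atTop (𝓝 0) := by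
  have hseq : CauchySeq fun m => (hF m).toLp (F m) := by
    refine Metric.cauchySeq_iff.2 fun ε hε => ?_
    obtain ⟨N, hN⟩ := hcauchy (ε / 2) (half_pos hε)
    refine ⟨N, fun m hm k hk => lt_of_le_of_lt ?_ (half_lt_self hε)⟩
    rw [dist_eq_norm, ← MemLp.toLp_sub]
    refine le_of_sq_le_sq ?_ (half_pos hε).le
    rw [norm_toLp_two_sq hab]
    exact hN m hm k hk
  obtain ⟨y, hy⟩ := cauchySeq_tendsto_of_complete hseq
  refine ⟨y, Lp.memLp y, (Lp.tendsto_Lp_iff_tendsto_eLpNorm'' F hF y (Lp.memLp y)).1 ?_⟩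
  rwa [Lp.toLp_coeFn]

end SquareIntegrable

/-! ### Observations of finite energy solutions -/

section Observation

variable {𝕜 : Type*} [RCLike 𝕜] {H : Type*} [NormedAddCommGroup H] [InnerProductSpace 𝕜 H]
  {Λ : H →L[𝕜] H} {C : ℕ → H →L[𝕜] H} {n : ℕ}
  {G : Type*} [NormedAddCommGroup G] [InnerProductSpace 𝕜 G] {b : H × H →L[𝕜] G}

lemma norm_waveSource_sub_le {r r' : ℕ → ℝ → H} {i : ℕ} {t e : ℝ} (he : 0 ≤ e)
    (h : 2 ≤ i → ‖Λ (r (i - 1) t) - Λ (r' (i - 1) t)‖ ≤ e) :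
    ‖waveSource Λ C r i t - waveSource Λ C r' i t‖ ≤ ‖C i‖ * ‖Λ‖ * e := by
  unfold waveSource
  split_ifs with hi
  · rw [neg_sub_neg, norm_sub_rev, ← map_sub, ← map_sub, mul_assoc]
    exact (C i).le_opNorm_of_le (Λ.le_opNorm_of_le (h hi))
  · rw [sub_self, norm_zero]
    positivity

lemma IsAdmissible.exists_integral_obs_sub_le [NormedSpace ℝ H] {T D : ℝ}
    (hadm : IsAdmissible Λ b T D) (hD : 0 ≤ D) (hT : 0 ≤ T) (hn : 1 ≤ n) (C : ℕ → H →L[𝕜] H) :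
    ∃ M : ℝ, 0 ≤ M ∧ ∀ (r q r' q' : ℕ → ℝ → H) (e : ℝ), 0 ≤ e → IsWaveCascade Λ C n r q →
      IsWaveCascade Λ C n r' q' →
      (∀ i, 1 ≤ i → i ≤ n → ∀ t ∈ Icc 0 T, ‖Λ (r i t) - Λ (r' i t)‖ ≤ e ∧
        ‖Λ (q i t) - Λ (q' i t)‖ ≤ e) →
      ∫ t in (0 : ℝ)..T, ‖b (r n t, q n t) - b (r' n t, q' n t)‖ ^ 2 ≤ (M * e) ^ 2 := by
  set c := ‖C n‖ * ‖Λ‖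
  refine ⟨√(D * (4 + 2 * T + T * c ^ 2)), Real.sqrt_nonneg _,
    fun r q r' q' e he hr hr' hclose => ?_⟩
  have hdiff := ((hr n hn le_rfl).sub (hr' n hn le_rfl)).mono
    (Icc_subset_Ici_self : Icc 0 T ⊆ Ici 0)
  have henergy : ∀ t ∈ Icc 0 T, waveEnergy Λ 0 (r n t - r' n t) (q n t - q' n t) ≤ 2 * e ^ 2 := by
    intro t ht
    obtain ⟨hrt, hqt⟩ := hclose n hn le_rfl t ht
    simp only [waveEnergy, pow_zero, one_apply_eq_self, map_sub]
    linarith [pow_le_pow_left₀ (norm_nonneg _) hrt 2, pow_le_pow_left₀ (norm_nonneg _) hqt 2]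
  have hsource : ∀ t ∈ Icc 0 T,
      ‖waveSource Λ C r n t - waveSource Λ C r' n t‖ ^ 2 ≤ c ^ 2 * e ^ 2 := by
    intro t ht
    rw [← mul_pow]
    exact pow_le_pow_left₀ (norm_nonneg _) (norm_waveSource_sub_le he fun h2 =>
      (hclose (n - 1) (by omega) (by omega) t ht).1) 2
  have hint : ∀ {g : ℝ → ℝ} {c : ℝ}, ContinuousOn g (Icc 0 T) → (∀ t ∈ Icc 0 T, g t ≤ c) →
      ∫ t in (0 : ℝ)..T, g t ≤ T * c := fun hg hgc =>
    (intervalIntegral.integral_mono_on hT (hg.intervalIntegrable_of_Icc hT)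
      intervalIntegrable_const hgc).trans_eq (by simp)
  have henergy_int : ∫ t in (0 : ℝ)..T, waveEnergy Λ 0 (r n t - r' n t) (q n t - q' n t) ≤
      T * (2 * e ^ 2) := hint (hdiff.continuousOn_energy 0) henergy
  have hsource_int : ∫ t in (0 : ℝ)..T, ‖waveSource Λ C r n t - waveSource Λ C r' n t‖ ^ 2 ≤
      T * (c ^ 2 * e ^ 2) := hint (hdiff.continuous_source.norm.pow 2) hsource
  rw [mul_pow, Real.sq_sqrt (by positivity), mul_assoc]
  simp only [← map_sub, Prod.mk_sub_mk]
  refine (hadm _ _ _ hdiff).trans (mul_le_mul_of_nonneg_left ?_ hD)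
  linarith [henergy 0 (left_mem_Icc.2 hT), henergy T (right_mem_Icc.2 hT)]

lemma exists_integral_obs_sub_le_of_tendstoUniformlyOn [NormedSpace ℝ H]
    {r q : ℕ → ℕ → ℝ → H} {p v : ℕ → ℝ → H} {T D : ℝ}
    (hadm : IsAdmissible Λ b T D) (hD : 0 ≤ D) (hT : 0 ≤ T) (hn : 1 ≤ n)
    (hrq : ∀ m, IsWaveCascade Λ C n (r m) (q m))
    (hlim : ∀ i, 1 ≤ i → i ≤ n →
      TendstoUniformlyOn (fun m t => Λ (r m i t)) (p i) atTop (Icc 0 T) ∧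
        TendstoUniformlyOn (fun m t => Λ (q m i t)) (v i) atTop (Icc 0 T)) {ε : ℝ} (hε : 0 < ε) :
    ∃ N, ∀ m ≥ N, ∀ k ≥ N, ∫ t in (0 : ℝ)..T,
      ‖b (r m n t, q m n t) - b (r k n t, q k n t)‖ ^ 2 ≤ ε ^ 2 := by
  obtain ⟨M, hM, hle⟩ := hadm.exists_integral_obs_sub_le hD hT hn C
  have hcauchy : ∀ᶠ N in atTop, ∀ i ∈ Finset.Icc 1 n, ∀ m ≥ N, ∀ k ≥ N, ∀ t ∈ Icc 0 T,
      ‖Λ (r m i t) - Λ (r k i t)‖ ≤ ε / (M + 1) ∧ ‖Λ (q m i t) - Λ (q k i t)‖ ≤ ε / (M + 1) := by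
    rw [Filter.eventually_all_finset]
    intro i hi
    obtain ⟨h1, hin⟩ := Finset.mem_Icc.1 hi
    obtain ⟨N₁, hN₁⟩ := Metric.uniformCauchySeqOn_iff.1 (hlim i h1 hin).1.uniformCauchySeqOn
      (ε / (M + 1)) (by positivity)
    obtain ⟨N₂, hN₂⟩ := Metric.uniformCauchySeqOn_iff.1 (hlim i h1 hin).2.uniformCauchySeqOn
      (ε / (M + 1)) (by positivity)
    simp only [dist_eq_norm] at hN₁ hN₂
    filter_upwards [eventually_ge_atTop N₁, eventually_ge_atTop N₂] with N h₁ h₂ m hm k hk t ht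
    exact ⟨(hN₁ m (h₁.trans hm) k (h₁.trans hk) t ht).le,
      (hN₂ m (h₂.trans hm) k (h₂.trans hk) t ht).le⟩
  obtain ⟨N, hN⟩ := hcauchy.exists
  refine ⟨N, fun m hm k hk => (hle _ _ _ _ _ (by positivity) (hrq m) (hrq k)
    fun i h1 hi t ht => hN i (Finset.mem_Icc.2 ⟨h1, hi⟩) m hm k hk t ht).trans ?_⟩
  refine pow_le_pow_left₀ (by positivity) ?_ 2
  rw [mul_div_left_comm]
  exact mul_le_of_le_one_right hε.le (div_le_one_of_le₀ (by linarith) (by linarith))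

variable [CompleteSpace H] {A : H →ₗ.[𝕜] H} {B : A.domain × H →ₗ[𝕜] G}

lemma IsInvSqrt.tendsto_energy (hΛ : IsInvSqrt A Λ) (hA : A1 A) (k : ℕ) {p v : H}
    {a b : ℕ → H} (ha : Tendsto a atTop (𝓝 p)) (hb : Tendsto b atTop (𝓝 v)) :
    Tendsto (fun m => energy A (1 - (k : ℤ)) (Λ (a m)) (b m)) atTop
      (𝓝 (energy A (1 - (k : ℤ)) (Λ p) v)) := by
  simp only [hΛ.energy_apply hA]
  have hsq : ∀ {x : ℕ → H} {y : H}, Tendsto x atTop (𝓝 y) →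
      Tendsto (fun m => ‖(Λ ^ k) (x m)‖ ^ 2) atTop (𝓝 (‖(Λ ^ k) y‖ ^ 2)) :=
    fun hx => (((Λ ^ k).continuous.tendsto _).comp hx).norm.pow 2
  exact ((hsq ha).add (hsq hb)).const_mul _

variable [NormedSpace ℝ H]

section MemLp

variable [IsScalarTower ℝ 𝕜 H]

lemma IsStrongCascadeSol.memLp_obs {w : ℕ → ℝ → A.domain} {v : ℕ → ℝ → H}
    (h : IsStrongCascadeSol A C n w v) (hA : A1 A) (hB : A4 A B) (hn : 1 ≤ n) (T : ℝ) :
    MemLp (fun t => B (w n t, v n t)) 2 (volume.restrict (Ioc 0 T)) := by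
  obtain ⟨Λ, hΛ⟩ := hA.exists_isInvSqrt
  obtain ⟨b, hb⟩ := hB.exists_obs hΛ hA
  obtain ⟨q, hq, hw⟩ := h.exists_isWaveCascade hΛ hA
  refine memLp_of_continuousOn_Icc ((((hw n hn le_rfl).continuousOn_obs b).mono
    Icc_subset_Ici_self).congr fun t ht => ?_) 2
  change _ = b (A (w n t), q n t)
  rw [hb, hΛ.lift_apply hA, hq n hn le_rfl t ht.1]

lemma IsObservation.energy_le {w v : ℕ → ℝ → H} {T : ℝ} {y : ℝ → G}
    (hy : IsObservation A C n B w v T y) (hw : IsCascadeSol A C n w v) (hA : A1 A) (hB : A4 A B)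
    (hT : 0 ≤ T) {i : ℕ} (h1 : 1 ≤ i) (hi : i ≤ n) {d : ℝ}
    (hd : ∀ (a : ℕ → ℝ → A.domain) (b : ℕ → ℝ → H), IsStrongCascadeSol A C n a b →
      energy A (1 + (i : ℤ) - (n : ℤ)) (a i 0) (b i 0) ≤
        d * ∫ t in (0 : ℝ)..T, ‖B (a n t, b n t)‖ ^ 2) :
    energy A (1 + (i : ℤ) - (n : ℤ)) (w i 0) (v i 0) ≤ d * ∫ t in (0 : ℝ)..T, ‖y t‖ ^ 2 := by
  obtain ⟨Λ, hΛ⟩ := hA.exists_isInvSqrt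
  obtain ⟨hy_memLp, a, b, hab, hinit, hlim⟩ := hy
  obtain ⟨p, hp⟩ := hΛ.exists_apply_eq_of_continuousInH hA (hw i h1 hi).continuous_fst
  have ha : Tendsto (fun m => Λ (A (a m i 0))) atTop (𝓝 (p 0)) := by
    rw [tendsto_iff_norm_sub_tendsto_zero]
    refine (hinit i h1 hi).1.congr fun m => ?_
    rw [← hΛ.apply_apply_apply hA (a m i 0), ← hp 0 self_mem_Ici, ← map_sub,
      hΛ.normH_one_apply hA]
  have henergy := hΛ.tendsto_energy hA (n - i) ha (hinit i h1 hi).2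
  rw [Nat.cast_sub hi, sub_sub_eq_add_sub] at henergy
  simp only [hΛ.apply_apply_apply hA, hp 0 self_mem_Ici] at henergy
  exact le_of_tendsto_of_tendsto' henergy ((tendsto_integral_norm_sq hT
    (fun m => (hab m).memLp_obs hA hB (h1.trans hi) T) hy_memLp hlim).const_mul d)
    fun m => hd _ _ (hab m)

end MemLp

variable [IsScalarTower ℝ 𝕜 H] {w v p : ℕ → ℝ → H} {T : ℝ}

lemma IsCascadeSol.exists_tendstoUniformlyOn (hw : IsCascadeSol A C n w v) (hΛ : IsInvSqrt A Λ)
    (hA : A1 A) (hpw : ∀ i, 1 ≤ i → i ≤ n → ∀ t ∈ Ici (0 : ℝ), Λ (p i t) = w i t) (T : ℝ) :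
    ∃ r q : ℕ → ℕ → ℝ → H, (∀ m, IsWaveCascade Λ C n (r m) (q m)) ∧ ∀ i, 1 ≤ i → i ≤ n →
      TendstoUniformlyOn (fun m t => Λ (r m i t)) (p i) atTop (Icc 0 T) ∧
        TendstoUniformlyOn (fun m t => Λ (q m i t)) (v i) atTop (Icc 0 T) := by
  have hp : ∀ i, 1 ≤ i → i ≤ n → ContinuousOn (p i) (Ici 0) := fun i h1 hi =>
    (hΛ.continuousInH_iff hA (hpw i h1 hi)).1 (hw i h1 hi).continuous_fst
  let h : ℕ → ℝ := fun m => 1 / ((m : ℝ) + 1)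
  have hpos : ∀ m, 0 < h m := fun m => Nat.one_div_pos_of_nat
  have hlim : Tendsto h atTop (𝓝[>] 0) := tendsto_nhdsWithin_iff.2
    ⟨tendsto_one_div_add_atTop_nhds_zero_nat, Eventually.of_forall hpos⟩
  refine ⟨_, _, fun m => hw.isWaveCascade_timeAvg hΛ hA hp hpw (hpos m).le, fun i h1 hi =>
    ⟨TendstoUniformlyOn.congr (F := fun m => timeAvg (h m) (p i))
        (fun u hu => hlim.eventually (tendstoUniformlyOn_timeAvg (hp i h1 hi) T u hu))
        (Eventually.of_forall fun m t ht => ?_),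
      TendstoUniformlyOn.congr (F := fun m => timeAvg (h m) (v i))
        (fun u hu => hlim.eventually
          (tendstoUniformlyOn_timeAvg (hw i h1 hi).continuous_snd T u hu))
        (Eventually.of_forall fun m t ht => ?_)⟩⟩
  · exact ((hw i h1 hi).apply_timeAvg_sub hΛ hA (hw.continuousOn_source hi) (hp i h1 hi)
      (hpw i h1 hi) (hpos m).le ht.1).symm
  · exact ((hw i h1 hi).apply_timeDiff (hpw i h1 hi) (hpos m).le ht.1).symm

lemma IsCascadeSol.exists_isObservation [CompleteSpace G] (hw : IsCascadeSol A C n w v)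
    (hA : A1 A) (hB : A4 A B) (hn : 1 ≤ n) (hT : 0 < T) :
    ∃ y : ℝ → G, IsObservation A C n B w v T y := by
  obtain ⟨Λ, hΛ⟩ := hA.exists_isInvSqrt
  obtain ⟨b, hb⟩ := hB.exists_obs hΛ hA
  obtain ⟨D, hD, hadm⟩ := hB.exists_isAdmissible hΛ hA hb hT
  choose! p hpw using fun i h1 hi =>
    hΛ.exists_apply_eq_of_continuousInH hA (hw i h1 hi).continuous_fst
  obtain ⟨r, q, hrq, hlim⟩ := hw.exists_tendstoUniformlyOn hΛ hA hpw T
  have hstrong := fun m => (hrq m).isStrongCascadeSol hΛ hA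
  have hcauchy := fun ε (hε : 0 < ε) =>
    exists_integral_obs_sub_le_of_tendstoUniformlyOn hadm hD.le hT.le hn hrq hlim hε
  simp only [hb] at hcauchy
  obtain ⟨y, hy, hy_lim⟩ := exists_memLp_two_tendsto hT.le
    (fun m => (hstrong m).memLp_obs hA hB hn T) hcauchy
  have h0 : (0 : ℝ) ∈ Icc 0 T := left_mem_Icc.2 hT.le
  refine ⟨y, hy, _, _, hstrong, fun i h1 hi => ⟨?_, (hlim i h1 hi).2.tendsto_at h0⟩, hy_lim⟩
  refine (tendsto_iff_norm_sub_tendsto_zero.1 ((hlim i h1 hi).1.tendsto_at h0)).congr fun m => ?_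
  rw [hΛ.coe_lift hA, ← hpw i h1 hi 0 self_mem_Ici, ← map_sub, hΛ.normH_one_apply hA]

end Observation

end CascadeObs

open CascadeObs in
theorem theorem2p5_general {𝕜 H G : Type*} [RCLike 𝕜]
    [NormedAddCommGroup H] [InnerProductSpace 𝕜 H] [CompleteSpace H]
    [NormedSpace ℝ H] [IsScalarTower ℝ 𝕜 H]
    [NormedAddCommGroup G] [InnerProductSpace 𝕜 G] [CompleteSpace G]
    {A : H →ₗ.[𝕜] H} (hA1 : A1 A) {n : ℕ} (hn : 1 ≤ n) {C P : ℕ → H →L[𝕜] H}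
    (hbounded : ∀ i k : ℕ, 2 ≤ i → i ≤ n → k + i ≤ n + 1 → ∃ c : ℝ, ∀ u : H, MemH A k u →
      MemH A k (ContinuousLinearMap.adjoint (C i) u) ∧
        normH A k (ContinuousLinearMap.adjoint (C i) u) ≤ c * normH A k u)
    (hcoercive : ∀ i : ℕ, 2 ≤ i → i ≤ n → ∃ α : ℝ, 0 < α ∧ ∀ w : H,
      α * ‖P i w‖ ^ 2 ≤ RCLike.re (inner 𝕜 (C i w) w))
    (hA3 : A3 A P n) {B : A.domain × H →ₗ[𝕜] G} (hA4 : A4 A B) (hA5 : A5 A B) :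
    ∃ Tstar K : ℝ, 1 ≤ Tstar ∧ 0 < K ∧
      ∀ w v : ℕ → ℝ → H, IsCascadeSol A C n w v → ∀ T : ℝ, Tstar < T →
        (∃ y : ℝ → G, IsObservation A C n B w v T y) ∧
        ∀ y : ℝ → G, IsObservation A C n B w v T y → ∀ i, 1 ≤ i → i ≤ n →
          energy A (1 + (i : ℤ) - (n : ℤ)) (w i 0) (v i 0) ≤
            K / T ^ (2 * (n - i) + 1) * ∫ t in (0 : ℝ)..T, ‖y t‖ ^ 2 := by
  obtain ⟨Λ, hΛ⟩ := hA1.exists_isInvSqrt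
  obtain ⟨b, hb⟩ := hA4.exists_obs hΛ hA1
  have hobservable : IsObservable Λ C n b :=
    (hA5.isObserver hA4 hΛ hA1 hb).isObservable (hΛ.isSymmetric hA1) (hΛ.hasFreeSol hA1)
      (hΛ.isCoupling hA1 hbounded hcoercive) (hA3.observesVelocity hΛ hA1) hn
  obtain ⟨Tstar, K, hTstar, hK, hobs⟩ := hobservable.exists_observesStrong hΛ hA1 hb
  refine ⟨Tstar, K, hTstar, hK, fun w v hw T hT => ⟨?_, fun y hy i h1 hi => ?_⟩⟩
  · exact hw.exists_isObservation hA1 hA4 hn (by linarith)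
  · exact hy.energy_le hw hA1 hA4 (by linarith) h1 hi fun a b hab => hobs a b hab T hT i h1 hi

open CascadeObs in
theorem theorem2p5 {𝕜 H G : Type*} [RCLike 𝕜]
    [NormedAddCommGroup H] [InnerProductSpace 𝕜 H] [CompleteSpace H]
    [NormedSpace ℝ H] [IsScalarTower ℝ 𝕜 H]
    [NormedAddCommGroup G] [InnerProductSpace 𝕜 G] [CompleteSpace G]
    (A : H →ₗ.[𝕜] H) (hA1 : A1 A)
    (n : ℕ) (hn : 2 ≤ n)
    (C P : ℕ → H →L[𝕜] H) (hA2 : A2 A C P n) (hA3 : A3 A P n)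
    (B : A.domain × H →ₗ[𝕜] G) (hA4 : A4 A B) (hA5 : A5 A B) :
    ∃ (Tstar K : ℝ) (d : ℕ → ℝ → ℝ), 0 < Tstar ∧ 0 < K ∧
      (∀ T : ℝ, Tstar < T →
        (∀ i, 1 ≤ i → i ≤ n → 0 < d i T) ∧
        (∀ i, 1 ≤ i → i < n → d i T ≤ K / T ^ 3) ∧
        d n T ≤ K / T) ∧
      ∀ w v : ℕ → ℝ → H, IsCascadeSol A C n w v → ∀ T : ℝ, Tstar < T →
        (∃ y : ℝ → G, IsObservation A C n B w v T y) ∧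
        ∀ y : ℝ → G, IsObservation A C n B w v T y → ∀ i, 1 ≤ i → i ≤ n →
          energy A (1 + (i : ℤ) - (n : ℤ)) (w i 0) (v i 0) ≤
            d i T * ∫ t in (0 : ℝ)..T, ‖y t‖ ^ 2 := by
  obtain ⟨Tstar, K, hTstar, hK, hobs⟩ := theorem2p5_general hA1 (one_le_two.trans hn)
    hA2.adjoint_bounded hA2.coercive hA3 hA4 hA5
  exact ⟨Tstar, K, fun i T => K / T ^ (2 * (n - i) + 1), by linarith, hK, fun T hT =>
    ⟨fun i _ _ => div_pos hK (pow_pos (by linarith) _), fun i _ hi =>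
      div_le_div_of_nonneg_left hK.le (pow_pos (by linarith) 3)
        (pow_le_pow_right₀ (by linarith) (by omega)), by simp⟩, hobs⟩
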